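/- Let $b\ge 2$, $\Lambda=\{0,\dots,b-1\}$, and let $\Sigma=\Lambda^{\mathbb N}$ be the space of sequences $x=x_1x_2\cdots$, with the metric $d(x,y)=e^{-\min\{n\ge 1:\,x_n\ne y_n\}}$ for $x\neq y$ and its Borel $\sigma$-field. Write $x|_n=x_1\cdots x_n$, and $[x|_n]$ for the set of sequences that begin with $x|_n$. Let $\{X_u\}$, indexed by the nonempty finite words $u$ over $\Lambda$, be i.i.d. nonnegative random variables on a probability space $(\Omega,\mathcal A,\mathbb P)$ with the law of a random variable $X$ such that $\mathbb E(X)=1$, and put $h_X=\mathbb E(X\log X)\in[0,\infty]$ (with $0\log 0=0$) and $Q_n(\omega,x)=X_{x|_1}(\omega)\cdots X_{x|_n}(\omega)$. Let $\nu$ be a Borel probability measure on $\Sigma$. Almost surely, the measures $Q_n\cdot\nu$ (of density $Q_n(\omega,\cdot)$ with respect to $\nu$) converge weakly as $n\to\infty$ to a finite measure, denoted by $Q\cdot\nu$. One says that $\nu$ is $Q$-regular if $\mathbb E\big((Q\cdot\nu)(\Sigma)\big)=\nu(\Sigma)$, and $Q$-singular if $Q\cdot\nu=0$ almost surely. For a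 finite Borel measure $\mu$ on $\Sigma$ put $$\underline{\dim}_{\rm loc}(\mu,x)=\liminf_{n\to\infty}\frac{-\log\mu([x|_n])}{n},\qquad \underline{\dim}_H(\mu)=\inf\{\dim_H E: E \text{ Borel},\ \mu(E)>0\},$$ $$\overline{\dim}_H(\mu)=\inf\{\dim_H E: E \text{ Borel},\ \mu(\Sigma\setminus E)=0\},\qquad \overline{\dim}_P(\mu)=\inf\{\dim_P E: E \text{ Borel},\ \mu(\Sigma\setminus E)=0\},$$ where $\dim_H$ and $\dim_P$ are the Hausdorff and packing dimensions with respect to $d$. **Theorem.** (a) If $\underline{\dim}_{\rm loc}(\nu,x)>h_X$ for $\nu$-almost every $x\in\Sigma$, then $\nu$ is $Q$-regular. This holds (both the hypothesis and the conclusion) in particular if $\underline{\dim}_H(\nu)>h_X$. (b) If $\underline{\dim}_{\rm loc}(\nu,x)<h_X$ for $\nu$-almost every $x\in\Sigma$, then $\nu$ is $Q$-singular. This holds (both the hypothesis and the conclusion) in particular if $\overline{\dim}_H(\nu)<h_X$. (c) Under the hypothesis of (a), almost surely on the event $\{Q\cdot\nu\neq 0\}$, $$\underline{\dim}_H(\nu)-h_X\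 \le\ \underline{\dim}_H(Q\cdot\nu)\ \le\ \overline{\dim}_P(Q\cdot\nu)\ \le\ \overline{\dim}_P(\nu)-h_X .$$ -/

import Mathlib

open MeasureTheory ProbabilityTheory Filter
open scoped NNReal ENNReal Topology

namespace MandelbrotCascade

/-! ### The symbolic space -/

/-- The one-sided symbolic space over the alphabet `{0, …, b-1}`. The letter `x i` of a sequence
is the one usually written `x_{i+1}`. -/
def SymbolicSpace (b : ℕ) : Type := ℕ → Fin b

variable {b : ℕ}

/-- The standard ultrametric: `d x y = exp (-min {n ≥ 1 : x_n ≠ y_n})` for `x ≠ y`, letters being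
numbered from `1`. (`PiNat.firstDiff` numbers them from `0`, whence the `+ 1`.) -/
noncomputable def symbolicDist (x y : SymbolicSpace b) : ℝ :=
  open Classical in
  if x = y then 0 else Real.exp (-((PiNat.firstDiff (E := fun _ => Fin b) x y : ℝ) + 1))

theorem symbolicDist_nonneg (x y : SymbolicSpace b) : 0 ≤ symbolicDist x y := by
  unfold symbolicDist
  split_ifs
  · exact le_rfl
  · exact (Real.exp_pos _).le

theorem symbolicDist_triangle (x y z : SymbolicSpace b) :
    symbolicDist x z ≤ symbolicDist x y + symbolicDist y z := by
  by_cases hxz : x = z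
  · have h : symbolicDist x z = 0 := by simp [symbolicDist, hxz]
    rw [h]
    exact add_nonneg (symbolicDist_nonneg _ _) (symbolicDist_nonneg _ _)
  by_cases hxy : x = y
  · subst hxy
    linarith [symbolicDist_nonneg x x]
  by_cases hyz : y = z
  · subst hyz
    linarith [symbolicDist_nonneg y y]
  have key := PiNat.min_firstDiff_le (E := fun _ => Fin b) x y z hxz
  rcases min_le_iff.1 key with h | h
  · have h1 : symbolicDist x z ≤ symbolicDist x y := by
      simp only [symbolicDist, hxz, hxy, if_false]
      apply Real.exp_le_exp.2
      have : ((PiNat.firstDiff (E := fun _ => Fin b) x y : ℕ) : ℝ) ≤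
        (PiNat.firstDiff (E := fun _ => Fin b) x z : ℕ) := by exact_mod_cast h
      linarith
    linarith [symbolicDist_nonneg y z]
  · have h1 : symbolicDist x z ≤ symbolicDist y z := by
      simp only [symbolicDist, hxz, hyz, if_false]
      apply Real.exp_le_exp.2
      have : ((PiNat.firstDiff (E := fun _ => Fin b) y z : ℕ) : ℝ) ≤
        (PiNat.firstDiff (E := fun _ => Fin b) x z : ℕ) := by exact_mod_cast h
      linarith
    linarith [symbolicDist_nonneg x y]

noncomputable instance : MetricSpace (SymbolicSpace b) where
  dist := symbolicDist
  dist_self x := by simp [symbolicDist]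
  dist_comm x y := by
    by_cases h : x = y
    · rw [h]
    · simp only [symbolicDist, h, Ne.symm h, if_false,
        PiNat.firstDiff_comm (E := fun _ => Fin b) x y]
  dist_triangle := symbolicDist_triangle
  eq_of_dist_eq_zero {x y} h := by
    by_contra hne
    change symbolicDist x y = 0 at h
    simp only [symbolicDist, hne, if_false] at h
    exact (Real.exp_pos _).ne' h

noncomputable instance : MeasurableSpace (SymbolicSpace b) := borel _

instance : BorelSpace (SymbolicSpace b) := ⟨rfl⟩

/-- The word `x|_n` made of the first `n` letters of `x`. -/
def prefixWord (x : SymbolicSpace b) (n : ℕ) : List (Fin b) := List.ofFn fun i : Fin n => x i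

/-- The cylinder `[x|_n]`: the sequences with the same first `n` letters as `x`. -/
def cylinder (x : SymbolicSpace b) (n : ℕ) : Set (SymbolicSpace b) :=
  {y | prefixWord y n = prefixWord x n}

/-! ### Dimensions -/

/-- The lower local dimension `liminf_n -log μ([x|_n]) / n`. -/
noncomputable def lowerLocalDim (μ : Measure (SymbolicSpace b)) (x : SymbolicSpace b) : EReal :=
  liminf (fun n : ℕ => -ENNReal.log (μ (cylinder x n)) / (n : EReal)) atTop

section Dimensions

variable {T : Type*} [MetricSpace T]

/-- The upper box-counting (Minkowski) dimension
`limsup_{ε → 0+} log N(A, ε) / log (1 / ε)`, where `N(A, ε)` is the least number of closed balls of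
radius `ε` that cover `A` (it is `0` for `A = ∅`). -/
noncomputable def upperBoxDim (A : Set T) : ℝ≥0∞ :=
  (limsup (fun ε : ℝ≥0 =>
    ENNReal.log ((Metric.externalCoveringNumber ε A : ℕ∞) : ℝ≥0∞) /
      ((-Real.log (ε : ℝ) : ℝ) : EReal)) (𝓝[>] 0)).toENNReal

/-- The packing dimension, as the upper modified box-counting dimension:
`inf {sup_i (upper box dimension of A i) : A ⊆ ⋃ i, A i}` over countable covers. -/
noncomputable def packingDim (A : Set T) : ℝ≥0∞ :=
  ⨅ (s : ℕ → Set T) (_ : A ⊆ ⋃ i, s i), ⨆ i, upperBoxDim (s i)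

variable [MeasurableSpace T]

/-- Lower Hausdorff dimension of a measure. -/
noncomputable def lowerHausdorffDim (μ : Measure T) : ℝ≥0∞ :=
  ⨅ (E : Set T) (_ : MeasurableSet E) (_ : 0 < μ E), dimH E

/-- Upper Hausdorff dimension of a measure. -/
noncomputable def upperHausdorffDim (μ : Measure T) : ℝ≥0∞ :=
  ⨅ (E : Set T) (_ : MeasurableSet E) (_ : μ Eᶜ = 0), dimH E

/-- Upper packing dimension of a measure. -/
noncomputable def upperPackingDim (μ : Measure T) : ℝ≥0∞ :=
  ⨅ (E : Set T) (_ : MeasurableSet E) (_ : μ Eᶜ = 0), packingDim E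

end Dimensions

/-! ### Mandelbrot multiplicative cascades -/

variable {Ω : Type*}

/-- The weights `X u`, indexed by the nonempty words `u`, are i.i.d. nonnegative random variables
of law `ρ` and expectation `1`. (The value of `X` at the empty word is never used.) -/
structure IsCascade [MeasurableSpace Ω] (P : Measure Ω) (ρ : Measure ℝ≥0)
    (X : List (Fin b) → Ω → ℝ≥0) : Prop where
  measurable : ∀ u, u ≠ [] → Measurable (X u)
  indep : iIndepFun (fun u : {u : List (Fin b) // u ≠ []} => X u) P
  law : ∀ u, u ≠ [] → P.map (X u) = ρ
  mean : ∫⁻ t, (t : ℝ≥0∞) ∂ρ = 1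

/-- `h_X = E (X log X)` for `X` of law `ρ`: expectation of the positive part minus expectation of
the negative part, the latter being at most `1 / e` when `ρ` is a probability measure. -/
noncomputable def cascadeEntropy (ρ : Measure ℝ≥0) : EReal :=
  ((∫⁻ t, ENNReal.ofReal ((t : ℝ) * Real.log t) ∂ρ : ℝ≥0∞) : EReal) -
    ((∫⁻ t, ENNReal.ofReal (-((t : ℝ) * Real.log t)) ∂ρ : ℝ≥0∞) : EReal)

/-- `Q_n(ω, x) = X_{x|_1}(ω) ⋯ X_{x|_n}(ω)`. -/
def cascadeDensity (X : List (Fin b) → Ω → ℝ≥0) (n : ℕ) (ω : Ω) (x : SymbolicSpace b) : ℝ≥0 :=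
  ∏ k ∈ Finset.range n, X (prefixWord x (k + 1)) ω

theorem exists_cascadeDensity_le (X : List (Fin b) → Ω → ℝ≥0) (n : ℕ) (ω : Ω) :
    ∃ C : ℝ≥0, ∀ x : SymbolicSpace b, cascadeDensity X n ω x ≤ C := by
  induction n with
  | zero => exact ⟨1, fun x => by simp [cascadeDensity]⟩
  | succ n ih =>
    obtain ⟨C, hC⟩ := ih
    refine ⟨C * ∑ v : Fin (n + 1) → Fin b, X (List.ofFn v) ω, fun x => ?_⟩
    have h : cascadeDensity X (n + 1) ω x =
        cascadeDensity X n ω x * X (prefixWord x (n + 1)) ω := by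
      simp [cascadeDensity, Finset.prod_range_succ]
    rw [h]
    exact mul_le_mul' (hC x) (Finset.single_le_sum
      (f := fun v : Fin (n + 1) → Fin b => X (List.ofFn v) ω) (fun _ _ => zero_le)
      (Finset.mem_univ fun i : Fin (n + 1) => x i))

/-- The finite random measure `ν_n = Q_n · ν`. -/
noncomputable def cascadeMeasure (X : List (Fin b) → Ω → ℝ≥0) (ν : Measure (SymbolicSpace b))
    [IsFiniteMeasure ν] (n : ℕ) (ω : Ω) : FiniteMeasure (SymbolicSpace b) :=
  ⟨ν.withDensity fun x => (cascadeDensity X n ω x : ℝ≥0∞), isFiniteMeasure_withDensity (by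
    obtain ⟨C, hC⟩ := exists_cascadeDensity_le X n ω
    refine ((lintegral_mono fun x => ENNReal.coe_le_coe.2 (hC x)).trans_lt ?_).ne
    rw [lintegral_const]
    exact ENNReal.mul_lt_top ENNReal.coe_lt_top (measure_lt_top ν _))⟩

open Classical in
/-- The random measure `Q · ν`: the weak limit of the measures `Q_n · ν` wherever it exists (and `0`
on the exceptional event where it does not). -/
noncomputable def limitMeasure (X : List (Fin b) → Ω → ℝ≥0) (ν : Measure (SymbolicSpace b))
    [IsFiniteMeasure ν] (ω : Ω) : FiniteMeasure (SymbolicSpace b) :=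
  if h : ∃ μ : FiniteMeasure (SymbolicSpace b),
      Tendsto (fun n => cascadeMeasure X ν n ω) atTop (𝓝 μ) then h.choose else 0

/-- `ν` is `Q`-regular: the expected total mass of `Q · ν` is the total mass of `ν`. -/
def IsQRegular [MeasurableSpace Ω] (P : Measure Ω) (X : List (Fin b) → Ω → ℝ≥0)
    (ν : Measure (SymbolicSpace b)) [IsFiniteMeasure ν] : Prop :=
  ∫⁻ ω, (limitMeasure X ν ω : Measure (SymbolicSpace b)) Set.univ ∂P = ν Set.univ

/-- `ν` is `Q`-singular: `Q · ν = 0` almost surely. -/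
def IsQSingular [MeasurableSpace Ω] (P : Measure Ω) (X : List (Fin b) → Ω → ℝ≥0)
    (ν : Measure (SymbolicSpace b)) [IsFiniteMeasure ν] : Prop :=
  ∀ᵐ ω ∂P, limitMeasure X ν ω = 0

end MandelbrotCascade

open MandelbrotCascade

/-! The proof follows a random ray. Under `levelMeasure`, which is Q_N(ω,x) P(dω) ν(dx), the ray x
has law ν, and the first N weights along it are independent of x and i.i.d. with the size-biased law
t ρ(dt) (`IsCascade.levelMeasure_spine`). The mean of log under that law is h_X, so the strong law
of large numbers makes Q_n behave like e^{n h_X} along the ray (`ae_pathLaw_eventually_le`,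
`ae_pathLaw_eventually_ge`; truncating log from above covers h_X = ∞). Whether Q_n ν([x|_n])
explodes or decays is thus decided by comparing the local dimension of ν with h_X.

Singularity. If the lower local dimension is below h_X, then Q_n ν([x|_n]) is almost surely
unbounded along the ray. It is the mass of a cylinder under Q_n·ν, hence at most the total mass M_n,
so the expectation of M_N on {M_n ≤ K for all n ≤ N} tends to 0. Since M_n converges, it stays below
some K, and Fatou's lemma forces its limit to vanish.

Regularity. Fix x and average over the weights off its ray. Sorting the points of [x|_n] by the
length k of their common prefix with x bounds the conditional mean of (Q_N·ν)([x|_n]) by `spineSum`,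
the sum of Q_k ν([x|_k]) over n ≤ k ≤ N. This gives a conditional Markov inequality
(`IsCascade.mul_levelMeasure_le`). When the local dimension exceeds h_X these sums are bounded
uniformly in N, so M_N is tight under the level measures, which is uniform integrability under P,
and the expectation 1 survives in the limit.

Dimensions. Regularity makes `peyriereMeasure`, that is (Q·ν)(ω,dx) P(dω), agree with the level
measures on events of finite level (`peyriereMeasure_eq`), so the ray still has law ν and its
weights still have law `pathLaw`. Two Borel–Cantelli arguments compare (Q·ν)([x|_n]) with Q_n
ν([x|_n]) from below (`ae_eventually_le_limitMeasure`) and with the tail of the spine sum from above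
(`ae_eventually_limitMeasure_le`), up to factors e^{±εn}. The resulting bounds on cylinder masses
become dimension bounds through the mass distribution principle, a covering argument and box
counting. -/

namespace MandelbrotCascade

variable {b : ℕ}

/-! ### Topology and measure theory of the symbolic space -/

/-- The first `n` letters of a sequence. -/
def firstLetters (n : ℕ) (x : SymbolicSpace b) : Fin n → Fin b := fun i => x i

theorem prefixWord_eq_ofFn (x : SymbolicSpace b) (n : ℕ) :
    prefixWord x n = List.ofFn (firstLetters n x) := rfl

theorem prefixWord_inj {x y : SymbolicSpace b} {n : ℕ} :
    prefixWord x n = prefixWord y n ↔ ∀ i < n, x i = y i := by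
  rw [prefixWord_eq_ofFn, prefixWord_eq_ofFn, List.ofFn_inj]
  constructor
  · intro h i hi
    exact congrFun h ⟨i, hi⟩
  · intro h
    funext i
    exact h i i.2

theorem mem_cylinder_iff {x y : SymbolicSpace b} {n : ℕ} :
    y ∈ cylinder x n ↔ ∀ i < n, y i = x i := prefixWord_inj

theorem firstLetters_eq_iff {x y : SymbolicSpace b} {n : ℕ} :
    firstLetters n y = firstLetters n x ↔ y ∈ cylinder x n := by
  rw [cylinder, Set.mem_ofPred_eq, prefixWord_eq_ofFn, prefixWord_eq_ofFn, List.ofFn_inj]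

theorem cylinder_eq_preimage (x : SymbolicSpace b) (n : ℕ) :
    cylinder x n = firstLetters n ⁻¹' {firstLetters n x} := by
  ext y
  simp [firstLetters_eq_iff]

theorem self_mem_cylinder (x : SymbolicSpace b) (n : ℕ) : x ∈ cylinder x n :=
  mem_cylinder_iff.2 fun _ _ => rfl

theorem cylinder_anti (x : SymbolicSpace b) {m n : ℕ} (h : m ≤ n) :
    cylinder x n ⊆ cylinder x m := fun _ hy =>
  mem_cylinder_iff.2 fun i hi => mem_cylinder_iff.1 hy i (hi.trans_le h)

theorem mem_cylinder_comm {x y : SymbolicSpace b} {n : ℕ} :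
    y ∈ cylinder x n ↔ x ∈ cylinder y n := by
  simp [cylinder, eq_comm]

theorem cylinder_eq_of_mem {x y : SymbolicSpace b} {n : ℕ} (h : y ∈ cylinder x n) :
    cylinder y n = cylinder x n := by
  rw [cylinder_eq_preimage, cylinder_eq_preimage, firstLetters_eq_iff.2 h]

theorem cylinder_zero (x : SymbolicSpace b) : cylinder x 0 = Set.univ :=
  Set.eq_univ_of_forall fun _ => mem_cylinder_iff.2 fun _ hi => absurd hi (Nat.not_lt_zero _)

theorem mem_cylinder_iff_le_firstDiff {x y : SymbolicSpace b} (hne : x ≠ y) (n : ℕ) :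
    y ∈ cylinder x n ↔ n ≤ PiNat.firstDiff (E := fun _ => Fin b) x y := by
  rw [mem_cylinder_comm, mem_cylinder_iff]
  exact PiNat.mem_cylinder_iff_le_firstDiff (E := fun _ => Fin b) hne n

theorem dist_eq_exp_firstDiff {x y : SymbolicSpace b} (hne : x ≠ y) :
    dist x y = Real.exp (-((PiNat.firstDiff (E := fun _ => Fin b) x y : ℝ) + 1)) := by
  change symbolicDist x y = _
  simp [symbolicDist, hne]

theorem dist_le_exp_iff {x y : SymbolicSpace b} {n : ℕ} :
    dist x y ≤ Real.exp (-((n : ℝ) + 1)) ↔ y ∈ cylinder x n := by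
  by_cases hne : x = y
  · subst hne
    simp [self_mem_cylinder, Real.exp_nonneg]
  · rw [dist_eq_exp_firstDiff hne, mem_cylinder_iff_le_firstDiff hne, Real.exp_le_exp]
    constructor
    · intro h
      have : (n : ℝ) ≤ (PiNat.firstDiff (E := fun _ => Fin b) x y : ℕ) := by linarith
      exact_mod_cast this
    · intro h
      have : (n : ℝ) ≤ (PiNat.firstDiff (E := fun _ => Fin b) x y : ℕ) := by exact_mod_cast h
      linarith

theorem dist_lt_exp_iff {x y : SymbolicSpace b} {n : ℕ} :
    dist x y < Real.exp (-(n : ℝ)) ↔ y ∈ cylinder x n := by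
  by_cases hne : x = y
  · subst hne
    simp [self_mem_cylinder, Real.exp_pos]
  · rw [dist_eq_exp_firstDiff hne, mem_cylinder_iff_le_firstDiff hne, Real.exp_lt_exp]
    constructor
    · intro h
      have : (n : ℝ) < ((PiNat.firstDiff (E := fun _ => Fin b) x y : ℕ) + 1 : ℕ) := by
        push_cast
        linarith
      have := Nat.cast_lt.1 this
      omega
    · intro h
      have : (n : ℝ) ≤ (PiNat.firstDiff (E := fun _ => Fin b) x y : ℕ) := by exact_mod_cast h
      linarith

theorem cylinder_eq_ball (x : SymbolicSpace b) (n : ℕ) :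
    cylinder x n = Metric.ball x (Real.exp (-(n : ℝ))) := by
  ext y
  rw [Metric.mem_ball, dist_comm, dist_lt_exp_iff]

theorem cylinder_eq_closedBall (x : SymbolicSpace b) (n : ℕ) :
    cylinder x n = Metric.closedBall x (Real.exp (-((n : ℝ) + 1))) := by
  ext y
  rw [Metric.mem_closedBall, dist_comm, dist_le_exp_iff]

theorem isClopen_cylinder (x : SymbolicSpace b) (n : ℕ) : IsClopen (cylinder x n) :=
  ⟨cylinder_eq_closedBall x n ▸ Metric.isClosed_closedBall,
    cylinder_eq_ball x n ▸ Metric.isOpen_ball⟩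

theorem measurableSet_cylinder (x : SymbolicSpace b) (n : ℕ) : MeasurableSet (cylinder x n) :=
  (isClopen_cylinder x n).isOpen.measurableSet

theorem measurable_firstLetters (n : ℕ) : Measurable (firstLetters n : SymbolicSpace b → _) := by
  refine measurable_to_countable' fun v => ?_
  by_cases h : ∃ x, firstLetters n x = v
  · obtain ⟨x, rfl⟩ := h
    rw [← cylinder_eq_preimage]
    exact measurableSet_cylinder x n
  · have : firstLetters n ⁻¹' {v} = (∅ : Set (SymbolicSpace b)) :=
      Set.eq_empty_of_forall_notMem fun x hx => h ⟨x, hx⟩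
    rw [this]
    exact MeasurableSet.empty

theorem exp_neg_natCast_tendsto_zero :
    Tendsto (fun n : ℕ => Real.exp (-(n : ℝ))) atTop (𝓝 0) :=
  Real.tendsto_exp_neg_atTop_nhds_zero.comp tendsto_natCast_atTop_atTop

theorem exists_cylinder_subset {s : Set (SymbolicSpace b)} (hs : IsOpen s) {x : SymbolicSpace b}
    (hx : x ∈ s) : ∃ n, cylinder x n ⊆ s := by
  obtain ⟨ε, hε, h⟩ := Metric.isOpen_iff.1 hs x hx
  obtain ⟨n, hn⟩ := (exp_neg_natCast_tendsto_zero.eventually (gt_mem_nhds hε)).exists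
  exact ⟨n, (cylinder_eq_ball x n ▸ Metric.ball_subset_ball hn.le).trans h⟩

/-- Tychonoff: the identity from the product of finite discrete spaces is onto, and it is continuous
because a ball is determined by finitely many letters. -/
instance : CompactSpace (SymbolicSpace b) := by
  let f : (ℕ → Fin b) → SymbolicSpace b := id
  have hf : Continuous f := by
    rw [continuous_iff_continuousAt]
    intro x
    rw [ContinuousAt, Metric.tendsto_nhds]
    intro ε hε
    obtain ⟨n, hn⟩ := (exp_neg_natCast_tendsto_zero.eventually (gt_mem_nhds hε)).exists
    have h : ∀ i ∈ Finset.range n, ∀ᶠ y in 𝓝 x, y i = x i := fun i _ =>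
      ((continuous_apply i).tendsto x).eventually
        ((isOpen_discrete {x i}).mem_nhds rfl)
    filter_upwards [(Filter.eventually_all_finset _).2 h] with y hy
    refine lt_trans ?_ hn
    rw [dist_comm, dist_lt_exp_iff, mem_cylinder_iff]
    exact fun i hi => hy i (Finset.mem_range.2 hi)
  have hsurj : Set.range f = Set.univ := Set.range_eq_univ.2 fun x => ⟨x, rfl⟩
  exact ⟨hsurj ▸ isCompact_range hf⟩

/-- The family of cylinders, together with the empty set. -/
def cylinderFamily (b : ℕ) : Set (Set (SymbolicSpace b)) :=
  insert ∅ (Set.range fun p : SymbolicSpace b × ℕ => cylinder p.1 p.2)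

/-- Two cylinders with a common point are nested; the longer one is the intersection. -/
theorem isPiSystem_cylinderFamily : IsPiSystem (cylinderFamily b) := by
  rintro s (rfl | ⟨⟨x, n⟩, rfl⟩) t (rfl | ⟨⟨y, m⟩, rfl⟩) ⟨z, hz⟩
  · simp at hz
  · simp at hz
  · simp at hz
  · right
    simp only at hz ⊢
    rcases le_total n m with h | h
    · refine ⟨(y, m), ?_⟩
      change cylinder _ _ = _
      rw [← cylinder_eq_of_mem hz.1, ← cylinder_eq_of_mem hz.2]
      exact (Set.inter_eq_right.2 (cylinder_anti z h)).symm
    · refine ⟨(x, n), ?_⟩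
      change cylinder _ _ = _
      rw [← cylinder_eq_of_mem hz.1, ← cylinder_eq_of_mem hz.2]
      exact (Set.inter_eq_left.2 (cylinder_anti z h)).symm

theorem borel_eq_generateFrom_cylinderFamily :
    (inferInstance : MeasurableSpace (SymbolicSpace b)) =
      MeasurableSpace.generateFrom (cylinderFamily b) := by
  apply le_antisymm
  · change borel _ ≤ _
    refine MeasurableSpace.generateFrom_le fun s hs => ?_
    have hs : IsOpen s := hs
    -- There are only countably many finite words, so this union of cylinders contained in `s` is
    -- countable.
    have h : s = ⋃ n : ℕ, ⋃ v ∈ {v : Fin n → Fin b | firstLetters n ⁻¹' {v} ⊆ s},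
        (firstLetters n ⁻¹' {v} : Set (SymbolicSpace b)) := by
      ext x
      simp only [Set.mem_iUnion]
      constructor
      · intro hx
        obtain ⟨n, hn⟩ := exists_cylinder_subset hs hx
        exact ⟨n, firstLetters n x, by simpa [cylinder_eq_preimage] using hn, rfl⟩
      · rintro ⟨n, v, hv, hx⟩
        exact hv hx
    rw [h]
    refine MeasurableSet.iUnion fun n => MeasurableSet.biUnion (Set.to_countable _) fun v _ => ?_
    apply MeasurableSpace.measurableSet_generateFrom
    by_cases h : ∃ x, firstLetters n x = v
    · obtain ⟨x, rfl⟩ := h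
      rw [← cylinder_eq_preimage]
      exact Or.inr ⟨(x, n), rfl⟩
    · left
      exact Set.eq_empty_of_forall_notMem fun x hx => h ⟨x, hx⟩
  · refine MeasurableSpace.generateFrom_le ?_
    rintro s (rfl | ⟨⟨x, n⟩, rfl⟩)
    · exact MeasurableSet.empty
    · exact measurableSet_cylinder x n

theorem measure_ext_of_cylinder {μ μ' : Measure (SymbolicSpace b)} [IsFiniteMeasure μ]
    (h : ∀ x n, μ (cylinder x n) = μ' (cylinder x n)) : μ = μ' := by
  refine ext_of_generate_finite _ borel_eq_generateFrom_cylinderFamily isPiSystem_cylinderFamily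
    ?_ ?_
  · rintro s (rfl | ⟨⟨x, n⟩, rfl⟩)
    · simp
    · exact h x n
  · by_cases hne : Nonempty (SymbolicSpace b)
    · obtain ⟨x⟩ := hne
      simpa [cylinder_zero] using h x 0
    · have : (Set.univ : Set (SymbolicSpace b)) = ∅ :=
        Set.eq_empty_of_forall_notMem fun x _ => hne ⟨x⟩
      simp [this]

theorem lintegral_firstLetters (μ : Measure (SymbolicSpace b)) (n : ℕ)
    (g : (Fin n → Fin b) → ℝ≥0∞) :
    ∫⁻ x, g (firstLetters n x) ∂μ = ∑ v, g v * μ (firstLetters n ⁻¹' {v}) := by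
  rw [← lintegral_map (f := g) (measurable_of_countable _) (measurable_firstLetters n),
    lintegral_fintype]
  refine Finset.sum_congr rfl fun v _ => ?_
  rw [Measure.map_apply (measurable_firstLetters n) (measurableSet_singleton v)]

/-- The measure of a cylinder is a function of finitely many letters. -/
theorem measure_cylinder_eq_comp_firstLetters (μ : Measure (SymbolicSpace b)) (n : ℕ) :
    (fun x => μ (cylinder x n)) =
      (fun v => μ (firstLetters n ⁻¹' {v})) ∘ firstLetters n := by
  funext x
  rw [cylinder_eq_preimage]
  rfl

theorem measurable_measure_cylinder (μ : Measure (SymbolicSpace b)) (n : ℕ) :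
    Measurable fun x => μ (cylinder x n) := by
  rw [measure_cylinder_eq_comp_firstLetters]
  exact (measurable_of_countable _).comp (measurable_firstLetters n)

theorem ediam_cylinder_le (x : SymbolicSpace b) (n : ℕ) :
    Metric.ediam (cylinder x n) ≤ ENNReal.ofReal (Real.exp (-((n : ℝ) + 1))) := by
  refine Metric.ediam_le fun y hy z hz => ?_
  rw [edist_dist]
  refine ENNReal.ofReal_le_ofReal (dist_le_exp_iff.2 ?_)
  rw [cylinder_eq_of_mem hy]
  exact hz

end MandelbrotCascade

namespace MandelbrotCascade

variable {b : ℕ}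

/-! ### Exponential rates -/

/-- The exponential rate `e^{-n a}` as an extended nonnegative real. -/
noncomputable def expDecay (a : ℝ) (n : ℕ) : ℝ≥0∞ := ENNReal.ofReal (Real.exp (-(n * a)))

theorem expDecay_pos (a : ℝ) (n : ℕ) : 0 < expDecay a n :=
  ENNReal.ofReal_pos.2 (Real.exp_pos _)

theorem expDecay_ne_top (a : ℝ) (n : ℕ) : expDecay a n ≠ ∞ := ENNReal.ofReal_ne_top

theorem expDecay_add (a c : ℝ) (n : ℕ) : expDecay (a + c) n = expDecay a n * expDecay c n := by
  rw [expDecay, expDecay, expDecay, ← ENNReal.ofReal_mul (Real.exp_nonneg _), ← Real.exp_add]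
  congr 2
  ring

theorem expDecay_eq_pow (a : ℝ) (n : ℕ) :
    expDecay a n = ENNReal.ofReal (Real.exp (-a)) ^ n := by
  rw [expDecay, ← ENNReal.ofReal_pow (Real.exp_nonneg _), ← Real.exp_nat_mul]
  congr 2
  ring

theorem expDecay_rate_lt_one {a : ℝ} (ha : 0 < a) : ENNReal.ofReal (Real.exp (-a)) < 1 := by
  rw [← ENNReal.ofReal_one]
  exact (ENNReal.ofReal_lt_ofReal_iff one_pos).2 (by simpa using ha)

theorem tsum_expDecay_ne_top {a : ℝ} (ha : 0 < a) : ∑' n, expDecay a n ≠ ∞ := by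
  simp_rw [expDecay_eq_pow, ENNReal.tsum_geometric]
  exact ENNReal.inv_ne_top.2 (tsub_pos_of_lt (expDecay_rate_lt_one ha)).ne'

theorem tendsto_expDecay {a : ℝ} (ha : 0 < a) : Tendsto (expDecay a) atTop (𝓝 0) :=
  ENNReal.tendsto_atTop_zero_of_tsum_ne_top (tsum_expDecay_ne_top ha)

theorem expDecay_neg_mul (a : ℝ) (n : ℕ) : expDecay (-a) n * expDecay a n = 1 := by
  rw [← expDecay_add, expDecay]
  simp

theorem tendsto_expDecay_top {a : ℝ} (ha : a < 0) : Tendsto (expDecay a) atTop (𝓝 ∞) := by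
  have h : expDecay a = fun n => (expDecay (-a) n)⁻¹ := by
    funext n
    refine ENNReal.eq_inv_of_mul_eq_one_left ?_
    have := expDecay_neg_mul (-a) n
    rwa [neg_neg] at this
  rw [h, ← ENNReal.inv_zero]
  exact (tendsto_expDecay (neg_pos.2 ha)).inv

theorem log_expDecay (a : ℝ) (n : ℕ) : ENNReal.log (expDecay a n) = ((-(n * a) : ℝ) : EReal) := by
  rw [expDecay, ENNReal.log_ofReal_of_pos (Real.exp_pos _), Real.log_exp]

/-- This and the next lemma translate local dimensions into exponential bounds on masses, including
the masses 0 and ∞. Only n = 0 has to be avoided. -/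
theorem neg_log_div_le_iff {m : ℝ≥0∞} {n : ℕ} (hn : 0 < n) {a : ℝ} :
    -ENNReal.log m / (n : EReal) ≤ a ↔ expDecay a n ≤ m := by
  have hn' : (0 : EReal) < n := by exact_mod_cast hn
  rw [EReal.div_le_iff_le_mul hn' (EReal.natCast_ne_top n), EReal.neg_le, ← ENNReal.log_le_log_iff,
    log_expDecay]
  norm_cast

theorem le_neg_log_div_iff {m : ℝ≥0∞} {n : ℕ} (hn : 0 < n) {a : ℝ} :
    a ≤ -ENNReal.log m / (n : EReal) ↔ m ≤ expDecay a n := by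
  have hn' : (0 : EReal) < n := by exact_mod_cast hn
  rw [EReal.le_div_iff_mul_le hn' (EReal.natCast_ne_top n), EReal.le_neg, ← ENNReal.log_le_log_iff,
    log_expDecay, mul_comm]
  norm_cast

/-! ### Local dimensions -/

variable {μ : Measure (SymbolicSpace b)}

theorem le_lowerLocalDim_of_eventually {a : ℝ} {x : SymbolicSpace b}
    (h : ∀ᶠ n in atTop, μ (cylinder x n) ≤ expDecay a n) : (a : EReal) ≤ lowerLocalDim μ x := by
  refine le_liminf_of_le (by isBoundedDefault) ?_
  filter_upwards [h, eventually_gt_atTop 0] with n hn h0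
  exact (le_neg_log_div_iff h0).2 hn

theorem lowerLocalDim_le_of_frequently {a : ℝ} {x : SymbolicSpace b}
    (h : ∃ᶠ n in atTop, expDecay a n ≤ μ (cylinder x n)) : lowerLocalDim μ x ≤ a := by
  refine liminf_le_of_frequently_le ?_ (by isBoundedDefault)
  refine (h.and_eventually (eventually_gt_atTop 0)).mono fun n hn => ?_
  exact (neg_log_div_le_iff hn.2).2 hn.1

theorem eventually_of_lt_lowerLocalDim {a : ℝ} {x : SymbolicSpace b}
    (h : (a : EReal) < lowerLocalDim μ x) : ∀ᶠ n in atTop, μ (cylinder x n) ≤ expDecay a n := by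
  filter_upwards [eventually_lt_of_lt_liminf h (by isBoundedDefault), eventually_gt_atTop 0]
    with n hn h0
  exact (le_neg_log_div_iff h0).1 hn.le

theorem frequently_of_lowerLocalDim_lt {a : ℝ} {x : SymbolicSpace b}
    (h : lowerLocalDim μ x < a) : ∃ᶠ n in atTop, expDecay a n ≤ μ (cylinder x n) := by
  refine ((frequently_lt_of_liminf_lt (by isBoundedDefault) h).and_eventually
    (eventually_gt_atTop 0)).mono fun n hn => ?_
  exact (neg_log_div_le_iff hn.2).1 hn.1.le

theorem lowerLocalDim_nonneg [IsFiniteMeasure μ] (x : SymbolicSpace b) :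
    0 ≤ lowerLocalDim μ x := by
  refine EReal.ge_of_forall_gt_iff_ge.1 fun a ha => ?_
  have ha : a < 0 := by exact_mod_cast ha
  refine le_lowerLocalDim_of_eventually ?_
  -- For a negative rate the bound e^{-na} tends to infinity and eventually exceeds the total mass.
  filter_upwards [(tendsto_expDecay_top ha).eventually (lt_mem_nhds (measure_lt_top μ Set.univ))]
    with n hn
  exact (measure_mono (Set.subset_univ _)).trans hn.le

/-! ### Hausdorff dimension and local dimensions -/

theorem sum_measure_firstLetters (n : ℕ) :
    ∑ v, μ (firstLetters n ⁻¹' {v}) = μ Set.univ := by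
  simpa using (lintegral_firstLetters μ n fun _ => 1).symm

/-- For every N the heavy cylinders of length n ≥ N cover the set. A heavy cylinder has diameter to
the power c at most e^{-cn} ≤ e^{-(c-a)n} μ(cylinder), so the cylinders of length n contribute at
most e^{-(c-a)n} times the total mass. The tails of this geometric series tend to 0. -/
theorem hausdorffMeasure_frequently_eq_zero [IsFiniteMeasure μ] {a c : ℝ} (hc : 0 < c)
    (hac : a < c) :
    Measure.hausdorffMeasure c {x | ∃ᶠ n in atTop, expDecay a n ≤ μ (cylinder x n)} = 0 := by
  classical
  -- Light words are replaced by the empty set, which contributes 0 to the sum because c > 0.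
  let t : ∀ N : ℕ, (Σ n : ℕ, (Fin (n + N) → Fin b)) → Set (SymbolicSpace b) := fun N p =>
    if expDecay a (p.1 + N) ≤ μ (firstLetters (p.1 + N) ⁻¹' {p.2}) then
      firstLetters (p.1 + N) ⁻¹' {p.2} else ∅
  have hdiam : ∀ N p, Metric.ediam (t N p) ≤
      ENNReal.ofReal (Real.exp (-(((p.1 + N : ℕ) : ℝ)))) := by
    intro N p
    simp only [t]
    split_ifs with h
    · by_cases hv : ∃ x, firstLetters (p.1 + N) x = p.2
      · obtain ⟨x, hx⟩ := hv
        rw [← hx, ← cylinder_eq_preimage]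
        refine (ediam_cylinder_le x _).trans (ENNReal.ofReal_le_ofReal (Real.exp_le_exp.2 ?_))
        linarith
      · have : firstLetters (p.1 + N) ⁻¹' {p.2} = (∅ : Set (SymbolicSpace b)) :=
          Set.eq_empty_of_forall_notMem fun x hx => hv ⟨x, hx⟩
        simp [this]
    · simp
  have hterm : ∀ N p, Metric.ediam (t N p) ^ c ≤
      expDecay (c - a) (p.1 + N) * μ (firstLetters (p.1 + N) ⁻¹' {p.2}) := by
    intro N p
    by_cases h : expDecay a (p.1 + N) ≤ μ (firstLetters (p.1 + N) ⁻¹' {p.2})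
    · calc Metric.ediam (t N p) ^ c
          ≤ ENNReal.ofReal (Real.exp (-(((p.1 + N : ℕ) : ℝ)))) ^ c :=
            ENNReal.rpow_le_rpow (hdiam N p) hc.le
        _ = expDecay c (p.1 + N) := by
            rw [ENNReal.ofReal_rpow_of_pos (Real.exp_pos _), ← Real.exp_mul, expDecay]
            congr 2
            ring
        _ = expDecay (c - a) (p.1 + N) * expDecay a (p.1 + N) := by
            rw [← expDecay_add, sub_add_cancel]
        _ ≤ _ := by gcongr
    · simp only [t, if_neg h, Metric.ediam_empty, ENNReal.zero_rpow_of_pos hc]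
      exact zero_le
  have hsum : ∀ N, ∑' p, Metric.ediam (t N p) ^ c ≤
      (∑' n, expDecay (c - a) (n + N)) * μ Set.univ := by
    intro N
    calc ∑' p, Metric.ediam (t N p) ^ c
        ≤ ∑' p : (Σ n : ℕ, (Fin (n + N) → Fin b)),
            expDecay (c - a) (p.1 + N) * μ (firstLetters (p.1 + N) ⁻¹' {p.2}) :=
          ENNReal.tsum_le_tsum (hterm N)
      _ = ∑' n, expDecay (c - a) (n + N) * μ Set.univ := by
          rw [ENNReal.tsum_sigma']
          refine tsum_congr fun n => ?_
          dsimp only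
          rw [tsum_fintype, ← Finset.mul_sum, sum_measure_firstLetters]
      _ = _ := ENNReal.tsum_mul_right
  have hlim : Tendsto (fun N => (∑' n, expDecay (c - a) (n + N)) * μ Set.univ) atTop (𝓝 0) := by
    have := ENNReal.Tendsto.mul_const
      (ENNReal.tendsto_sum_nat_add _ (tsum_expDecay_ne_top (sub_pos.2 hac)))
      (b := μ Set.univ) (Or.inr (measure_ne_top _ _))
    simpa using this
  refine le_antisymm ?_ zero_le
  refine (Measure.hausdorffMeasure_le_liminf_tsum c _ (l := atTop)
    (fun N : ℕ => ENNReal.ofReal (Real.exp (-(N : ℝ)))) ?_ t ?_ ?_).trans ?_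
  · simpa using ENNReal.tendsto_ofReal exp_neg_natCast_tendsto_zero
  · refine Eventually.of_forall fun N p => (hdiam N p).trans
      (ENNReal.ofReal_le_ofReal (Real.exp_le_exp.2 ?_))
    push_cast
    linarith [(Nat.cast_nonneg p.1 : (0 : ℝ) ≤ p.1)]
  · refine Eventually.of_forall fun N x hx => ?_
    obtain ⟨n, hn, hxn⟩ := frequently_atTop.1 hx N
    obtain ⟨k, rfl⟩ := Nat.exists_eq_add_of_le' hn
    refine Set.mem_iUnion.2 ⟨⟨k, firstLetters (k + N) x⟩, ?_⟩
    simp only [t, ← cylinder_eq_preimage]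
    rw [if_pos hxn]
    exact self_mem_cylinder _ _
  · rw [← hlim.liminf_eq]
    exact liminf_le_liminf (Eventually.of_forall hsum)

theorem measurableSet_frequently (a : ℝ) :
    MeasurableSet {x | ∃ᶠ n in atTop, expDecay a n ≤ μ (cylinder x n)} := by
  have h : {x | ∃ᶠ n in atTop, expDecay a n ≤ μ (cylinder x n)} =
      limsup (fun n => {x | expDecay a n ≤ μ (cylinder x n)}) atTop := by
    ext x
    rw [mem_limsup_iff_frequently_mem]
    rfl
  rw [h]
  exact MeasurableSet.measurableSet_limsup fun n =>
    measurableSet_le measurable_const (measurable_measure_cylinder μ n)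

/-- The Borel set where μ([x|_n]) ≥ e^{-an} infinitely often has dimension at most a, by the
previous covering bound with exponents decreasing to a. If a is below the lower Hausdorff dimension,
that set must be null. Rational a suffice. -/
theorem ae_lowerHausdorffDim_le_lowerLocalDim (μ : Measure (SymbolicSpace b))
    [IsFiniteMeasure μ] :
    ∀ᵐ x ∂μ, (lowerHausdorffDim μ : EReal) ≤ lowerLocalDim μ x := by
  have key : ∀ a : ℚ, ∀ᵐ x ∂μ, 0 ≤ (a : ℝ) → ((a : ℝ) : EReal) < (lowerHausdorffDim μ : EReal) →
      ∀ᶠ n in atTop, μ (cylinder x n) ≤ expDecay a n := by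
    intro a
    by_cases h : 0 ≤ (a : ℝ) ∧ ((a : ℝ) : EReal) < (lowerHausdorffDim μ : EReal)
    · have h0 : μ {x | ∃ᶠ n in atTop, expDecay a n ≤ μ (cylinder x n)} = 0 := by
        by_contra hne
        have hle : lowerHausdorffDim μ ≤
            dimH {x | ∃ᶠ n in atTop, expDecay a n ≤ μ (cylinder x n)} :=
          iInf_le_of_le _ (iInf_le_of_le (measurableSet_frequently _)
            (iInf_le_of_le (pos_iff_ne_zero.2 hne) le_rfl))
        have hdim : dimH {x | ∃ᶠ n in atTop, expDecay a n ≤ μ (cylinder x n)} ≤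
            ENNReal.ofReal a := by
          refine ENNReal.le_of_forall_pos_le_add fun ε hε _ => ?_
          have hz := hausdorffMeasure_frequently_eq_zero (μ := μ) (a := a) (c := a + ε)
            (add_pos_of_nonneg_of_pos h.1 hε) (lt_add_of_pos_right _ hε)
          have := dimH_le_of_hausdorffMeasure_ne_top (d := (a : ℝ).toNNReal + ε)
            (s := {x | ∃ᶠ n in atTop, expDecay a n ≤ μ (cylinder x n)}) (by
              rw [NNReal.coe_add, Real.coe_toNNReal _ h.1, hz]
              exact ENNReal.zero_ne_top)
          simpa [ENNReal.ofReal] using this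
        have h2 := hle.trans hdim
        have h3 : (lowerHausdorffDim μ : EReal) ≤ ((a : ℝ) : EReal) := by
          have := EReal.coe_ennreal_le_coe_ennreal_iff.2 h2
          rwa [EReal.coe_ennreal_ofReal, max_eq_left h.1] at this
        exact absurd h.2 (not_lt.2 h3)
      rw [measure_eq_zero_iff_ae_notMem] at h0
      filter_upwards [h0] with x hx _ _
      have hx : ¬ ∃ᶠ n in atTop, expDecay a n ≤ μ (cylinder x n) := hx
      rw [not_frequently] at hx
      exact hx.mono fun n hn => (not_le.1 hn).le
    · exact ae_of_all _ fun x h1 h2 => absurd ⟨h1, h2⟩ h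
  filter_upwards [ae_all_iff.2 key] with x hx
  by_contra hlt
  obtain ⟨q, hq1, hq2⟩ := EReal.lt_iff_exists_rat_btwn.1 (not_le.1 hlt)
  have hq0 : 0 ≤ (q : ℝ) := by
    have := (lowerLocalDim_nonneg (μ := μ) x).trans hq1.le
    exact_mod_cast this
  exact absurd (le_lowerLocalDim_of_eventually (hx q hq0 hq2)) (not_le.2 hq1)

/-- The mass distribution principle. -/
theorem measure_inter_eventually_eq_zero [IsFiniteMeasure μ] {E : Set (SymbolicSpace b)} {a : ℝ≥0}
    (hE : dimH E < a) :
    μ (E ∩ {x | ∀ᶠ n in atTop, μ (cylinder x n) ≤ expDecay a n}) = 0 := by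
  have ha : 0 < a := by
    have := (zero_le (a := dimH E)).trans_lt hE
    exact_mod_cast this
  let A : ℕ → Set (SymbolicSpace b) := fun N => {x | ∀ n, N ≤ n → μ (cylinder x n) ≤ expDecay a n}
  have hAm : ∀ N, MeasurableSet (A N) := by
    intro N
    have : A N = ⋂ n, ⋂ (_ : N ≤ n), {x | μ (cylinder x n) ≤ expDecay a n} := by
      ext x
      simp [A]
    rw [this]
    exact MeasurableSet.iInter fun n => MeasurableSet.iInter fun _ =>
      measurableSet_le (measurable_measure_cylinder μ n) measurable_const
  -- A set of diameter in [e^{-(m+1)}, e^{-m}) that meets `A N` lies in one cylinder of length m, of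
  -- mass at most e^{-am}. The factor e^{-a} pays for the ratio of consecutive scales.
  have hle : ∀ N, expDecay a 1 • μ.restrict (A N) ≤ Measure.hausdorffMeasure (a : ℝ) := by
    intro N
    refine Measure.le_hausdorffMeasure _ _ (ENNReal.ofReal (Real.exp (-((N : ℝ) + 1))))
      (ENNReal.ofReal_pos.2 (Real.exp_pos _)) fun s hs => ?_
    rw [Measure.smul_apply, Measure.restrict_apply' (hAm N), smul_eq_mul]
    rcases (s ∩ A N).eq_empty_or_nonempty with h | ⟨x, hxs, hxA⟩
    · simp [h]
    have hsub : ∀ m : ℕ, Metric.ediam s < ENNReal.ofReal (Real.exp (-(m : ℝ))) →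
        s ⊆ cylinder x m := by
      intro m hm y hy
      rw [← dist_lt_exp_iff]
      have := (Metric.edist_le_ediam_of_mem hxs hy).trans_lt hm
      rw [edist_dist] at this
      exact (ENNReal.ofReal_lt_ofReal_iff (Real.exp_pos _)).1 this
    by_cases hex : ∃ m : ℕ, ENNReal.ofReal (Real.exp (-((m : ℝ) + 1))) ≤ Metric.ediam s
    · classical
      let m := Nat.find hex
      have hm : ENNReal.ofReal (Real.exp (-((m : ℝ) + 1))) ≤ Metric.ediam s := Nat.find_spec hex
      have hNm : N ≤ m := by
        have h1 := (ENNReal.ofReal_le_ofReal_iff (Real.exp_nonneg _)).1 (hm.trans hs)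
        have h2 := Real.exp_le_exp.1 h1
        have : (N : ℝ) ≤ m := by linarith
        exact_mod_cast this
      have hlt : Metric.ediam s < ENNReal.ofReal (Real.exp (-(m : ℝ))) := by
        rcases Nat.eq_zero_or_pos m with h0 | h0
        · rw [h0]
          refine hs.trans_lt ((ENNReal.ofReal_lt_ofReal_iff (Real.exp_pos _)).2
            (Real.exp_lt_exp.2 ?_))
          have : (0 : ℝ) ≤ N := Nat.cast_nonneg N
          push_cast
          linarith
        · have := Nat.find_min hex (Nat.sub_lt h0 one_pos)
          rw [not_le] at this
          have h1 : (((m - 1 : ℕ) : ℝ) + 1) = m := by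
            rw [Nat.cast_sub h0]
            simp
          rwa [h1] at this
      calc expDecay a 1 * μ (s ∩ A N) ≤ expDecay a 1 * expDecay a m := by
            gcongr
            exact (measure_mono (Set.inter_subset_left.trans (hsub m hlt))).trans (hxA m hNm)
        _ = ENNReal.ofReal (Real.exp (-((m : ℝ) + 1))) ^ (a : ℝ) := by
            rw [ENNReal.ofReal_rpow_of_pos (Real.exp_pos _), ← Real.exp_mul, expDecay, expDecay,
              ← ENNReal.ofReal_mul (Real.exp_nonneg _), ← Real.exp_add]
            congr 2
            push_cast
            ring
        _ ≤ _ := ENNReal.rpow_le_rpow hm a.2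
    -- Here the diameter is below every scale, so the set lies in arbitrarily long cylinders around
    -- x, whose masses tend to 0 since a > 0.
    · have hz : μ (s ∩ A N) = 0 := by
        refine le_antisymm ?_ zero_le
        refine ge_of_tendsto (tendsto_expDecay (a := a) (by exact_mod_cast ha)) ?_
        filter_upwards [eventually_ge_atTop (N + 1)] with m hm
        obtain ⟨k, rfl⟩ := Nat.exists_eq_add_of_le' (show 1 ≤ m by omega)
        have h1 : Metric.ediam s < ENNReal.ofReal (Real.exp (-((k + 1 : ℕ) : ℝ))) := by
          push_cast
          exact not_le.1 fun h => hex ⟨k, h⟩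
        exact (measure_mono (Set.inter_subset_left.trans (hsub _ h1))).trans
          (hxA _ (by omega))
      simp [hz]
  have hnull : ∀ N, μ (E ∩ A N) = 0 := by
    intro N
    have h1 := hle N E
    rw [hausdorffMeasure_of_dimH_lt hE, Measure.smul_apply, Measure.restrict_apply' (hAm N),
      smul_eq_mul, nonpos_iff_eq_zero, mul_eq_zero] at h1
    exact h1.resolve_left (expDecay_pos _ _).ne'
  refine measure_mono_null ?_ (measure_iUnion_null hnull)
  rintro x ⟨hxE, hx⟩
  obtain ⟨N, hN⟩ := eventually_atTop.1 hx
  exact Set.mem_iUnion.2 ⟨N, hxE, hN⟩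

theorem ae_lowerLocalDim_le_of_dimH [IsFiniteMeasure μ] {E : Set (SymbolicSpace b)}
    (hE : μ Eᶜ = 0) : ∀ᵐ x ∂μ, lowerLocalDim μ x ≤ (dimH E : EReal) := by
  have key : ∀ q : ℚ, ∀ᵐ x ∂μ, (dimH E : EReal) < ((q : ℝ) : EReal) →
      ¬ ∀ᶠ n in atTop, μ (cylinder x n) ≤ expDecay q n := by
    intro q
    by_cases h : (dimH E : EReal) < ((q : ℝ) : EReal)
    · have hq : 0 ≤ (q : ℝ) := by
        have := (EReal.coe_ennreal_nonneg (dimH E)).trans h.le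
        exact_mod_cast this
      have hq' : dimH E < ((q : ℝ).toNNReal : ℝ≥0∞) := by
        rw [← EReal.coe_ennreal_lt_coe_ennreal_iff]
        change _ < ((ENNReal.ofReal (q : ℝ) : ℝ≥0∞) : EReal)
        rwa [EReal.coe_ennreal_ofReal, max_eq_left hq]
      have h0 := measure_inter_eventually_eq_zero (μ := μ) hq'
      rw [Real.coe_toNNReal _ hq] at h0
      rw [measure_eq_zero_iff_ae_notMem] at h0 hE
      filter_upwards [h0, hE] with x hx hxE _ hev
      exact hx ⟨by simpa using hxE, hev⟩
    · exact ae_of_all _ fun x h1 => absurd h1 h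
  filter_upwards [ae_all_iff.2 key] with x hx
  by_contra hlt
  obtain ⟨q, hq1, hq2⟩ := EReal.lt_iff_exists_rat_btwn.1 (not_le.1 hlt)
  exact hx q hq1 (eventually_of_lt_lowerLocalDim hq2)

/-- A set of positive mass and dimension below q < d would contradict the mass distribution
principle, since almost every x has μ([x|_n]) ≤ e^{-qn} eventually. The zero measure is allowed: its
lower dimension is an infimum over no set, hence ∞. -/
theorem le_lowerHausdorffDim_of_ae [IsFiniteMeasure μ] {d : EReal}
    (h : ∀ᵐ x ∂μ, d ≤ lowerLocalDim μ x) : d ≤ (lowerHausdorffDim μ : EReal) := by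
  by_contra hlt
  rw [not_le] at hlt
  obtain ⟨q, hq1, hq2⟩ := EReal.lt_iff_exists_rat_btwn.1 hlt
  have hq : 0 ≤ (q : ℝ) := by
    have := (EReal.coe_ennreal_nonneg (lowerHausdorffDim μ)).trans hq1.le
    exact_mod_cast this
  have hq' : lowerHausdorffDim μ < ((q : ℝ).toNNReal : ℝ≥0∞) := by
    rw [← EReal.coe_ennreal_lt_coe_ennreal_iff]
    change _ < ((ENNReal.ofReal (q : ℝ) : ℝ≥0∞) : EReal)
    rwa [EReal.coe_ennreal_ofReal, max_eq_left hq]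
  simp only [lowerHausdorffDim, iInf_lt_iff] at hq'
  obtain ⟨E, -, hE, hdim⟩ := hq'
  have h0 := measure_inter_eventually_eq_zero (μ := μ) hdim
  rw [Real.coe_toNNReal _ hq] at h0
  refine hE.ne' (measure_mono_null (t := (E ∩ _) ∪ {x | ¬ d ≤ lowerLocalDim μ x}) ?_
    (measure_union_null h0 h))
  intro x hx
  by_cases hd : d ≤ lowerLocalDim μ x
  · exact Or.inl ⟨hx, eventually_of_lt_lowerLocalDim (hq2.trans_le hd)⟩
  · exact Or.inr hd

end MandelbrotCascade

namespace MandelbrotCascade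

variable {b : ℕ} {μ : Measure (SymbolicSpace b)}

/-! ### Packing dimension and local dimensions -/

/-- An infimum of a nonempty family in the well-ordered ℕ∞ is attained. -/
theorem exists_isCover_encard_eq {T : Type*} [MetricSpace T] (ε : ℝ≥0) (A : Set T) :
    ∃ C : Set T, Metric.IsCover ε A C ∧ C.encard = Metric.externalCoveringNumber ε A := by
  have : Nonempty {C : Set T // Metric.IsCover ε A C} := ⟨⟨A, Metric.IsCover.rfl⟩⟩
  obtain ⟨⟨C, hC⟩, h⟩ := ciInf_mem fun C : {C : Set T // Metric.IsCover ε A C} => C.1.encard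
  refine ⟨C, hC, h.trans ?_⟩
  rw [Metric.externalCoveringNumber, iInf_subtype]

/-- Points of a set of small upper box dimension lying in a small cylinder. -/
theorem measure_small_cylinder_le {s : Set (SymbolicSpace b)} {n : ℕ} {r : ℝ≥0∞} {ε : ℝ≥0}
    (hr : r ≠ 0) (hε : (ε : ℝ) = Real.exp (-((n : ℝ) + 1))) :
    μ (s ∩ {x | μ (cylinder x n) ≤ r}) ≤
      ((Metric.externalCoveringNumber ε s : ℕ∞) : ℝ≥0∞) * r := by
  obtain ⟨C, hC, hcard⟩ := exists_isCover_encard_eq ε s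
  rw [← hcard]
  by_cases hfin : C.Finite
  · have hsub : s ∩ {x | μ (cylinder x n) ≤ r} ⊆
        ⋃ c ∈ {c ∈ C | μ (cylinder c n) ≤ r}, cylinder c n := by
      rintro x ⟨hxs, hx⟩
      obtain ⟨c, hc, hxc⟩ := hC hxs
      have hmem : x ∈ cylinder c n := by
        have hxc : edist x c ≤ ε := hxc
        rw [mem_cylinder_comm, ← dist_le_exp_iff, ← hε]
        rw [edist_dist] at hxc
        have := ENNReal.toReal_mono ENNReal.coe_ne_top hxc
        rwa [ENNReal.toReal_ofReal dist_nonneg] at this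
      refine Set.mem_biUnion (x := c) ⟨hc, ?_⟩ hmem
      rw [← cylinder_eq_of_mem hmem]
      exact hx
    have hfin' : {c ∈ C | μ (cylinder c n) ≤ r}.Finite := hfin.subset (Set.sep_subset _ _)
    calc μ (s ∩ {x | μ (cylinder x n) ≤ r})
        ≤ μ (⋃ c ∈ hfin'.toFinset, cylinder c n) := by
          refine measure_mono (hsub.trans ?_)
          simp
      _ ≤ ∑ c ∈ hfin'.toFinset, μ (cylinder c n) := measure_biUnion_finset_le _ _
      _ ≤ ∑ c ∈ hfin'.toFinset, r := Finset.sum_le_sum fun c hc => by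
          have := (Set.Finite.mem_toFinset _).1 hc
          exact this.2
      _ = (hfin'.toFinset.card : ℝ≥0∞) * r := by rw [Finset.sum_const, nsmul_eq_mul]
      _ ≤ _ := by
          gcongr
          have h1 : ((hfin'.toFinset.card : ℕ∞)) ≤ C.encard := by
            rw [← Set.encard_coe_eq_coe_finsetCard, Set.Finite.coe_toFinset]
            exact Set.encard_le_encard (Set.sep_subset _ _)
          have h2 := ENat.toENNReal_le.2 h1
          rwa [ENat.toENNReal_coe] at h2
  -- With no finite cover the right side is ∞ · r, which is ∞ because r ≠ 0.
  · rw [Set.not_finite.1 hfin |>.encard_eq]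
    simp [ENNReal.top_mul hr]

/-- The scale `e^{-(n+1)}`, at which closed balls are cylinders of length `n`. -/
noncomputable def cylinderScale (n : ℕ) : ℝ≥0 := (Real.exp (-((n : ℝ) + 1))).toNNReal

theorem coe_cylinderScale (n : ℕ) : (cylinderScale n : ℝ) = Real.exp (-((n : ℝ) + 1)) :=
  Real.coe_toNNReal _ (Real.exp_nonneg _)

theorem tendsto_cylinderScale : Tendsto cylinderScale atTop (𝓝[>] 0) := by
  refine tendsto_nhdsWithin_iff.2 ⟨?_, Eventually.of_forall fun n => ?_⟩
  · rw [← NNReal.tendsto_coe]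
    simp_rw [coe_cylinderScale]
    have := (tendsto_add_atTop_iff_nat 1).2 exp_neg_natCast_tendsto_zero
    simpa using this
  · rw [Set.mem_Ioi, ← NNReal.coe_lt_coe, coe_cylinderScale]
    exact Real.exp_pos _

theorem eventually_coveringNumber_le {s : Set (SymbolicSpace b)} {d : ℝ}
    (h : upperBoxDim s < ENNReal.ofReal d) :
    ∀ᶠ n : ℕ in atTop, ((Metric.externalCoveringNumber (cylinderScale n) s : ℕ∞) : ℝ≥0∞) ≤
      ENNReal.ofReal (Real.exp ((n + 1) * d)) := by
  have hd : 0 < d := by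
    by_contra hd
    rw [ENNReal.ofReal_of_nonpos (not_lt.1 hd)] at h
    exact not_lt_zero h
  have h1 : limsup (fun ε : ℝ≥0 =>
      ENNReal.log ((Metric.externalCoveringNumber ε s : ℕ∞) : ℝ≥0∞) /
      ((-Real.log (ε : ℝ) : ℝ) : EReal)) (𝓝[>] 0) < (d : EReal) := by
    rw [upperBoxDim] at h
    rcases le_total 0 (limsup (fun ε : ℝ≥0 =>
      ENNReal.log ((Metric.externalCoveringNumber ε s : ℕ∞) : ℝ≥0∞) /
      ((-Real.log (ε : ℝ) : ℝ) : EReal)) (𝓝[>] 0)) with h0 | h0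
    · rw [← EReal.coe_toENNReal h0]
      have := EReal.coe_ennreal_lt_coe_ennreal_iff.2 h
      rwa [EReal.coe_ennreal_ofReal, max_eq_left hd.le] at this
    · exact h0.trans_lt (by exact_mod_cast hd)
  have h2 := eventually_lt_of_limsup_lt h1 (by isBoundedDefault)
  filter_upwards [tendsto_cylinderScale.eventually h2] with n hn
  rw [coe_cylinderScale, Real.log_exp, neg_neg] at hn
  have hpos : (0 : EReal) < (((n : ℝ) + 1 : ℝ) : EReal) := by
    have : (0 : ℝ) < (n : ℝ) + 1 := by positivity
    exact_mod_cast this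
  have h3 := (EReal.div_le_iff_le_mul hpos (EReal.coe_ne_top _)).1 hn.le
  rw [← ENNReal.log_le_log_iff, ENNReal.log_ofReal_of_pos (Real.exp_pos _), Real.log_exp]
  exact_mod_cast h3

/-- Cover almost all points by countably many pieces of upper box dimension below some c < d. A
piece needs at most e^{(n+1)c} cylinders of length n, so its points in cylinders of mass at most
e^{-dn} have total mass at most e^{(n+1)c-dn}. This is summable, and Borel–Cantelli applies to each
piece. -/
theorem ae_eventually_ge_of_upperPackingDim_lt {d : ℝ}
    (h : upperPackingDim μ < ENNReal.ofReal d) :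
    ∀ᵐ x ∂μ, ∀ᶠ n in atTop, expDecay d n ≤ μ (cylinder x n) := by
  simp only [upperPackingDim, packingDim, iInf_lt_iff] at h
  obtain ⟨E, -, hE, s, hs, hlt⟩ := h
  obtain ⟨c, hc1, hc2⟩ := exists_between hlt
  have hctop : c ≠ ∞ := hc2.ne_top
  have hc : ENNReal.ofReal c.toReal = c := ENNReal.ofReal_toReal hctop
  have hcd : c.toReal < d := by
    rw [← hc] at hc2
    exact (ENNReal.ofReal_lt_ofReal_iff_of_nonneg ENNReal.toReal_nonneg).1 hc2
  have key : ∀ i, ∀ᵐ x ∂μ, ∀ᶠ n in atTop, x ∉ s i ∩ {x | μ (cylinder x n) ≤ expDecay d n} := by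
    intro i
    have hi : upperBoxDim (s i) < ENNReal.ofReal c.toReal := by
      rw [hc]
      exact (le_iSup (fun i => upperBoxDim (s i)) i).trans_lt hc1
    obtain ⟨N, hN⟩ := eventually_atTop.1 (eventually_coveringNumber_le hi)
    have hbound : ∀ n, μ (s i ∩ {x | μ (cylinder x (n + N)) ≤ expDecay d (n + N)}) ≤
        ENNReal.ofReal (Real.exp c.toReal) * expDecay (d - c.toReal) (n + N) := by
      intro n
      calc μ (s i ∩ {x | μ (cylinder x (n + N)) ≤ expDecay d (n + N)})
          ≤ _ * expDecay d (n + N) :=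
            measure_small_cylinder_le (expDecay_pos _ _).ne' (coe_cylinderScale (n + N))
        _ ≤ ENNReal.ofReal (Real.exp (((n + N : ℕ) + 1) * c.toReal)) * expDecay d (n + N) := by
            gcongr
            exact hN _ (Nat.le_add_left _ _)
        _ = _ := by
            rw [expDecay, expDecay, ← ENNReal.ofReal_mul (Real.exp_nonneg _),
              ← ENNReal.ofReal_mul (Real.exp_nonneg _), ← Real.exp_add, ← Real.exp_add]
            congr 2
            ring
    have hsum : ∑' n, μ (s i ∩ {x | μ (cylinder x (n + N)) ≤ expDecay d (n + N)}) ≠ ∞ := by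
      refine ne_top_of_le_ne_top ?_ (ENNReal.tsum_le_tsum hbound)
      rw [ENNReal.tsum_mul_left]
      refine ENNReal.mul_ne_top ENNReal.ofReal_ne_top
        (ne_top_of_le_ne_top (tsum_expDecay_ne_top (sub_pos.2 hcd)) ?_)
      exact ENNReal.tsum_comp_le_tsum_of_injective (add_left_injective N) _
    filter_upwards [ae_eventually_notMem hsum] with x hx
    obtain ⟨M, hM⟩ := eventually_atTop.1 hx
    filter_upwards [eventually_ge_atTop (M + N)] with n hn
    obtain ⟨k, rfl⟩ := Nat.exists_eq_add_of_le' ((Nat.le_add_left N M).trans hn)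
    exact hM k (by omega)
  rw [measure_eq_zero_iff_ae_notMem] at hE
  filter_upwards [ae_all_iff.2 key, hE] with x hx hxE
  obtain ⟨i, hi⟩ := Set.mem_iUnion.1 (hs (not_not.1 hxE))
  filter_upwards [hx i] with n hn
  by_contra hlt
  exact hn ⟨hi, (not_le.1 hlt).le⟩

theorem exists_natCast_scale {ε : ℝ} (h0 : 0 < ε) (h1 : ε < 1) :
    ∃ n : ℕ, Real.exp (-((n : ℝ) + 1)) ≤ ε ∧ ε < Real.exp (-(n : ℝ)) := by
  refine ⟨⌈-Real.log ε⌉₊ - 1, ?_, ?_⟩ <;>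
  have hpos : 0 < -Real.log ε := neg_pos.2 (Real.log_neg h0 h1) <;>
  have hc : 0 < ⌈-Real.log ε⌉₊ := Nat.ceil_pos.2 hpos <;>
  have hcast : ((⌈-Real.log ε⌉₊ - 1 : ℕ) : ℝ) = ⌈-Real.log ε⌉₊ - 1 := by
    rw [Nat.cast_sub hc, Nat.cast_one]
  · rw [hcast, sub_add_cancel, ← Real.le_log_iff_exp_le h0]
    linarith [Nat.le_ceil (-Real.log ε)]
  · rw [hcast, ← Real.log_lt_iff_lt_exp h0]
    linarith [Nat.ceil_lt_add_one hpos.le]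

/-- The cylinders of length n that meet `s` are disjoint and each has mass at least r. One point of
`s` chosen in each of them gives the centres of a cover. -/
theorem coveringNumber_mul_le {s : Set (SymbolicSpace b)} {n : ℕ} {r : ℝ≥0∞} {ε : ℝ≥0}
    (hε : Real.exp (-((n : ℝ) + 1)) ≤ ε) (hs : ∀ x ∈ s, r ≤ μ (cylinder x n)) :
    ((Metric.externalCoveringNumber ε s : ℕ∞) : ℝ≥0∞) * r ≤ μ Set.univ := by
  classical
  rcases isEmpty_or_nonempty (SymbolicSpace b) with hemp | ⟨⟨x₀⟩⟩
  · have : s = ∅ := Set.eq_empty_of_isEmpty s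
    simp [this]
  let T : Finset (Fin n → Fin b) := Finset.univ.filter fun v => ∃ x ∈ s, firstLetters n x = v
  let c : (Fin n → Fin b) → SymbolicSpace b := fun v =>
    if h : ∃ x ∈ s, firstLetters n x = v then h.choose else x₀
  have hc : ∀ v ∈ T, c v ∈ s ∧ firstLetters n (c v) = v := by
    intro v hv
    have h := (Finset.mem_filter.1 hv).2
    simp only [c, dif_pos h]
    exact h.choose_spec
  have hcover : Metric.IsCover ε s (T.image c : Set (SymbolicSpace b)) := by
    intro x hx
    have hv : firstLetters n x ∈ T := Finset.mem_filter.2 ⟨Finset.mem_univ _, x, hx, rfl⟩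
    refine ⟨c (firstLetters n x), by simpa using ⟨_, hv, rfl⟩, ?_⟩
    have h1 : dist x (c (firstLetters n x)) ≤ ε :=
      (dist_le_exp_iff.2 (firstLetters_eq_iff.1 (hc _ hv).2)).trans hε
    change edist _ _ ≤ (ε : ℝ≥0∞)
    rw [edist_dist]
    exact ENNReal.ofReal_le_of_le_toReal h1
  have hcard : ((Metric.externalCoveringNumber ε s : ℕ∞) : ℝ≥0∞) ≤ (T.card : ℝ≥0∞) := by
    have h1 : Metric.externalCoveringNumber ε s ≤ (T.card : ℕ∞) := by
      refine hcover.externalCoveringNumber_le_encard.trans ?_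
      rw [Set.encard_coe_eq_coe_finsetCard]
      exact_mod_cast Finset.card_image_le
    have h2 := ENat.toENNReal_le.2 h1
    rwa [ENat.toENNReal_coe] at h2
  calc _ ≤ (T.card : ℝ≥0∞) * r := by gcongr
    _ = ∑ v ∈ T, r := by rw [Finset.sum_const, nsmul_eq_mul]
    _ ≤ ∑ v ∈ T, μ (firstLetters n ⁻¹' {v}) := Finset.sum_le_sum fun v hv => by
        have := hs _ (hc v hv).1
        rwa [cylinder_eq_preimage, (hc v hv).2] at this
    _ ≤ ∑ v, μ (firstLetters n ⁻¹' {v}) :=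
        Finset.sum_le_sum_of_subset (Finset.subset_univ _)
    _ = μ Set.univ := sum_measure_firstLetters n

theorem upperBoxDim_le_of_forall_ge [IsFiniteMeasure μ] {s : Set (SymbolicSpace b)} {d : ℝ}
    (hd : 0 ≤ d) {N : ℕ} (hs : ∀ x ∈ s, ∀ n, N ≤ n → expDecay d n ≤ μ (cylinder x n)) :
    upperBoxDim s ≤ ENNReal.ofReal d := by
  -- The covering number at a scale in [e^{-(n+1)}, e^{-n}) is at most e^{L+nd}; once n ≥ L/δ the
  -- constant L is absorbed in nδ.
  obtain ⟨L, hL0, hL⟩ : ∃ L : ℝ, 0 ≤ L ∧ μ Set.univ ≤ ENNReal.ofReal (Real.exp L) := by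
    refine ⟨(μ Set.univ).toReal, ENNReal.toReal_nonneg, ?_⟩
    rw [← ENNReal.ofReal_toReal (measure_ne_top μ Set.univ)]
    refine ENNReal.ofReal_le_ofReal ?_
    rw [ENNReal.toReal_ofReal ENNReal.toReal_nonneg]
    linarith [Real.add_one_le_exp (μ Set.univ).toReal]
  refine ENNReal.le_of_forall_pos_le_add fun δ hδ _ => ?_
  have hδ : (0 : ℝ) < δ := hδ
  have key : limsup (fun ε : ℝ≥0 =>
      ENNReal.log ((Metric.externalCoveringNumber ε s : ℕ∞) : ℝ≥0∞) /
      ((-Real.log (ε : ℝ) : ℝ) : EReal)) (𝓝[>] 0) ≤ ((d + δ : ℝ) : EReal) := by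
    refine limsup_le_of_le (by isBoundedDefault) ?_
    obtain ⟨m, hm⟩ := exists_nat_ge (L / δ)
    have hlt : ∀ᶠ ε : ℝ≥0 in 𝓝[>] 0, (ε : ℝ) < Real.exp (-((max m N + 1 : ℕ) : ℝ)) := by
      have h0 : Tendsto (fun ε : ℝ≥0 => (ε : ℝ)) (𝓝[>] 0) (𝓝 0) :=
        (NNReal.continuous_coe.tendsto' 0 0 rfl).mono_left nhdsWithin_le_nhds
      exact h0.eventually (gt_mem_nhds (Real.exp_pos _))
    filter_upwards [hlt, self_mem_nhdsWithin] with ε hε hpos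
    have hpos : (0 : ℝ) < ε := hpos
    have hε1 : (ε : ℝ) < 1 := hε.trans_le (by
      rw [← Real.exp_zero]
      exact Real.exp_le_exp.2 (neg_nonpos.2 (Nat.cast_nonneg _)))
    obtain ⟨n, hn1, hn2⟩ := exists_natCast_scale hpos hε1
    have hn : max m N ≤ n := by
      have h1 := Real.exp_lt_exp.1 (hn1.trans_lt hε)
      have h2 : (max m N : ℝ) < n := by
        push_cast at h1
        linarith
      exact_mod_cast h2.le
    have hLn : L ≤ n * δ := by
      have h1 : L / δ ≤ n := hm.trans (by exact_mod_cast (le_max_left m N).trans hn)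
      exact (div_le_iff₀ hδ).1 h1
    have hnlog : (n : ℝ) < -Real.log ε := by
      have := (Real.log_lt_iff_lt_exp hpos).2 hn2
      linarith
    have hcov := (coveringNumber_mul_le hn1
      fun x hx => hs x hx n ((le_max_right m N).trans hn)).trans hL
    have hcard : ((Metric.externalCoveringNumber ε s : ℕ∞) : ℝ≥0∞) ≤
        ENNReal.ofReal (Real.exp (n * (d + δ))) := by
      calc _ = ((Metric.externalCoveringNumber ε s : ℕ∞) : ℝ≥0∞) * expDecay d n *
            expDecay (-d) n := by
            rw [mul_assoc, mul_comm (expDecay d n), expDecay_neg_mul, mul_one]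
        _ ≤ ENNReal.ofReal (Real.exp L) * expDecay (-d) n := by gcongr
        _ = ENNReal.ofReal (Real.exp (L + n * d)) := by
            rw [expDecay, ← ENNReal.ofReal_mul (Real.exp_nonneg _), ← Real.exp_add]
            congr 3
            ring
        _ ≤ _ := ENNReal.ofReal_le_ofReal (Real.exp_le_exp.2 (by linarith))
    have hlog0 : (0 : EReal) < ((-Real.log ε : ℝ) : EReal) := by
      have := (Nat.cast_nonneg n).trans_lt hnlog
      exact_mod_cast this
    rw [EReal.div_le_iff_le_mul hlog0 (EReal.coe_ne_top _)]
    refine (ENNReal.log_le_log hcard).trans ?_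
    rw [ENNReal.log_ofReal_of_pos (Real.exp_pos _), Real.log_exp]
    have : (n : ℝ) * (d + δ) ≤ -Real.log ε * (d + δ) := by gcongr
    exact_mod_cast this
  have h2 := EReal.toENNReal_le_toENNReal key
  rw [EReal.toENNReal_of_ne_top (EReal.coe_ne_top _), EReal.toReal_coe,
    ENNReal.ofReal_add hd hδ.le, ENNReal.ofReal_coe_nnreal] at h2
  exact h2

theorem upperPackingDim_le_of_ae_eventually [IsFiniteMeasure μ] {d : ℝ} (hd : 0 ≤ d)
    (h : ∀ᵐ x ∂μ, ∀ᶠ n in atTop, expDecay d n ≤ μ (cylinder x n)) :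
    upperPackingDim μ ≤ ENNReal.ofReal d := by
  let A : ℕ → Set (SymbolicSpace b) := fun N => {x | ∀ n, N ≤ n → expDecay d n ≤ μ (cylinder x n)}
  have hAm : ∀ N, MeasurableSet (A N) := by
    intro N
    have : A N = ⋂ n, ⋂ (_ : N ≤ n), {x | expDecay d n ≤ μ (cylinder x n)} := by
      ext x
      simp [A]
    rw [this]
    exact MeasurableSet.iInter fun n => MeasurableSet.iInter fun _ =>
      measurableSet_le measurable_const (measurable_measure_cylinder μ n)
  have hnull : μ (⋃ N, A N)ᶜ = 0 := by
    rw [measure_eq_zero_iff_ae_notMem]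
    filter_upwards [h] with x hx
    obtain ⟨N, hN⟩ := eventually_atTop.1 hx
    exact not_not.2 (Set.mem_iUnion.2 ⟨N, hN⟩)
  refine iInf_le_of_le (⋃ N, A N) (iInf_le_of_le (MeasurableSet.iUnion hAm)
    (iInf_le_of_le hnull (iInf_le_of_le A (iInf_le_of_le le_rfl (iSup_le fun N => ?_)))))
  exact upperBoxDim_le_of_forall_ge hd fun x hx => hx

end MandelbrotCascade

namespace MandelbrotCascade

variable {b : ℕ} {Ω : Type*}

/-! ### Weak convergence on the symbolic space -/

/-- The indicator of a clopen set is a continuous test function. -/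
theorem continuous_finiteMeasure_apply {s : Set (SymbolicSpace b)} (hs : IsClopen s) :
    Continuous fun μ : FiniteMeasure (SymbolicSpace b) => μ s := by
  let f : BoundedContinuousFunction (SymbolicSpace b) ℝ≥0 :=
    BoundedContinuousFunction.mkOfCompact ⟨s.indicator 1, continuous_one.indicator (by simp [hs.frontier_eq])⟩
  have h : (fun μ : FiniteMeasure (SymbolicSpace b) => μ s) = fun μ => μ.testAgainstNN f := by
    funext μ
    have : ∫⁻ x, (f x : ℝ≥0∞) ∂(μ : Measure (SymbolicSpace b)) =
        (μ : Measure (SymbolicSpace b)) s := by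
      rw [← lintegral_indicator_one hs.isOpen.measurableSet]
      refine lintegral_congr fun x => ?_
      change ((s.indicator 1 x : ℝ≥0) : ℝ≥0∞) = _
      by_cases hx : x ∈ s <;> simp [hx]
    rw [FiniteMeasure.testAgainstNN, this]
    rfl
  rw [h]
  exact FiniteMeasure.continuous_testAgainstNN_eval f

/-- The total masses are bounded, so the sequence stays in a weakly compact set. Every cluster point
gives the cylinders the limiting masses, and these determine a measure, so the cluster point is
unique. -/
theorem exists_tendsto_of_tendsto_cylinder {m : ℕ → FiniteMeasure (SymbolicSpace b)}
    (h : ∀ x n, ∃ c : ℝ≥0, Tendsto (fun k => m k (cylinder x n)) atTop (𝓝 c)) :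
    ∃ μ : FiniteMeasure (SymbolicSpace b), Tendsto m atTop (𝓝 μ) := by
  rcases isEmpty_or_nonempty (SymbolicSpace b) with hemp | ⟨⟨x₀⟩⟩
  · refine ⟨0, tendsto_const_nhds.congr fun k => ?_⟩
    refine Subtype.ext (Measure.ext fun s _ => ?_)
    simp [Set.eq_empty_of_isEmpty s]
  obtain ⟨C, hC⟩ : ∃ C : ℝ≥0, ∀ k, (m k).mass ≤ C := by
    obtain ⟨c, hc⟩ := h x₀ 0
    obtain ⟨C, hC⟩ := hc.bddAbove_range
    refine ⟨C, fun k => hC ⟨k, ?_⟩⟩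
    simp [cylinder_zero, FiniteMeasure.mass]
  have hK := isCompact_setOfPred_finiteMeasure_le_of_compactSpace (SymbolicSpace b) C
  have hval : ∀ μ, MapClusterPt μ atTop m → ∀ x n c,
      Tendsto (fun k => m k (cylinder x n)) atTop (𝓝 c) → μ (cylinder x n) = c := by
    intro μ hμ x n c hc
    have h1 : MapClusterPt (μ (cylinder x n)) atTop fun k => m k (cylinder x n) :=
      hμ.continuousAt_comp
        (continuous_finiteMeasure_apply (isClopen_cylinder x n)).continuousAt
    have h2 : ClusterPt (μ (cylinder x n)) (𝓝 c) := ClusterPt.mono h1 hc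
    exact eq_of_nhds_neBot h2
  obtain ⟨μ, -, hμ⟩ := hK.exists_mapClusterPt (f := atTop) (u := m)
    (by simpa using ⟨0, fun k _ => hC k⟩)
  refine ⟨μ, hK.tendsto_nhds_of_unique_mapClusterPt (Eventually.of_forall hC) fun μ' _ hμ' => ?_⟩
  refine Subtype.ext (measure_ext_of_cylinder (μ := (μ' : Measure (SymbolicSpace b))) fun x n => ?_)
  obtain ⟨c, hc⟩ := h x n
  have := (hval μ' hμ' x n c hc).trans (hval μ hμ x n c hc).symm
  rw [← ENNReal.coe_inj, FiniteMeasure.ennreal_coeFn_eq_coeFn_toMeasure,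
    FiniteMeasure.ennreal_coeFn_eq_coeFn_toMeasure] at this
  exact this

/-! ### The σ-algebras generated by the weights -/

variable {X : List (Fin b) → Ω → ℝ≥0}

/-- The σ-algebra generated by the weights indexed by the nonempty words of `S`. -/
@[reducible]
def wordAlgebra (X : List (Fin b) → Ω → ℝ≥0) (S : Set (List (Fin b))) : MeasurableSpace Ω :=
  ⨆ u ∈ {u : {u : List (Fin b) // u ≠ []} | u.1 ∈ S}, MeasurableSpace.comap (X u) inferInstance

theorem wordAlgebra_mono {S T : Set (List (Fin b))} (h : S ⊆ T) :
    wordAlgebra X S ≤ wordAlgebra X T :=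
  biSup_mono fun _ hu => h hu

theorem measurable_wordAlgebra {S : Set (List (Fin b))} {u : List (Fin b)} (hu : u ∈ S)
    (hne : u ≠ []) : Measurable[wordAlgebra X S] (X u) :=
  Measurable.of_comap_le
    (le_biSup (fun u : {u : List (Fin b) // u ≠ []} => MeasurableSpace.comap (X u) inferInstance)
      (i := ⟨u, hne⟩) hu)

theorem prefixWord_succ_ne_nil (x : SymbolicSpace b) (n : ℕ) : prefixWord x (n + 1) ≠ [] := by
  simp [prefixWord]

theorem length_prefixWord (x : SymbolicSpace b) (n : ℕ) : (prefixWord x n).length = n := by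
  simp [prefixWord]

theorem cascadeDensity_zero (ω : Ω) (x : SymbolicSpace b) : cascadeDensity X 0 ω x = 1 := by
  simp [cascadeDensity]

theorem cascadeDensity_succ (n : ℕ) (ω : Ω) (x : SymbolicSpace b) :
    cascadeDensity X (n + 1) ω x = cascadeDensity X n ω x * X (prefixWord x (n + 1)) ω := by
  simp [cascadeDensity, Finset.prod_range_succ]

theorem cascadeDensity_congr {n : ℕ} {x y : SymbolicSpace b} (h : y ∈ cylinder x n) (ω : Ω) :
    cascadeDensity X n ω y = cascadeDensity X n ω x := by
  refine Finset.prod_congr rfl fun k hk => ?_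
  have : y ∈ cylinder x (k + 1) := cylinder_anti x (Finset.mem_range.1 hk) h
  rw [show prefixWord y (k + 1) = prefixWord x (k + 1) from this]

theorem measurable_cascadeDensity_of_mem {S : Set (List (Fin b))} {n : ℕ} {x : SymbolicSpace b}
    (h : ∀ k < n, prefixWord x (k + 1) ∈ S) :
    Measurable[wordAlgebra X S] fun ω => cascadeDensity X n ω x := by
  unfold cascadeDensity
  exact Finset.measurable_fun_prod _ fun k hk =>
    measurable_wordAlgebra (h k (Finset.mem_range.1 hk)) (prefixWord_succ_ne_nil x k)

/-- The σ-algebra on Ω is left free, to be taken either ambient or generated by the words of length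
at most n. Joint measurability holds because x enters through finitely many letters. -/
theorem measurable_uncurry_cascadeDensity {m : MeasurableSpace Ω} {n : ℕ}
    (h : ∀ u : List (Fin b), u ≠ [] → u.length ≤ n → Measurable (X u)) :
    Measurable fun p : Ω × SymbolicSpace b => cascadeDensity X n p.1 p.2 := by
  unfold cascadeDensity
  refine Finset.measurable_fun_prod _ fun k hk => ?_
  have h1 : Measurable fun q : Ω × (Fin (k + 1) → Fin b) => X (List.ofFn q.2) q.1 := by
    refine measurable_from_prod_countable_left fun v => h (List.ofFn v) (by simp) ?_
    rw [List.length_ofFn]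
    exact Finset.mem_range.1 hk
  exact h1.comp (measurable_fst.prodMk ((measurable_firstLetters (k + 1)).comp measurable_snd))

variable {ν : Measure (SymbolicSpace b)}

/-- The mass that `Q_n · ν` gives to `B`. -/
noncomputable def cascadeMass (X : List (Fin b) → Ω → ℝ≥0) (ν : Measure (SymbolicSpace b))
    (n : ℕ) (B : Set (SymbolicSpace b)) (ω : Ω) : ℝ≥0∞ :=
  ∫⁻ x in B, cascadeDensity X n ω x ∂ν

theorem measurable_cascadeDensity (n : ℕ) (x : SymbolicSpace b) :
    Measurable[wordAlgebra X {u | u.length ≤ n}] fun ω => cascadeDensity X n ω x := by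
  refine measurable_cascadeDensity_of_mem fun k hk => ?_
  change (prefixWord x (k + 1)).length ≤ n
  rw [length_prefixWord]
  exact hk

theorem measurable_cascadeMass [SFinite ν] (n : ℕ) (B : Set (SymbolicSpace b)) :
    Measurable[wordAlgebra X {u | u.length ≤ n}] (cascadeMass X ν n B) :=
  @Measurable.lintegral_prod_right' Ω (SymbolicSpace b) (wordAlgebra X {u | u.length ≤ n}) _
    (ν.restrict B) _ (fun p => (cascadeDensity X n p.1 p.2 : ℝ≥0∞))
    (measurable_coe_nnreal_ennreal.comp (@measurable_uncurry_cascadeDensity b Ω X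
      (wordAlgebra X {u | u.length ≤ n}) n fun _ h1 h2 => measurable_wordAlgebra h2 h1))

theorem cascadeMeasure_apply [IsFiniteMeasure ν] (n : ℕ) (ω : Ω) {B : Set (SymbolicSpace b)}
    (hB : MeasurableSet B) :
    (cascadeMeasure X ν n ω : Measure (SymbolicSpace b)) B = cascadeMass X ν n B ω :=
  withDensity_apply _ hB

theorem cascadeMass_ne_top [IsFiniteMeasure ν] (n : ℕ) (ω : Ω) {B : Set (SymbolicSpace b)}
    (hB : MeasurableSet B) : cascadeMass X ν n B ω ≠ ∞ := by
  rw [← cascadeMeasure_apply n ω hB]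
  exact measure_ne_top _ _

/-! ### The martingale property of the cascade -/

section Cascade

variable [MeasurableSpace Ω] {P : Measure Ω} {ρ : Measure ℝ≥0}

theorem IsCascade.wordAlgebra_le (hX : IsCascade P ρ X) (S : Set (List (Fin b))) :
    wordAlgebra X S ≤ ‹MeasurableSpace Ω› :=
  iSup₂_le fun u _ => (hX.measurable u u.2).comap_le

theorem IsCascade.lintegral_weight (hX : IsCascade P ρ X) {u : List (Fin b)} (hu : u ≠ []) :
    ∫⁻ ω, (X u ω : ℝ≥0∞) ∂P = 1 := by
  rw [← hX.mean, ← hX.law u hu, lintegral_map measurable_coe_nnreal_ennreal (hX.measurable u hu)]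

theorem IsCascade.lintegral_mul_weight (hX : IsCascade P ρ X) {S : Set (List (Fin b))}
    {u : List (Fin b)} (hu : u ≠ []) (huS : u ∉ S) {f : Ω → ℝ≥0∞}
    (hf : Measurable[wordAlgebra X S] f) :
    ∫⁻ ω, f ω * X u ω ∂P = ∫⁻ ω, f ω ∂P := by
  have hind : Indep (wordAlgebra X S) (wordAlgebra X {u}) P := by
    refine indep_iSup_of_disjoint
      (m := fun v : {u : List (Fin b) // u ≠ []} => MeasurableSpace.comap (X v) inferInstance)
      (fun v => (hX.measurable v v.2).comap_le) ((iIndepFun_iff_iIndep _ _ _).1 hX.indep) ?_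
    rw [Set.disjoint_left]
    intro v hv hvu
    have hvu : v.1 = u := hvu
    exact huS (hvu ▸ hv)
  have hg : Measurable[wordAlgebra X {u}] fun ω => (X u ω : ℝ≥0∞) :=
    measurable_coe_nnreal_ennreal.comp (measurable_wordAlgebra (Set.mem_singleton u) hu)
  rw [lintegral_mul_eq_lintegral_mul_lintegral_of_independent_measurableSpace
    (hX.wordAlgebra_le S) (hX.wordAlgebra_le {u}) hind hf hg, hX.lintegral_weight hu, mul_one]

/-- Each weight of x at a level in (n, m] is fresh: independent of `S` and of the earlier weights,
with mean 1. Since `S` is arbitrary, this serves both for the martingale property (`S` the words of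
length at most n) and for two rays that have separated (`S` the other ray). -/
theorem IsCascade.lintegral_mul_density (hX : IsCascade P ρ X) {S : Set (List (Fin b))}
    {f : Ω → ℝ≥0∞} (hf : Measurable[wordAlgebra X S] f) (x : SymbolicSpace b) {n m : ℕ}
    (hnm : n ≤ m) (hS : ∀ k, n ≤ k → k < m → prefixWord x (k + 1) ∉ S) :
    ∫⁻ ω, f ω * cascadeDensity X m ω x ∂P = ∫⁻ ω, f ω * cascadeDensity X n ω x ∂P := by
  induction m, hnm using Nat.le_induction with
  | base => rfl
  | succ m hnm ih =>
    rw [← ih fun k h1 h2 => hS k h1 (by omega)]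
    simp_rw [cascadeDensity_succ, ENNReal.coe_mul, ← mul_assoc]
    -- Adding the words of length at most m makes f · Q_m(x) measurable, while the next weight of x
    -- still has its word outside the set.
    refine hX.lintegral_mul_weight (S := S ∪ {u | u.length ≤ m}) (prefixWord_succ_ne_nil x m)
      ?_ ?_
    · rintro (h | h)
      · exact hS m hnm (Nat.lt_succ_self m) h
      · have h : (prefixWord x (m + 1)).length ≤ m := h
        rw [length_prefixWord] at h
        omega
    · refine (hf.mono (wordAlgebra_mono Set.subset_union_left) le_rfl).mul
        (measurable_coe_nnreal_ennreal.comp (measurable_cascadeDensity_of_mem fun k hk => ?_))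
      right
      change (prefixWord x (k + 1)).length ≤ m
      rw [length_prefixWord]
      exact hk

/-- The filtration generated by the weights of words of length at most `n`. -/
def cascadeFiltration (hX : IsCascade P ρ X) : Filtration ℕ ‹MeasurableSpace Ω› where
  seq n := wordAlgebra X {u | u.length ≤ n}
  mono' _ _ h := wordAlgebra_mono fun _ hu => le_trans hu h
  le' _ := hX.wordAlgebra_le _

theorem IsCascade.measurable_uncurry (hX : IsCascade P ρ X) (n : ℕ) :
    Measurable fun p : Ω × SymbolicSpace b => cascadeDensity X n p.1 p.2 :=
  measurable_uncurry_cascadeDensity fun u hu _ => hX.measurable u hu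

theorem IsCascade.lintegral_mul_mass_eq (hX : IsCascade P ρ X) [SFinite P] [SFinite ν]
    {f : Ω → ℝ≥0∞} (hf : Measurable f) (n : ℕ) (B : Set (SymbolicSpace b)) :
    ∫⁻ ω, f ω * cascadeMass X ν n B ω ∂P =
      ∫⁻ x in B, ∫⁻ ω, f ω * cascadeDensity X n ω x ∂P ∂ν := by
  have hQ := measurable_coe_nnreal_ennreal.comp (hX.measurable_uncurry n)
  rw [← lintegral_lintegral_swap ((hf.comp measurable_fst).mul hQ).aemeasurable]
  refine lintegral_congr fun ω => ?_
  exact (lintegral_const_mul _ (hQ.comp measurable_prodMk_left)).symm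

theorem IsCascade.lintegral_mul_mass (hX : IsCascade P ρ X) [SFinite P] [SFinite ν]
    {f : Ω → ℝ≥0∞} {n m : ℕ} (hf : Measurable[wordAlgebra X {u | u.length ≤ n}] f) (hnm : n ≤ m)
    (B : Set (SymbolicSpace b)) :
    ∫⁻ ω, f ω * cascadeMass X ν m B ω ∂P = ∫⁻ ω, f ω * cascadeMass X ν n B ω ∂P := by
  have hf' : Measurable f := hf.mono (hX.wordAlgebra_le _) le_rfl
  rw [hX.lintegral_mul_mass_eq hf', hX.lintegral_mul_mass_eq hf']
  refine lintegral_congr fun x => hX.lintegral_mul_density hf x hnm fun k hk _ h => ?_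
  have h : (prefixWord x (k + 1)).length ≤ n := h
  rw [length_prefixWord] at h
  omega

theorem IsCascade.lintegral_mass (hX : IsCascade P ρ X) [IsProbabilityMeasure P] [SFinite ν]
    (n : ℕ) (B : Set (SymbolicSpace b)) : ∫⁻ ω, cascadeMass X ν n B ω ∂P = ν B := by
  have := hX.lintegral_mul_mass (ν := ν) (f := fun _ => 1) (n := 0) (m := n)
    measurable_const (Nat.zero_le n) B
  simpa [cascadeMass, cascadeDensity_zero] using this

/-- The masses of `B` form a nonnegative martingale of constant expectation ν(B), hence converge
almost surely by Doob's theorem. -/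
theorem IsCascade.ae_tendsto_mass (hX : IsCascade P ρ X) [IsProbabilityMeasure P]
    [IsFiniteMeasure ν] {B : Set (SymbolicSpace b)} (hB : MeasurableSet B) :
    ∀ᵐ ω ∂P, ∃ c : ℝ≥0, Tendsto (fun n => cascadeMass X ν n B ω) atTop (𝓝 c) := by
  have hm : ∀ n, Measurable (cascadeMass X ν n B) := fun n =>
    (measurable_cascadeMass n B).mono (hX.wordAlgebra_le _) le_rfl
  have hfin : ∀ n, ∫⁻ ω, cascadeMass X ν n B ω ∂P ≠ ∞ := fun n => by
    rw [hX.lintegral_mass]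
    exact measure_ne_top _ _
  have hmart : Martingale (fun n ω => (cascadeMass X ν n B ω).toReal) (cascadeFiltration hX) P := by
    refine martingale_of_setIntegral_eq_succ (fun n => ?_) (fun n => ?_) fun n s hs => ?_
    · exact (measurable_cascadeMass n B).ennreal_toReal.stronglyMeasurable
    · exact integrable_toReal_of_lintegral_ne_top (hm n).aemeasurable (hfin n)
    · have hs' : MeasurableSet s := (cascadeFiltration hX).le n s hs
      rw [integral_toReal (hm n).aemeasurable.restrict
          (ae_of_all _ fun ω => (cascadeMass_ne_top n ω hB).lt_top),
        integral_toReal (hm (n + 1)).aemeasurable.restrict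
          (ae_of_all _ fun ω => (cascadeMass_ne_top (n + 1) ω hB).lt_top)]
      have hs0 : MeasurableSet[wordAlgebra X {u | u.length ≤ n}] s := hs
      have hind : Measurable[wordAlgebra X {u | u.length ≤ n}]
          (s.indicator fun _ => (1 : ℝ≥0∞)) :=
        Measurable.indicator measurable_const hs0
      have h1 := hX.lintegral_mul_mass (ν := ν) hind (Nat.le_succ n) B
      have h2 : ∀ k, ∫⁻ ω, s.indicator (fun _ => 1) ω * cascadeMass X ν k B ω ∂P =
          ∫⁻ ω in s, cascadeMass X ν k B ω ∂P := by
        intro k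
        rw [← lintegral_indicator hs']
        refine lintegral_congr fun ω => ?_
        by_cases h : ω ∈ s <;> simp [h]
      rw [← h2, ← h2, h1]
  have hbdd : ∀ n, eLpNorm (fun ω => (cascadeMass X ν n B ω).toReal) 1 P ≤
      ((ν B).toNNReal : ℝ≥0∞) := by
    intro n
    rw [eLpNorm_one_eq_lintegral_enorm, ENNReal.coe_toNNReal (measure_ne_top _ _),
      ← hX.lintegral_mass (ν := ν) n B]
    refine (lintegral_congr fun ω => ?_).le
    rw [Real.enorm_of_nonneg ENNReal.toReal_nonneg,
      ENNReal.ofReal_toReal (cascadeMass_ne_top n ω hB)]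
  filter_upwards [hmart.submartingale.exists_ae_tendsto_of_bdd hbdd] with ω ⟨c, hω⟩
  refine ⟨c.toNNReal, ?_⟩
  have := ENNReal.tendsto_ofReal hω
  refine this.congr fun n => ?_
  rw [ENNReal.ofReal_toReal (cascadeMass_ne_top n ω hB)]

end Cascade

end MandelbrotCascade

namespace MandelbrotCascade

variable {b : ℕ} {Ω : Type*} {X : List (Fin b) → Ω → ℝ≥0} {ν : Measure (SymbolicSpace b)}

/-! ### The limit measure as a random measure -/

theorem tendsto_limitMeasure_or_eq_zero [IsFiniteMeasure ν] (ω : Ω) :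
    Tendsto (fun n => cascadeMeasure X ν n ω) atTop (𝓝 (limitMeasure X ν ω)) ∨
      ((¬ ∃ μ : FiniteMeasure (SymbolicSpace b),
        Tendsto (fun n => cascadeMeasure X ν n ω) atTop (𝓝 μ)) ∧ limitMeasure X ν ω = 0) := by
  by_cases h : ∃ μ : FiniteMeasure (SymbolicSpace b),
      Tendsto (fun n => cascadeMeasure X ν n ω) atTop (𝓝 μ)
  · left
    rw [limitMeasure, dif_pos h]
    exact h.choose_spec
  · right
    exact ⟨h, dif_neg h⟩

theorem tendsto_cascadeMass [IsFiniteMeasure ν] {ω : Ω} {μ : FiniteMeasure (SymbolicSpace b)}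
    (h : Tendsto (fun n => cascadeMeasure X ν n ω) atTop (𝓝 μ)) {B : Set (SymbolicSpace b)}
    (hB : IsClopen B) :
    Tendsto (fun n => cascadeMass X ν n B ω) atTop
      (𝓝 ((μ : Measure (SymbolicSpace b)) B)) := by
  have h1 := ((continuous_finiteMeasure_apply hB).tendsto _).comp h
  have h2 := ENNReal.tendsto_coe.2 h1
  rw [FiniteMeasure.ennreal_coeFn_eq_coeFn_toMeasure] at h2
  refine h2.congr fun n => ?_
  rw [← cascadeMeasure_apply n ω hB.isOpen.measurableSet, Function.comp_apply,
    FiniteMeasure.ennreal_coeFn_eq_coeFn_toMeasure]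

/-- Weak convergence becomes countably many conditions on real sequences, which makes the
convergence event measurable. -/
theorem exists_tendsto_cascadeMeasure_iff [IsFiniteMeasure ν] (ω : Ω) :
    (∃ μ : FiniteMeasure (SymbolicSpace b),
      Tendsto (fun n => cascadeMeasure X ν n ω) atTop (𝓝 μ)) ↔
    ∀ (n : ℕ) (v : Fin n → Fin b), ∃ c : ℝ≥0,
      Tendsto (fun k => cascadeMeasure X ν k ω (firstLetters n ⁻¹' {v})) atTop (𝓝 c) := by
  constructor
  · rintro ⟨μ, hμ⟩ n v
    by_cases hv : ∃ x, firstLetters n x = v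
    · obtain ⟨x, rfl⟩ := hv
      rw [← cylinder_eq_preimage]
      exact ⟨_, ((continuous_finiteMeasure_apply (isClopen_cylinder x n)).tendsto _).comp hμ⟩
    · have : firstLetters n ⁻¹' {v} = (∅ : Set (SymbolicSpace b)) :=
        Set.eq_empty_of_forall_notMem fun x hx => hv ⟨x, hx⟩
      rw [this]
      exact ⟨0, by simp [FiniteMeasure.coeFn_def]⟩
  · intro h
    refine exists_tendsto_of_tendsto_cylinder fun x n => ?_
    rw [cylinder_eq_preimage]
    exact h n _

section Cascade

variable [MeasurableSpace Ω] {P : Measure Ω} {ρ : Measure ℝ≥0}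

theorem IsCascade.measurable_mass (hX : IsCascade P ρ X) [SFinite ν] (n : ℕ)
    (B : Set (SymbolicSpace b)) : Measurable (cascadeMass X ν n B) :=
  (measurable_cascadeMass n B).mono (hX.wordAlgebra_le _) le_rfl

theorem IsCascade.ae_tendsto_limitMeasure (hX : IsCascade P ρ X) [IsProbabilityMeasure P]
    [IsFiniteMeasure ν] :
    ∀ᵐ ω ∂P, Tendsto (fun n => cascadeMeasure X ν n ω) atTop (𝓝 (limitMeasure X ν ω)) := by
  have h : ∀ᵐ ω ∂P, ∀ (n : ℕ) (v : Fin n → Fin b), ∃ c : ℝ≥0,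
      Tendsto (fun k => cascadeMass X ν k (firstLetters n ⁻¹' {v}) ω) atTop (𝓝 c) :=
    ae_all_iff.2 fun n => ae_all_iff.2 fun v =>
      hX.ae_tendsto_mass (measurable_firstLetters n (measurableSet_singleton v))
  filter_upwards [h] with ω hω
  refine (tendsto_limitMeasure_or_eq_zero ω).resolve_right fun hn => hn.1 ?_
  rw [exists_tendsto_cascadeMeasure_iff]
  intro n v
  obtain ⟨c, hc⟩ := hω n v
  refine ⟨c, ENNReal.tendsto_coe.1 (hc.congr fun k => ?_)⟩
  rw [← cascadeMeasure_apply k ω (measurable_firstLetters n (measurableSet_singleton v)),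
    FiniteMeasure.ennreal_coeFn_eq_coeFn_toMeasure]

/-- On the convergence event the mass of a cylinder is a limit of measurable functions; off it the
measure is 0. Cylinders form a generating π-system. -/
theorem IsCascade.measurable_limitMeasure (hX : IsCascade P ρ X) [IsFiniteMeasure ν] :
    Measurable fun ω => (limitMeasure X ν ω : Measure (SymbolicSpace b)) := by
  let G : Set Ω := {ω | ∃ μ : FiniteMeasure (SymbolicSpace b),
    Tendsto (fun n => cascadeMeasure X ν n ω) atTop (𝓝 μ)}
  have hG : MeasurableSet G := by
    have : G = ⋂ (n : ℕ), ⋂ (v : Fin n → Fin b), {ω | ∃ c : ℝ≥0,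
        Tendsto (fun k => cascadeMeasure X ν k ω (firstLetters n ⁻¹' {v})) atTop (𝓝 c)} := by
      ext ω
      simp only [G, Set.mem_iInter, Set.mem_ofPred_eq]
      exact exists_tendsto_cascadeMeasure_iff ω
    rw [this]
    refine MeasurableSet.iInter fun n => MeasurableSet.iInter fun v =>
      MeasureTheory.measurableSet_exists_tendsto fun k => ?_
    have h1 := (hX.measurable_mass (ν := ν) k (firstLetters n ⁻¹' {v})).ennreal_toNNReal
    have h2 : (fun ω => (cascadeMass X ν k (firstLetters n ⁻¹' {v}) ω).toNNReal) =
        fun ω => cascadeMeasure X ν k ω (firstLetters n ⁻¹' {v}) := by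
      funext ω
      rw [← cascadeMeasure_apply k ω (measurable_firstLetters n (measurableSet_singleton v))]
      rfl
    rwa [h2] at h1
  have hclopen : ∀ s : Set (SymbolicSpace b), IsClopen s →
      Measurable fun ω => (limitMeasure X ν ω : Measure (SymbolicSpace b)) s := by
    intro s hs
    refine measurable_of_tendsto_metrizable (f := fun n => G.indicator (cascadeMass X ν n s))
      (fun n => (hX.measurable_mass n s).indicator hG) (tendsto_pi_nhds.2 fun ω => ?_)
    rcases tendsto_limitMeasure_or_eq_zero (X := X) (ν := ν) ω with h | ⟨h, h0⟩
    · have hω : ω ∈ G := ⟨_, h⟩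
      simp only [Set.indicator_of_mem hω]
      exact tendsto_cascadeMass h hs
    · have hω : ω ∉ G := h
      simp [Set.indicator_of_notMem hω, h0]
  refine Measurable.measure_of_isPiSystem borel_eq_generateFrom_cylinderFamily
    isPiSystem_cylinderFamily ?_ (hclopen _ isClopen_univ)
  rintro s (rfl | ⟨⟨x, n⟩, rfl⟩)
  · simp
  · exact hclopen _ (isClopen_cylinder x n)

/-- The limit measure as a kernel. -/
noncomputable def limitKernel (hX : IsCascade P ρ X) (ν : Measure (SymbolicSpace b))
    [IsFiniteMeasure ν] : Kernel Ω (SymbolicSpace b) :=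
  ⟨fun ω => (limitMeasure X ν ω : Measure (SymbolicSpace b)), hX.measurable_limitMeasure⟩

/-- Fatou's lemma against weights of words of length at most `n`. -/
theorem IsCascade.lintegral_mul_limitMeasure_le (hX : IsCascade P ρ X) [IsProbabilityMeasure P]
    [IsFiniteMeasure ν] {f : Ω → ℝ≥0∞} {n : ℕ}
    (hf : Measurable[wordAlgebra X {u | u.length ≤ n}] f) {B : Set (SymbolicSpace b)}
    (hB : IsClopen B) :
    ∫⁻ ω, f ω * (limitMeasure X ν ω : Measure (SymbolicSpace b)) B ∂P ≤
      ∫⁻ ω, f ω * cascadeMass X ν n B ω ∂P := by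
  have hf' : Measurable f := hf.mono (hX.wordAlgebra_le _) le_rfl
  calc ∫⁻ ω, f ω * (limitMeasure X ν ω : Measure (SymbolicSpace b)) B ∂P
      ≤ ∫⁻ ω, liminf (fun m => f ω * cascadeMass X ν m B ω) atTop ∂P := by
        refine lintegral_mono_ae ?_
        filter_upwards [hX.ae_tendsto_limitMeasure (ν := ν)] with ω hω
        -- Multiplication on [0, ∞] is not continuous at (∞, 0), so the product is bounded through
        -- strictly smaller factors.
        exact ENNReal.mul_le_of_forall_lt fun a ha c hc => by
          refine le_liminf_of_le (by isBoundedDefault) ?_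
          filter_upwards [(tendsto_cascadeMass hω hB).eventually (lt_mem_nhds hc)] with m hm
          exact mul_le_mul' ha.le hm.le
    _ ≤ liminf (fun m => ∫⁻ ω, f ω * cascadeMass X ν m B ω ∂P) atTop :=
        lintegral_liminf_le fun m => hf'.mul (hX.measurable_mass m B)
    _ = ∫⁻ ω, f ω * cascadeMass X ν n B ω ∂P := by
        refine Tendsto.liminf_eq (tendsto_const_nhds.congr' ?_)
        filter_upwards [eventually_ge_atTop n] with m hm
        exact (hX.lintegral_mul_mass hf hm B).symm

end Cascade

end MandelbrotCascade

namespace MandelbrotCascade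

variable {b : ℕ} {Ω : Type*} {X : List (Fin b) → Ω → ℝ≥0} {ν : Measure (SymbolicSpace b)}

/-! ### The size-biased law along a ray -/

/-- The size-biased law `t ρ(dt)`. -/
noncomputable def sizeBiased (ρ : Measure ℝ≥0) : Measure ℝ≥0 :=
  ρ.withDensity fun t => (t : ℝ≥0∞)

/-- The law of an i.i.d. sequence of size-biased weights. -/
noncomputable def pathLaw (ρ : Measure ℝ≥0) : Measure (ℕ → ℝ≥0) :=
  Measure.infinitePi fun _ => sizeBiased ρ

/-- The weights along the ray of `x`. -/
def spine (X : List (Fin b) → Ω → ℝ≥0) (x : SymbolicSpace b) (ω : Ω) : ℕ → ℝ≥0 :=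
  fun k => X (prefixWord x (k + 1)) ω

/-- The product of the first `n` terms of a sequence. -/
def partialProd (n : ℕ) (y : ℕ → ℝ≥0) : ℝ≥0 := ∏ k ∈ Finset.range n, y k

theorem partialProd_spine (n : ℕ) (x : SymbolicSpace b) (ω : Ω) :
    partialProd n (spine X x ω) = cascadeDensity X n ω x := rfl

theorem measurable_partialProd (n : ℕ) : Measurable (partialProd n) :=
  Finset.measurable_fun_prod _ fun k _ => measurable_pi_apply k

theorem partialProd_congr {n : ℕ} {y z : ℕ → ℝ≥0} (h : ∀ k < n, y k = z k) :
    partialProd n y = partialProd n z :=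
  Finset.prod_congr rfl fun k hk => h k (Finset.mem_range.1 hk)

section Cascade

variable [MeasurableSpace Ω] {P : Measure Ω} {ρ : Measure ℝ≥0}

theorem IsCascade.isProbabilityMeasure_sizeBiased (hX : IsCascade P ρ X) :
    IsProbabilityMeasure (sizeBiased ρ) :=
  ⟨by rw [sizeBiased, withDensity_apply _ MeasurableSet.univ, setLIntegral_univ, hX.mean]⟩

theorem IsCascade.measurable_spine (hX : IsCascade P ρ X) (x : SymbolicSpace b) :
    Measurable (spine X x) :=
  measurable_pi_iff.2 fun k => hX.measurable _ (prefixWord_succ_ne_nil x k)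

/-- The density Q_N(·,x) is the product of the very weights considered, so it splits over them and
biases each one separately. -/
theorem IsCascade.map_spine_restrict (hX : IsCascade P ρ X) (x : SymbolicSpace b) (N : ℕ) :
    ((P.withDensity fun ω => (cascadeDensity X N ω x : ℝ≥0∞)).map
      fun ω => (Finset.range N).restrict (spine X x ω)) =
      Measure.pi fun _ : Finset.range N => sizeBiased ρ := by
  have := hX.isProbabilityMeasure_sizeBiased
  have hmeas : Measurable fun ω => (Finset.range N).restrict (spine X x ω) :=
    (Finset.measurable_restrict _).comp (hX.measurable_spine x)
  -- The prefixes of x have different lengths, hence are different words.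
  have hind : iIndepFun (fun (k : ℕ) ω => X (prefixWord x (k + 1)) ω) P := by
    have := hX.indep.precomp (g := fun k : ℕ =>
      (⟨prefixWord x (k + 1), prefixWord_succ_ne_nil x k⟩ : {u : List (Fin b) // u ≠ []}))
      fun i j hij => by
        have := congrArg (fun u : {u : List (Fin b) // u ≠ []} => u.1.length) hij
        simpa [length_prefixWord] using this
    exact this
  refine (Measure.pi_eq fun t ht => ?_).symm
  rw [Measure.map_apply hmeas (MeasurableSet.univ_pi ht), withDensity_apply _
    (hmeas (MeasurableSet.univ_pi ht)), ← lintegral_indicator (hmeas (MeasurableSet.univ_pi ht))]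
  let g : Finset.range N → ℝ≥0 → ℝ≥0∞ := fun i => (t i).indicator fun s => (s : ℝ≥0∞)
  have hg : ∀ i, Measurable (g i) := fun i => measurable_coe_nnreal_ennreal.indicator (ht i)
  have hprod := lintegral_prod_eq_prod_lintegral_of_indepFun (μ := P) Finset.univ
    (fun (i : Finset.range N) ω => g i (X (prefixWord x (i + 1)) ω))
    ((hind.precomp Subtype.val_injective).comp g hg)
    fun i => (hg i).comp (hX.measurable _ (prefixWord_succ_ne_nil x i))
  calc _ = ∫⁻ ω, ∏ i : Finset.range N, g i (X (prefixWord x (i + 1)) ω) ∂P := by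
        refine lintegral_congr fun ω => ?_
        by_cases hω : ω ∈ (fun ω => (Finset.range N).restrict (spine X x ω)) ⁻¹' Set.univ.pi t
        · rw [Set.indicator_of_mem hω, cascadeDensity, ENNReal.ofNNReal_finsetProd,
            ← Finset.prod_coe_sort]
          refine Finset.prod_congr rfl fun i _ => ?_
          have : X (prefixWord x (i + 1)) ω ∈ t i := hω i (Set.mem_univ i)
          simp [g, this]
        · rw [Set.indicator_of_notMem hω]
          have : ∃ i, X (prefixWord x ((i : ℕ) + 1)) ω ∉ t i := by
            by_contra! hall
            exact hω fun i _ => hall i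
          obtain ⟨i, hi⟩ := this
          exact (Finset.prod_eq_zero (Finset.mem_univ i) (by simp [g, hi])).symm
    _ = ∏ i : Finset.range N, ∫⁻ ω, g i (X (prefixWord x (i + 1)) ω) ∂P := hprod
    _ = _ := by
        refine Finset.prod_congr rfl fun i _ => ?_
        rw [sizeBiased, withDensity_apply _ (ht i), ← lintegral_indicator (ht i),
          ← hX.law _ (prefixWord_succ_ne_nil x i),
          lintegral_map (hg i) (hX.measurable _ (prefixWord_succ_ne_nil x i))]

theorem IsCascade.lintegral_density_mul_spine (hX : IsCascade P ρ X) (x : SymbolicSpace b) {N : ℕ}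
    {f : (ℕ → ℝ≥0) → ℝ≥0∞} (hf : Measurable f)
    (hdep : ∀ y z : ℕ → ℝ≥0, (∀ k < N, y k = z k) → f y = f z) :
    ∫⁻ ω, (cascadeDensity X N ω x : ℝ≥0∞) * f (spine X x ω) ∂P = ∫⁻ y, f y ∂pathLaw ρ := by
  have := hX.isProbabilityMeasure_sizeBiased
  -- Padding by 0 is a section of the restriction to the first N terms, and f cannot see the
  -- padding.
  let e : (Finset.range N → ℝ≥0) → ℕ → ℝ≥0 := fun z k =>
    if h : k ∈ Finset.range N then z ⟨k, h⟩ else 0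
  have he : Measurable e := by
    refine measurable_pi_iff.2 fun k => ?_
    by_cases h : k ∈ Finset.range N
    · simpa only [e, dif_pos h] using measurable_pi_apply _
    · simpa only [e, dif_neg h] using measurable_const
  have hfe : ∀ y, f y = f (e ((Finset.range N).restrict y)) := fun y =>
    hdep _ _ fun k hk => by simp [e, hk]
  have hmeas : Measurable fun ω => (Finset.range N).restrict (spine X x ω) :=
    (Finset.measurable_restrict _).comp (hX.measurable_spine x)
  have hQ : Measurable fun ω => (cascadeDensity X N ω x : ℝ≥0∞) :=
    (measurable_coe_nnreal_ennreal.comp (measurable_cascadeDensity N x)).mono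
      (hX.wordAlgebra_le _) le_rfl
  have hfem : Measurable fun z => f (e z) := hf.comp he
  have hfes : Measurable fun ω => f (e ((Finset.range N).restrict (spine X x ω))) :=
    hfem.comp hmeas
  calc _ = ∫⁻ ω, f (e ((Finset.range N).restrict (spine X x ω)))
        ∂(P.withDensity fun ω => (cascadeDensity X N ω x : ℝ≥0∞)) := by
        rw [lintegral_withDensity_eq_lintegral_mul _ hQ hfes]
        refine lintegral_congr fun ω => ?_
        rw [hfe]
        rfl
    _ = ∫⁻ z, f (e z) ∂Measure.pi fun _ : Finset.range N => sizeBiased ρ := by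
        rw [← hX.map_spine_restrict x N, lintegral_map hfem hmeas]
    _ = ∫⁻ y, f y ∂pathLaw ρ := by
        rw [← Measure.infinitePi_map_restrict (μ := fun _ : ℕ => sizeBiased ρ),
          lintegral_map hfem (Finset.measurable_restrict _)]
        exact lintegral_congr fun y => (hfe y).symm

end Cascade

/-! ### Growth of products of size-biased weights -/

section Growth

variable {ρ : Measure ℝ≥0}

theorem ae_pathLaw_tendsto_average [IsProbabilityMeasure (sizeBiased ρ)] {φ : ℝ≥0 → ℝ}
    (hφ : Measurable φ) (hint : Integrable φ (sizeBiased ρ)) :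
    ∀ᵐ y ∂pathLaw ρ, Tendsto (fun n : ℕ => (∑ k ∈ Finset.range n, φ (y k)) / n) atTop
      (𝓝 (∫ t, φ t ∂sizeBiased ρ)) := by
  have hmp : ∀ k, MeasurePreserving (fun y : ℕ → ℝ≥0 => y k) (pathLaw ρ) (sizeBiased ρ) :=
    fun k => ⟨measurable_pi_apply k, Measure.infinitePi_map_eval _ k⟩
  have hind : iIndepFun (fun (k : ℕ) (y : ℕ → ℝ≥0) => φ (y k)) (pathLaw ρ) :=
    iIndepFun_infinitePi fun _ => hφ
  have h := strong_law_ae_real (μ := pathLaw ρ) (fun k y => φ (y k))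
    ((hmp 0).integrable_comp_of_integrable hint) (fun i j hij => hind.indepFun hij)
    fun k => ⟨(hφ.comp (measurable_pi_apply k)).aemeasurable,
      (hφ.comp (measurable_pi_apply 0)).aemeasurable, by
        have h1 := fun k => Measure.map_map (μ := pathLaw ρ) hφ (measurable_pi_apply k)
        simp only [(hmp _).map_eq] at h1
        exact (h1 k).symm.trans (h1 0)⟩
  have hmean : ∫ y, φ (y 0) ∂pathLaw ρ = ∫ t, φ t ∂sizeBiased ρ := by
    rw [← (hmp 0).map_eq, integral_map (hmp 0).measurable.aemeasurable
      hφ.aestronglyMeasurable]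
  rwa [hmean] at h

/-- Size-biasing removes the atom at 0, so log turns products into sums along almost every path. -/
theorem ae_pathLaw_pos [IsProbabilityMeasure (sizeBiased ρ)] :
    ∀ᵐ y ∂pathLaw ρ, ∀ k, 0 < y k := by
  refine ae_all_iff.2 fun k => ?_
  have hmp : MeasurePreserving (fun y : ℕ → ℝ≥0 => y k) (pathLaw ρ) (sizeBiased ρ) :=
    ⟨measurable_pi_apply k, Measure.infinitePi_map_eval _ k⟩
  have h0 : ∀ᵐ t ∂sizeBiased ρ, 0 < t := by
    rw [sizeBiased, ae_withDensity_iff measurable_coe_nnreal_ennreal]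
    refine ae_of_all _ fun t ht => pos_iff_ne_zero.2 fun h => ht (by simp [h])
  exact hmp.quasiMeasurePreserving.ae h0

/-- With φ = log the right side is E(X log X): this is where h_X enters as a growth rate. -/
theorem integral_sizeBiased (φ : ℝ≥0 → ℝ) :
    ∫ t, φ t ∂sizeBiased ρ = ∫ t, (t : ℝ) * φ t ∂ρ :=
  integral_withDensity_eq_integral_smul measurable_id φ

theorem integrable_sizeBiased_iff {φ : ℝ≥0 → ℝ} :
    Integrable φ (sizeBiased ρ) ↔ Integrable (fun t : ℝ≥0 => (t : ℝ) * φ t) ρ :=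
  integrable_withDensity_iff_integrable_smul measurable_id

theorem neg_mul_log_le_one (t : ℝ≥0) : -((t : ℝ) * Real.log t) ≤ 1 := by
  rcases eq_or_ne t 0 with rfl | ht
  · simp
  · have ht : (0 : ℝ) < t := by exact_mod_cast pos_iff_ne_zero.2 ht
    have h := Real.log_le_sub_one_of_pos (inv_pos.2 ht)
    rw [Real.log_inv] at h
    have h2 := mul_le_mul_of_nonneg_left h ht.le
    rw [mul_sub, mul_inv_cancel₀ ht.ne'] at h2
    linarith

variable [IsProbabilityMeasure ρ]

theorem lintegral_neg_entropy_ne_top :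
    ∫⁻ t : ℝ≥0, ENNReal.ofReal (-((t : ℝ) * Real.log t)) ∂ρ ≠ ∞ := by
  refine ne_top_of_le_ne_top ENNReal.one_ne_top ?_
  calc _ ≤ ∫⁻ _ : ℝ≥0, 1 ∂ρ := lintegral_mono fun t =>
        ENNReal.ofReal_le_one.2 (neg_mul_log_le_one t)
    _ = 1 := by simp

theorem measurable_mul_log : Measurable fun t : ℝ≥0 => (t : ℝ) * Real.log t :=
  measurable_coe_nnreal_real.mul (Real.measurable_log.comp measurable_coe_nnreal_real)

theorem coe_partialProd_eq_exp {y : ℕ → ℝ≥0} (hy : ∀ k, 0 < y k) (n : ℕ) :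
    (partialProd n y : ℝ≥0∞) =
      ENNReal.ofReal (Real.exp (∑ k ∈ Finset.range n, Real.log (y k))) := by
  rw [Real.exp_sum, Finset.prod_congr rfl fun k _ => Real.exp_log (show (0 : ℝ) < y k from hy k),
    ← NNReal.coe_prod, ENNReal.ofReal_coe_nnreal]
  rfl

theorem ae_pathLaw_eventually_le [IsProbabilityMeasure (sizeBiased ρ)] {c : ℝ}
    (hc : cascadeEntropy ρ < c) :
    ∀ᵐ y ∂pathLaw ρ, ∀ᶠ n in atTop, (partialProd n y : ℝ≥0∞) ≤ expDecay (-c) n := by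
  have hB := lintegral_neg_entropy_ne_top (ρ := ρ)
  -- The negative part is finite, so an infinite positive part would give h_X = ∞, against h_X < c.
  have hA : ∫⁻ t : ℝ≥0, ENNReal.ofReal ((t : ℝ) * Real.log t) ∂ρ ≠ ∞ := by
    intro h
    rw [cascadeEntropy, h, EReal.coe_ennreal_top,
      EReal.top_sub (EReal.coe_ennreal_eq_top_iff.not.2 hB)] at hc
    exact not_top_lt hc
  have hint : Integrable (fun t : ℝ≥0 => (t : ℝ) * Real.log t) ρ := by
    refine ⟨measurable_mul_log.aestronglyMeasurable, ?_⟩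
    refine (lintegral_mono fun t => ?_).trans_lt
      (((lintegral_add_left measurable_mul_log.ennreal_ofReal _).trans_lt
        (ENNReal.add_lt_top.2 ⟨hA.lt_top, hB.lt_top⟩)))
    rw [Real.enorm_eq_ofReal_abs]
    rcases abs_cases ((t : ℝ) * Real.log t) with h | h
    · rw [h.1]
      exact le_self_add
    · rw [h.1]
      exact le_add_self
  have hmean : ∫ t : ℝ≥0, (t : ℝ) * Real.log t ∂ρ < c := by
    rw [integral_eq_lintegral_pos_part_sub_lintegral_neg_part hint]
    rw [cascadeEntropy, ← ENNReal.ofReal_toReal hA, ← ENNReal.ofReal_toReal hB,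
      EReal.coe_ennreal_ofReal, EReal.coe_ennreal_ofReal, max_eq_left ENNReal.toReal_nonneg,
      max_eq_left ENNReal.toReal_nonneg] at hc
    exact_mod_cast hc
  have hφ : Measurable fun t : ℝ≥0 => Real.log t :=
    Real.measurable_log.comp measurable_coe_nnreal_real
  filter_upwards [ae_pathLaw_tendsto_average hφ (integrable_sizeBiased_iff.2 hint),
    ae_pathLaw_pos (ρ := ρ)] with y hy hpos
  rw [integral_sizeBiased] at hy
  filter_upwards [hy.eventually (gt_mem_nhds hmean), eventually_gt_atTop 0] with n hn h0
  rw [coe_partialProd_eq_exp hpos, expDecay]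
  refine ENNReal.ofReal_le_ofReal (Real.exp_le_exp.2 ?_)
  have := (div_lt_iff₀ (by exact_mod_cast h0)).1 hn
  linarith

theorem integrable_mul_min_log (hone : ∫⁻ t, (t : ℝ≥0∞) ∂ρ = 1) (K : ℕ) :
    Integrable (fun t : ℝ≥0 => (t : ℝ) * min (Real.log t) K) ρ := by
  have ht : Integrable (fun t : ℝ≥0 => (t : ℝ)) ρ := by
    refine ⟨measurable_coe_nnreal_real.aestronglyMeasurable, ?_⟩
    refine (lintegral_congr fun t => ?_).trans_lt (hone.trans_lt ENNReal.one_lt_top)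
    change ‖(t : ℝ)‖ₑ = _
    rw [Real.enorm_of_nonneg (NNReal.coe_nonneg t), ENNReal.ofReal_coe_nnreal]
  refine Integrable.mono' ((integrable_const (1 : ℝ)).add (ht.mul_const (K : ℝ)))
    (measurable_coe_nnreal_real.mul ((Real.measurable_log.comp measurable_coe_nnreal_real).min
      measurable_const)).aestronglyMeasurable (ae_of_all _ fun t => ?_)
  have hK : (0 : ℝ) ≤ t * K := mul_nonneg t.2 (Nat.cast_nonneg K)
  rw [Real.norm_eq_abs, abs_le]
  simp only [Pi.add_apply]
  constructor
  · rcases le_total (Real.log t) K with h | h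
    · rw [min_eq_left h]
      linarith [neg_mul_log_le_one t]
    · rw [min_eq_right h]
      linarith
  · have := mul_le_mul_of_nonneg_left (min_le_right (Real.log t) K) t.2
    linarith!

/-- Monotone convergence in K, applied to the positive parts. It gives a finite mean above c even
when h_X = ∞. -/
theorem exists_lt_integral_min_log (hone : ∫⁻ t, (t : ℝ≥0∞) ∂ρ = 1) {c : ℝ}
    (hc : (c : EReal) < cascadeEntropy ρ) :
    ∃ K : ℕ, c < ∫ t : ℝ≥0, (t : ℝ) * min (Real.log t) K ∂ρ := by
  have hB := lintegral_neg_entropy_ne_top (ρ := ρ)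
  set B := ∫⁻ t : ℝ≥0, ENNReal.ofReal (-((t : ℝ) * Real.log t)) ∂ρ with hBdef
  let F : ℕ → ℝ≥0 → ℝ≥0∞ := fun K t => ENNReal.ofReal ((t : ℝ) * min (Real.log t) K)
  -- Since K ≥ 0, the truncation only changes log where it is positive.
  have hneg : ∀ K : ℕ, ∫⁻ t : ℝ≥0, ENNReal.ofReal (-((t : ℝ) * min (Real.log t) K)) ∂ρ = B := by
    intro K
    refine lintegral_congr fun t => ?_
    rcases le_total (Real.log t) K with h | h
    · rw [min_eq_left h]
    · rw [min_eq_right h, ENNReal.ofReal_of_nonpos, ENNReal.ofReal_of_nonpos]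
      · exact neg_nonpos.2 (mul_nonneg t.2 ((Nat.cast_nonneg K).trans h))
      · exact neg_nonpos.2 (mul_nonneg t.2 (Nat.cast_nonneg K))
  have hmean : ∀ K : ℕ, ∫ t : ℝ≥0, (t : ℝ) * min (Real.log t) K ∂ρ =
      (∫⁻ t, F K t ∂ρ).toReal - B.toReal := by
    intro K
    rw [integral_eq_lintegral_pos_part_sub_lintegral_neg_part (integrable_mul_min_log hone K),
      hneg]
  have hFfin : ∀ K, ∫⁻ t, F K t ∂ρ ≠ ∞ := by
    intro K
    refine ((lintegral_mono fun t => ?_).trans_lt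
      (integrable_mul_min_log hone K).hasFiniteIntegral).ne
    rw [Real.enorm_eq_ofReal_abs]
    exact ENNReal.ofReal_le_ofReal (le_abs_self _)
  have hlim : Tendsto (fun K => ∫⁻ t, F K t ∂ρ) atTop
      (𝓝 (∫⁻ t : ℝ≥0, ENNReal.ofReal ((t : ℝ) * Real.log t) ∂ρ)) := by
    refine lintegral_tendsto_of_tendsto_of_monotone (fun K => ?_) (ae_of_all _ fun t => ?_)
      (ae_of_all _ fun t => ?_)
    · exact (integrable_mul_min_log hone K).aestronglyMeasurable.aemeasurable.ennreal_ofReal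
    · intro K L hKL
      refine ENNReal.ofReal_le_ofReal (mul_le_mul_of_nonneg_left ?_ t.2)
      exact min_le_min_left _ (by exact_mod_cast hKL)
    · refine tendsto_const_nhds.congr' ?_
      obtain ⟨m, hm⟩ := exists_nat_ge (Real.log t)
      filter_upwards [eventually_ge_atTop m] with K hK
      have : Real.log t ≤ K := hm.trans (by exact_mod_cast hK)
      simp only [F, min_eq_left this]
  have hcA : ((c + B.toReal : ℝ) : EReal) <
      ((∫⁻ t : ℝ≥0, ENNReal.ofReal ((t : ℝ) * Real.log t) ∂ρ : ℝ≥0∞) : EReal) := by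
    rw [cascadeEntropy, ← hBdef, ← ENNReal.ofReal_toReal hB, EReal.coe_ennreal_ofReal,
      max_eq_left ENNReal.toReal_nonneg,
      EReal.lt_sub_iff_add_lt (Or.inl (EReal.coe_ne_bot _)) (Or.inl (EReal.coe_ne_top _))] at hc
    exact_mod_cast hc
  -- If c + B < 0, then K = 0 already works, because every truncated mean is at least -B.
  rcases lt_or_ge (c + B.toReal) 0 with h0 | h0
  · refine ⟨0, ?_⟩
    rw [hmean]
    linarith [(ENNReal.toReal_nonneg : 0 ≤ (∫⁻ t, F 0 t ∂ρ).toReal)]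
  · have h1 : ENNReal.ofReal (c + B.toReal) <
        ∫⁻ t : ℝ≥0, ENNReal.ofReal ((t : ℝ) * Real.log t) ∂ρ := by
      rw [← EReal.coe_ennreal_lt_coe_ennreal_iff, EReal.coe_ennreal_ofReal, max_eq_left h0]
      exact hcA
    obtain ⟨K, hK⟩ := (hlim.eventually (lt_mem_nhds h1)).exists
    refine ⟨K, ?_⟩
    rw [hmean]
    have := (ENNReal.ofReal_lt_iff_lt_toReal h0 (hFfin K)).1 hK
    linarith

theorem ae_pathLaw_eventually_ge [IsProbabilityMeasure (sizeBiased ρ)]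
    (hone : ∫⁻ t, (t : ℝ≥0∞) ∂ρ = 1) {c : ℝ}
    (hc : (c : EReal) < cascadeEntropy ρ) :
    ∀ᵐ y ∂pathLaw ρ, ∀ᶠ n in atTop, expDecay (-c) n ≤ partialProd n y := by
  obtain ⟨K, hK⟩ := exists_lt_integral_min_log hone hc
  have hφ : Measurable fun t : ℝ≥0 => min (Real.log t) K :=
    (Real.measurable_log.comp measurable_coe_nnreal_real).min measurable_const
  filter_upwards [ae_pathLaw_tendsto_average hφ
    (integrable_sizeBiased_iff.2 (integrable_mul_min_log hone K)),
    ae_pathLaw_pos (ρ := ρ)] with y hy hpos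
  rw [integral_sizeBiased] at hy
  filter_upwards [hy.eventually (lt_mem_nhds hK), eventually_gt_atTop 0] with n hn h0
  rw [coe_partialProd_eq_exp hpos, expDecay]
  refine ENNReal.ofReal_le_ofReal (Real.exp_le_exp.2 ?_)
  have h1 := (lt_div_iff₀ (by exact_mod_cast h0)).1 hn
  have h2 : ∑ k ∈ Finset.range n, min (Real.log (y k)) K ≤
      ∑ k ∈ Finset.range n, Real.log (y k) := Finset.sum_le_sum fun k _ => min_le_left _ _
  linarith

end Growth

end MandelbrotCascade

namespace MandelbrotCascade

variable {b : ℕ} {Ω : Type*} {X : List (Fin b) → Ω → ℝ≥0} {ν : Measure (SymbolicSpace b)}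

/-! ### The finite-level Peyrière measures -/

/-- The sum `∑_{n ≤ k ≤ N} y_1 ⋯ y_k ν([x|_k])`. -/
noncomputable def spineSum (ν : Measure (SymbolicSpace b)) (n N : ℕ) (x : SymbolicSpace b)
    (y : ℕ → ℝ≥0) : ℝ≥0∞ :=
  ∑ k ∈ Finset.Icc n N, partialProd k y * ν (cylinder x k)

theorem measurable_spineSum (n N : ℕ) (x : SymbolicSpace b) : Measurable (spineSum ν n N x) :=
  Finset.measurable_fun_sum _ fun k _ =>
    (measurable_coe_nnreal_ennreal.comp (measurable_partialProd k)).mul_const _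

theorem measurable_uncurry_spineSum (n N : ℕ) :
    Measurable fun p : SymbolicSpace b × (ℕ → ℝ≥0) => spineSum ν n N p.1 p.2 :=
  Finset.measurable_fun_sum _ fun k _ =>
    ((measurable_coe_nnreal_ennreal.comp (measurable_partialProd k)).comp measurable_snd).mul
      ((measurable_measure_cylinder ν k).comp measurable_fst)

theorem spineSum_congr {n N : ℕ} (x : SymbolicSpace b) {y z : ℕ → ℝ≥0}
    (h : ∀ k < N, y k = z k) : spineSum ν n N x y = spineSum ν n N x z :=
  Finset.sum_congr rfl fun k hk => by
    rw [partialProd_congr fun i hi => h i (hi.trans_le (Finset.mem_Icc.1 hk).2)]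

/-- The measure `Q_N(ω, x) P(dω) ν(dx)`. -/
noncomputable def levelMeasure [MeasurableSpace Ω] (P : Measure Ω) (X : List (Fin b) → Ω → ℝ≥0)
    (ν : Measure (SymbolicSpace b)) (N : ℕ) : Measure (Ω × SymbolicSpace b) :=
  (P.prod ν).withDensity fun p => (cascadeDensity X N p.1 p.2 : ℝ≥0∞)

section Cascade

variable [MeasurableSpace Ω] {P : Measure Ω} {ρ : Measure ℝ≥0}

theorem measurable_comp_firstLetters {α : Type*} [MeasurableSpace α] {n : ℕ}
    {G : (Fin n → Fin b) → Ω → α} (hG : ∀ v, Measurable (G v)) :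
    Measurable fun p : Ω × SymbolicSpace b => G (firstLetters n p.2) p.1 := by
  have h1 : Measurable fun q : Ω × (Fin n → Fin b) => G q.2 q.1 :=
    measurable_from_prod_countable_left hG
  exact h1.comp (measurable_fst.prodMk ((measurable_firstLetters n).comp measurable_snd))

theorem IsCascade.measurable_uncurry_mass_cylinder (hX : IsCascade P ρ X) [SFinite ν]
    (n N : ℕ) :
    Measurable fun p : Ω × SymbolicSpace b => cascadeMass X ν N (cylinder p.2 n) p.1 := by
  simp_rw [cylinder_eq_preimage]
  exact measurable_comp_firstLetters
    (G := fun v ω => cascadeMass X ν N (firstLetters n ⁻¹' {v}) ω) fun v => hX.measurable_mass N _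

theorem IsCascade.measurable_density_coe (hX : IsCascade P ρ X) (N : ℕ) :
    Measurable fun p : Ω × SymbolicSpace b => (cascadeDensity X N p.1 p.2 : ℝ≥0∞) :=
  measurable_coe_nnreal_ennreal.comp (hX.measurable_uncurry N)

theorem IsCascade.measurable_uncurry_spine (hX : IsCascade P ρ X) :
    Measurable fun p : Ω × SymbolicSpace b => spine X p.2 p.1 := by
  refine measurable_pi_iff.2 fun k => ?_
  exact measurable_comp_firstLetters (n := k + 1) (G := fun v ω => X (List.ofFn v) ω) fun v =>
    hX.measurable (List.ofFn v) (by simp)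

/-- The first moment bound along a ray, for functions of the weights of that ray. -/
theorem IsCascade.lintegral_mul_density_le (hX : IsCascade P ρ X) {x y : SymbolicSpace b}
    {f : Ω → ℝ≥0∞} (hf : Measurable[wordAlgebra X (Set.range (prefixWord x))] f) {n N : ℕ}
    (hy : y ∈ cylinder x n) (hnN : n ≤ N) :
    ∫⁻ ω, f ω * cascadeDensity X N ω y ∂P ≤
      ∑ k ∈ Finset.Icc n N,
        (∫⁻ ω, f ω * cascadeDensity X k ω x ∂P) * (cylinder x k).indicator 1 y := by
  -- The index k is the length of the common prefix of x and y, capped at N. Beyond k the weights of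
  -- y are off the ray of x and average to 1, and Q_k takes the same value at both points.
  suffices h : ∃ k ∈ Finset.Icc n N, y ∈ cylinder x k ∧
      ∫⁻ ω, f ω * cascadeDensity X N ω y ∂P = ∫⁻ ω, f ω * cascadeDensity X k ω x ∂P by
    obtain ⟨k, hk, hyk, heq⟩ := h
    rw [heq]
    refine le_trans (le_of_eq ?_) (Finset.single_le_sum (f := fun k =>
      (∫⁻ ω, f ω * cascadeDensity X k ω x ∂P) * (cylinder x k).indicator 1 y)
      (fun _ _ => zero_le) hk)
    simp [hyk]
  by_cases hyN : y ∈ cylinder x N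
  · refine ⟨N, Finset.mem_Icc.2 ⟨hnN, le_rfl⟩, hyN, ?_⟩
    simp_rw [cascadeDensity_congr hyN]
  · classical
    have hex : ∃ m, y ∉ cylinder x m := ⟨N, hyN⟩
    have hpos : 0 < Nat.find hex := by
      rw [Nat.find_pos]
      simp [cylinder_zero]
    obtain ⟨k, hk⟩ := Nat.exists_eq_add_of_le' hpos
    have hk1 : y ∉ cylinder x (k + 1) := hk ▸ Nat.find_spec hex
    have hk2 : y ∈ cylinder x k := not_not.1 (Nat.find_min hex (by omega))
    have hkN : k < N := by
      have := Nat.find_min' hex hyN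
      omega
    have hnk : n ≤ k := by
      by_contra hlt
      exact hk1 (cylinder_anti x (by omega) hy)
    refine ⟨k, Finset.mem_Icc.2 ⟨hnk, hkN.le⟩, hk2, ?_⟩
    rw [hX.lintegral_mul_density hf y hkN.le]
    · simp_rw [cascadeDensity_congr hk2]
    -- A prefix of y on the ray of x equals the prefix of x of the same length, which is impossible
    -- beyond the separation level.
    · rintro j hj - ⟨i, hi⟩
      have hij : i = j + 1 := by
        have := congrArg List.length hi
        rwa [length_prefixWord, length_prefixWord] at this
      subst hij
      exact hk1 (cylinder_anti x (by omega : k + 1 ≤ j + 1) hi.symm)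

theorem IsCascade.measurableSet_mass_spineSum (hX : IsCascade P ρ X) [SFinite ν] (n N : ℕ)
    (s t : ℝ≥0∞) :
    MeasurableSet {p : Ω × SymbolicSpace b | t < cascadeMass X ν N (cylinder p.2 n) p.1 ∧
        spineSum ν n N p.2 (spine X p.2 p.1) ≤ s} :=
  (measurableSet_lt measurable_const (hX.measurable_uncurry_mass_cylinder n N)).inter
    (measurableSet_le ((measurable_uncurry_spineSum n N).comp
      (measurable_snd.prodMk hX.measurable_uncurry_spine)) measurable_const)

theorem IsCascade.lintegral_levelMeasure (hX : IsCascade P ρ X) [SFinite ν] (N : ℕ)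
    {F : Ω × SymbolicSpace b → ℝ≥0∞} (hF : Measurable F) :
    ∫⁻ p, F p ∂levelMeasure P X ν N =
      ∫⁻ ω, ∫⁻ x, cascadeDensity X N ω x * F (ω, x) ∂ν ∂P := by
  have hQ := hX.measurable_density_coe N
  rw [levelMeasure, lintegral_withDensity_eq_lintegral_mul _ hQ hF,
    lintegral_prod _ (hQ.mul hF).aemeasurable]
  rfl

variable [IsProbabilityMeasure P]

theorem IsCascade.lintegral_levelMeasure_symm (hX : IsCascade P ρ X) [SFinite ν] (N : ℕ)
    {F : Ω × SymbolicSpace b → ℝ≥0∞} (hF : Measurable F) :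
    ∫⁻ p, F p ∂levelMeasure P X ν N =
      ∫⁻ x, ∫⁻ ω, cascadeDensity X N ω x * F (ω, x) ∂P ∂ν := by
  have hQ := hX.measurable_density_coe N
  rw [levelMeasure, lintegral_withDensity_eq_lintegral_mul _ hQ hF,
    lintegral_prod_symm _ (hQ.mul hF).aemeasurable]
  rfl

theorem IsCascade.lintegral_density (hX : IsCascade P ρ X) (N : ℕ) (x : SymbolicSpace b) :
    ∫⁻ ω, (cascadeDensity X N ω x : ℝ≥0∞) ∂P = 1 := by
  have h := hX.lintegral_mul_density (S := ∅) (f := fun _ => 1) measurable_const x (Nat.zero_le N)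
    fun _ _ _ h => h
  simpa [cascadeDensity_zero] using h

theorem IsCascade.isProbabilityMeasure_levelMeasure (hX : IsCascade P ρ X)
    [IsProbabilityMeasure ν] (N : ℕ) : IsProbabilityMeasure (levelMeasure P X ν N) := by
  constructor
  have h := hX.lintegral_levelMeasure_symm (ν := ν) N (F := fun _ => 1) measurable_const
  simpa [hX.lintegral_density] using h

/-- Under the level measures, the weights along the ray are i.i.d. with size-biased law and
independent of the ray. -/
theorem IsCascade.lintegral_levelMeasure_spine (hX : IsCascade P ρ X) [IsProbabilityMeasure ν]
    {N : ℕ} {F : SymbolicSpace b × (ℕ → ℝ≥0) → ℝ≥0∞} (hF : Measurable F)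
    (hdep : ∀ x, ∀ y z : ℕ → ℝ≥0, (∀ k < N, y k = z k) → F (x, y) = F (x, z)) :
    ∫⁻ p, F (p.2, spine X p.2 p.1) ∂levelMeasure P X ν N = ∫⁻ q, F q ∂ν.prod (pathLaw ρ) := by
  have := hX.isProbabilityMeasure_sizeBiased
  have : IsProbabilityMeasure (pathLaw ρ) := by
    unfold pathLaw
    infer_instance
  rw [hX.lintegral_levelMeasure_symm N (F := fun p => F (p.2, spine X p.2 p.1))
    (hF.comp (measurable_snd.prodMk hX.measurable_uncurry_spine)),
    lintegral_prod _ hF.aemeasurable]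
  exact lintegral_congr fun x => hX.lintegral_density_mul_spine x
    (hF.comp measurable_prodMk_left) (hdep x)

theorem IsCascade.levelMeasure_spine (hX : IsCascade P ρ X) [IsProbabilityMeasure ν]
    {N : ℕ} {A : Set (SymbolicSpace b × (ℕ → ℝ≥0))} (hA : MeasurableSet A)
    (hdep : ∀ x, ∀ y z : ℕ → ℝ≥0, (∀ k < N, y k = z k) → ((x, y) ∈ A ↔ (x, z) ∈ A)) :
    levelMeasure P X ν N {p | (p.2, spine X p.2 p.1) ∈ A} = (ν.prod (pathLaw ρ)) A := by
  have hmeas : Measurable fun p : Ω × SymbolicSpace b => (p.2, spine X p.2 p.1) :=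
    measurable_snd.prodMk hX.measurable_uncurry_spine
  rw [← lintegral_indicator_one hA, ← hX.lintegral_levelMeasure_spine (N := N)
    (measurable_one.indicator hA) fun x y z h => ?_]
  · have hA' : MeasurableSet {p : Ω × SymbolicSpace b | (p.2, spine X p.2 p.1) ∈ A} := hmeas hA
    rw [← lintegral_indicator_one hA']
    rfl
  · by_cases hy : (x, y) ∈ A
    · simp [hy, (hdep x y z h).1 hy]
    · simp [hy, mt (hdep x y z h).2 hy]

/-- A Markov inequality conditional on the ray of x. The factor f = Q_N(x) on {spine sum ≤ s}, and 0
elsewhere, depends only on the weights of that ray. Replacing t by the mass of the cylinder and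
using the first moment bound gives E(f · spine sum) ≤ s E(Q_N(x)) = s. -/
theorem IsCascade.mul_lintegral_density_indicator_le (hX : IsCascade P ρ X) [IsFiniteMeasure ν]
    (x : SymbolicSpace b) {n N : ℕ} (hnN : n ≤ N) (s t : ℝ≥0∞) :
    t * ∫⁻ ω, (cascadeDensity X N ω x : ℝ≥0∞) *
      {ω | t < cascadeMass X ν N (cylinder x n) ω ∧
        spineSum ν n N x (spine X x ω) ≤ s}.indicator 1 ω ∂P ≤ s := by
  classical
  have hspine : Measurable[wordAlgebra X (Set.range (prefixWord x))] (spine X x) :=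
    (@measurable_pi_iff _ _ _ (wordAlgebra X (Set.range (prefixWord x))) _ _).2 fun k =>
      measurable_wordAlgebra ⟨k + 1, rfl⟩ (prefixWord_succ_ne_nil x k)
  let γ : (ℕ → ℝ≥0) → ℝ≥0∞ := fun y =>
    (partialProd N y : ℝ≥0∞) * {y | spineSum ν n N x y ≤ s}.indicator 1 y
  have hγ : Measurable γ :=
    (measurable_coe_nnreal_ennreal.comp (measurable_partialProd N)).mul
      (measurable_one.indicator (measurableSet_le (measurable_spineSum n N x) measurable_const))
  let f : Ω → ℝ≥0∞ := fun ω => γ (spine X x ω)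
  have hf : Measurable[wordAlgebra X (Set.range (prefixWord x))] f := hγ.comp hspine
  have hf' : Measurable f := hf.mono (hX.wordAlgebra_le _) le_rfl
  have hQ : ∀ k, Measurable fun ω => (cascadeDensity X k ω x : ℝ≥0∞) := fun k =>
    (hX.measurable_density_coe k).comp measurable_prodMk_right
  calc _ = ∫⁻ ω, t * ((cascadeDensity X N ω x : ℝ≥0∞) *
        {ω | t < cascadeMass X ν N (cylinder x n) ω ∧
          spineSum ν n N x (spine X x ω) ≤ s}.indicator 1 ω) ∂P := by
        rw [lintegral_const_mul]
        refine (hQ N).mul (measurable_one.indicator (MeasurableSet.inter ?_ ?_))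
        · exact measurableSet_lt measurable_const (hX.measurable_mass N _)
        · exact measurableSet_le ((measurable_spineSum n N x).comp (hX.measurable_spine x))
            measurable_const
    _ ≤ ∫⁻ ω, f ω * cascadeMass X ν N (cylinder x n) ω ∂P := by
        refine lintegral_mono fun ω => ?_
        by_cases h : t < cascadeMass X ν N (cylinder x n) ω ∧ spineSum ν n N x (spine X x ω) ≤ s
        · have h1 : f ω = cascadeDensity X N ω x := by
            simp [f, γ, h.2, partialProd_spine]
          rw [h1, Set.indicator_of_mem (by exact h), Pi.one_apply, mul_one, mul_comm]
          exact mul_le_mul' le_rfl h.1.le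
        · rw [Set.indicator_of_notMem (by exact h)]
          simp
    _ = ∫⁻ y in cylinder x n, ∫⁻ ω, f ω * cascadeDensity X N ω y ∂P ∂ν :=
        hX.lintegral_mul_mass_eq hf' N _
    _ ≤ ∫⁻ y in cylinder x n, ∑ k ∈ Finset.Icc n N,
          (∫⁻ ω, f ω * cascadeDensity X k ω x ∂P) * (cylinder x k).indicator 1 y ∂ν :=
        setLIntegral_mono' (measurableSet_cylinder x n) fun y hy =>
          hX.lintegral_mul_density_le hf hy hnN
    _ ≤ ∫⁻ y, ∑ k ∈ Finset.Icc n N,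
          (∫⁻ ω, f ω * cascadeDensity X k ω x ∂P) * (cylinder x k).indicator 1 y ∂ν :=
        setLIntegral_le_lintegral _ _
    _ = ∑ k ∈ Finset.Icc n N, (∫⁻ ω, f ω * cascadeDensity X k ω x ∂P) * ν (cylinder x k) := by
        rw [lintegral_finsetSum _ fun k _ => (measurable_one.indicator
          (measurableSet_cylinder x k)).const_mul _]
        refine Finset.sum_congr rfl fun k _ => ?_
        rw [lintegral_const_mul _ (measurable_one.indicator (measurableSet_cylinder x k)),
          lintegral_indicator_one (measurableSet_cylinder x k)]
    _ = ∫⁻ ω, f ω * spineSum ν n N x (spine X x ω) ∂P := by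
        simp_rw [spineSum, Finset.mul_sum, partialProd_spine, ← mul_assoc]
        have hfQ : ∀ k, Measurable fun ω => f ω * cascadeDensity X k ω x := fun k =>
          hf'.mul (hQ k)
        rw [lintegral_finsetSum _ fun k _ => (hfQ k).mul_const _]
        exact Finset.sum_congr rfl fun k _ => (lintegral_mul_const _ (hfQ k)).symm
    _ ≤ ∫⁻ ω, s * cascadeDensity X N ω x ∂P := by
        refine lintegral_mono fun ω => ?_
        by_cases h : spineSum ν n N x (spine X x ω) ≤ s
        · have h1 : f ω = cascadeDensity X N ω x := by
            simp [f, γ, h, partialProd_spine]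
          rw [h1, mul_comm]
          exact mul_le_mul' h le_rfl
        · have h1 : f ω = 0 := by simp [f, γ, h]
          simp [h1]
    _ = s := by rw [lintegral_const_mul _ (hQ N), hX.lintegral_density, mul_one]

theorem IsCascade.mul_levelMeasure_le (hX : IsCascade P ρ X) [IsProbabilityMeasure ν]
    {n N : ℕ} (hnN : n ≤ N) (s t : ℝ≥0∞) :
    t * levelMeasure P X ν N {p | t < cascadeMass X ν N (cylinder p.2 n) p.1 ∧
        spineSum ν n N p.2 (spine X p.2 p.1) ≤ s} ≤ s := by
  have hA := hX.measurableSet_mass_spineSum (ν := ν) n N s t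
  have hmeas := Measurable.lintegral_prod_left' (μ := P)
    ((hX.measurable_density_coe N).mul (measurable_one.indicator hA))
  rw [← lintegral_indicator_one hA, hX.lintegral_levelMeasure_symm N (measurable_one.indicator hA)]
  refine (lintegral_const_mul t hmeas).symm.trans_le ?_
  calc _ ≤ ∫⁻ _, s ∂ν := lintegral_mono fun x =>
        hX.mul_lintegral_density_indicator_le x hnN s t
    _ = s := by simp

end Cascade

end MandelbrotCascade

namespace MandelbrotCascade

variable {b : ℕ} {Ω : Type*} {X : List (Fin b) → Ω → ℝ≥0} {ν : Measure (SymbolicSpace b)}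

/-! ### Singularity -/

theorem cascadeMass_cylinder (n : ℕ) (x : SymbolicSpace b) (ω : Ω) :
    cascadeMass X ν n (cylinder x n) ω = cascadeDensity X n ω x * ν (cylinder x n) := by
  rw [cascadeMass, setLIntegral_congr_fun (g := fun _ => (cascadeDensity X n ω x : ℝ≥0∞))
    (measurableSet_cylinder x n) fun y hy => by rw [cascadeDensity_congr hy], setLIntegral_const]

theorem cascadeMass_mono (n : ℕ) {A B : Set (SymbolicSpace b)} (h : A ⊆ B) (ω : Ω) :
    cascadeMass X ν n A ω ≤ cascadeMass X ν n B ω := lintegral_mono_set h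

section Cascade

variable [MeasurableSpace Ω] {P : Measure Ω} {ρ : Measure ℝ≥0}

theorem IsCascade.isProbabilityMeasure_pathLaw (hX : IsCascade P ρ X) :
    IsProbabilityMeasure (pathLaw ρ) := by
  have := hX.isProbabilityMeasure_sizeBiased
  unfold pathLaw
  infer_instance

variable [IsProbabilityMeasure P]

theorem IsCascade.isProbabilityMeasure_law (hX : IsCascade P ρ X) [IsProbabilityMeasure ν] :
    IsProbabilityMeasure ρ := by
  obtain ⟨x⟩ : Nonempty (SymbolicSpace b) := nonempty_of_isProbabilityMeasure ν
  rw [← hX.law _ (prefixWord_succ_ne_nil x 0)]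
  exact Measure.isProbabilityMeasure_map (hX.measurable _ (prefixWord_succ_ne_nil x 0)).aemeasurable

theorem IsCascade.ae_forall_eventually_ge (hX : IsCascade P ρ X) [IsProbabilityMeasure ν] :
    ∀ᵐ y ∂pathLaw ρ, ∀ q : ℚ, ((q : ℝ) : EReal) < cascadeEntropy ρ →
      ∀ᶠ n in atTop, expDecay (-q) n ≤ partialProd n y := by
  have := hX.isProbabilityMeasure_sizeBiased
  have := hX.isProbabilityMeasure_law (ν := ν)
  refine ae_all_iff.2 fun q => ?_
  by_cases h : ((q : ℝ) : EReal) < cascadeEntropy ρ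
  · filter_upwards [ae_pathLaw_eventually_ge hX.mean h] with y hy _ using hy
  · exact ae_of_all _ fun y hy => absurd hy h

theorem IsCascade.ae_forall_eventually_le (hX : IsCascade P ρ X) [IsProbabilityMeasure ν] :
    ∀ᵐ y ∂pathLaw ρ, ∀ q : ℚ, cascadeEntropy ρ < ((q : ℝ) : EReal) →
      ∀ᶠ n in atTop, (partialProd n y : ℝ≥0∞) ≤ expDecay (-q) n := by
  have := hX.isProbabilityMeasure_sizeBiased
  have := hX.isProbabilityMeasure_law (ν := ν)
  refine ae_all_iff.2 fun q => ?_
  by_cases h : cascadeEntropy ρ < ((q : ℝ) : EReal)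
  · filter_upwards [ae_pathLaw_eventually_le h] with y hy _ using hy
  · exact ae_of_all _ fun y hy => absurd hy h

/-- Choose c < d strictly between the local dimension and h_X. Infinitely often ν([x|_n]) ≥ e^{-cn},
and eventually the product of weights is at least e^{dn}. -/
theorem IsCascade.ae_exists_lt_partialProd_mul (hX : IsCascade P ρ X) [IsProbabilityMeasure ν]
    (h : ∀ᵐ x ∂ν, lowerLocalDim ν x < cascadeEntropy ρ) :
    ∀ᵐ q ∂ν.prod (pathLaw ρ), ∀ K : ℕ, ∃ n,
      (K : ℝ≥0∞) < partialProd n q.2 * ν (cylinder q.1 n) := by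
  have := hX.isProbabilityMeasure_pathLaw
  filter_upwards [Measure.quasiMeasurePreserving_fst.ae h,
    Measure.quasiMeasurePreserving_snd.ae (hX.ae_forall_eventually_ge (ν := ν))] with q hx hy K
  obtain ⟨c, hc1, hc2⟩ := EReal.lt_iff_exists_rat_btwn.1 hx
  obtain ⟨d, hd1, hd2⟩ := EReal.lt_iff_exists_rat_btwn.1 hc2
  have hcd : (c : ℝ) - d < 0 := sub_neg.2 (by exact_mod_cast hd1)
  obtain ⟨n, hn1, hn2, hn3⟩ := ((frequently_of_lowerLocalDim_lt hc1).and_eventually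
    ((hy d hd2).and ((tendsto_expDecay_top hcd).eventually
      (lt_mem_nhds (ENNReal.natCast_lt_top K))))).exists
  refine ⟨n, hn3.trans_le ?_⟩
  rw [sub_eq_neg_add, expDecay_add]
  exact mul_le_mul' hn2 hn1

/-- The left side is the level measure of {M_n ≤ K for n ≤ N}, and M_n dominates the mass Q_n
ν([x|_n]) of the cylinder around the ray. -/
theorem IsCascade.lintegral_mass_mul_indicator_le (hX : IsCascade P ρ X) [IsProbabilityMeasure ν]
    (N : ℕ) (K : ℝ≥0∞) :
    ∫⁻ ω, cascadeMass X ν N Set.univ ω *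
      {ω | ∀ n ≤ N, cascadeMass X ν n Set.univ ω ≤ K}.indicator 1 ω ∂P ≤
    (ν.prod (pathLaw ρ)) {q | ∀ n ≤ N, partialProd n q.2 * ν (cylinder q.1 n) ≤ K} := by
  have hD : MeasurableSet {q : SymbolicSpace b × (ℕ → ℝ≥0) |
      ∀ n ≤ N, partialProd n q.2 * ν (cylinder q.1 n) ≤ K} := by
    simp only [Set.ofPred_forall]
    refine MeasurableSet.iInter fun n => MeasurableSet.iInter fun _ =>
      measurableSet_le (Measurable.mul ?_ ?_) measurable_const
    · exact (measurable_coe_nnreal_ennreal.comp (measurable_partialProd n)).comp measurable_snd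
    · exact (measurable_measure_cylinder ν n).comp measurable_fst
  have hD' : MeasurableSet {p : Ω × SymbolicSpace b | (p.2, spine X p.2 p.1) ∈
      {q : SymbolicSpace b × (ℕ → ℝ≥0) |
        ∀ n ≤ N, partialProd n q.2 * ν (cylinder q.1 n) ≤ K}} :=
    (measurable_snd.prodMk hX.measurable_uncurry_spine) hD
  rw [← hX.levelMeasure_spine (N := N) hD, ← lintegral_indicator_one hD',
    hX.lintegral_levelMeasure N (measurable_one.indicator hD')]
  · refine lintegral_mono fun ω => ?_
    by_cases hω : ∀ n ≤ N, cascadeMass X ν n Set.univ ω ≤ K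
    · rw [Set.indicator_of_mem (by exact hω), Pi.one_apply, mul_one, cascadeMass,
        setLIntegral_univ]
      refine lintegral_mono fun x => ?_
      rw [Set.indicator_of_mem, Pi.one_apply, mul_one]
      intro n hn
      simp only
      rw [partialProd_spine, ← cascadeMass_cylinder]
      exact (cascadeMass_mono n (Set.subset_univ _) ω).trans (hω n hn)
    · rw [Set.indicator_of_notMem (by exact hω), mul_zero]
      exact zero_le
  · intro x y z hyz
    refine forall₂_congr fun n hn => ?_
    simp only
    rw [partialProd_congr fun i hi => hyz i (hi.trans_le hn)]

theorem IsCascade.isQSingular (hX : IsCascade P ρ X) [IsProbabilityMeasure ν]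
    (h : ∀ᵐ x ∂ν, lowerLocalDim ν x < cascadeEntropy ρ) : IsQSingular P X ν := by
  have := hX.isProbabilityMeasure_pathLaw
  have hlim : ∀ K : ℕ, Tendsto (fun N => (ν.prod (pathLaw ρ))
      {q | ∀ n ≤ N, partialProd n q.2 * ν (cylinder q.1 n) ≤ (K : ℝ≥0∞)}) atTop (𝓝 0) := by
    intro K
    have h0 : (ν.prod (pathLaw ρ)) (⋂ N,
        {q | ∀ n ≤ N, partialProd n q.2 * ν (cylinder q.1 n) ≤ (K : ℝ≥0∞)}) = 0 := by
      rw [measure_eq_zero_iff_ae_notMem]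
      filter_upwards [hX.ae_exists_lt_partialProd_mul h] with q hq hmem
      obtain ⟨n, hn⟩ := hq K
      exact absurd (Set.mem_iInter.1 hmem n n le_rfl) (not_le.2 hn)
    rw [← h0]
    refine tendsto_measure_iInter_atTop (fun N => MeasurableSet.nullMeasurableSet ?_)
      (fun M N hMN q hq n hn => hq n (hn.trans hMN)) ⟨0, measure_ne_top _ _⟩
    simp only [Set.ofPred_forall]
    refine MeasurableSet.iInter fun n => MeasurableSet.iInter fun _ =>
      measurableSet_le (Measurable.mul ?_ ?_) measurable_const
    · exact (measurable_coe_nnreal_ennreal.comp (measurable_partialProd n)).comp measurable_snd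
    · exact (measurable_measure_cylinder ν n).comp measurable_fst
  let g : ℕ → ℕ → Ω → ℝ≥0∞ := fun K N ω => cascadeMass X ν N Set.univ ω *
    {ω | ∀ n ≤ N, cascadeMass X ν n Set.univ ω ≤ K}.indicator 1 ω
  have hg : ∀ K N, Measurable (g K N) := by
    intro K N
    refine (hX.measurable_mass N _).mul (measurable_one.indicator ?_)
    simp only [Set.ofPred_forall]
    exact MeasurableSet.iInter fun n => MeasurableSet.iInter fun _ =>
      measurableSet_le (hX.measurable_mass n _) measurable_const
  have hzero : ∀ K, ∀ᵐ ω ∂P, liminf (fun N => g K N ω) atTop = 0 := by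
    intro K
    have h1 : ∫⁻ ω, liminf (fun N => g K N ω) atTop ∂P = 0 := by
      refine le_antisymm ((lintegral_liminf_le (hg K)).trans ?_) zero_le
      rw [← (hlim K).liminf_eq]
      exact liminf_le_liminf (Eventually.of_forall fun N =>
        hX.lintegral_mass_mul_indicator_le N K)
    exact (lintegral_eq_zero_iff (Measurable.liminf (hg K))).1 h1
  filter_upwards [ae_all_iff.2 hzero, hX.ae_tendsto_limitMeasure (ν := ν)] with ω hω hconv
  have hM := tendsto_cascadeMass hconv isClopen_univ
  -- A convergent sequence of finite masses with finite limit is bounded. The bound depends on ω,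
  -- whence the preceding statement for all integers K at once.
  obtain ⟨K, hK⟩ : ∃ K : ℕ, ∀ n, cascadeMass X ν n Set.univ ω ≤ K := by
    obtain ⟨N, hN⟩ := eventually_atTop.1 (hM.eventually
      (gt_mem_nhds (ENNReal.lt_add_right (measure_ne_top _ _) one_ne_zero)))
    obtain ⟨K, hK⟩ := ENNReal.exists_nat_gt (r := ((limitMeasure X ν ω :
      Measure (SymbolicSpace b)) Set.univ + 1) + ∑ n ∈ Finset.range N,
        cascadeMass X ν n Set.univ ω) (ENNReal.add_ne_top.2
        ⟨ENNReal.add_ne_top.2 ⟨measure_ne_top _ _, ENNReal.one_ne_top⟩,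
          ENNReal.sum_ne_top.2 fun n _ => cascadeMass_ne_top n ω MeasurableSet.univ⟩)
    refine ⟨K, fun n => le_trans ?_ hK.le⟩
    rcases le_or_gt N n with hn | hn
    · exact (hN n hn).le.trans le_self_add
    · exact (Finset.single_le_sum (f := fun n => cascadeMass X ν n Set.univ ω)
        (fun _ _ => zero_le) (Finset.mem_range.2 hn)).trans le_add_self
  have hgK : (fun N => g K N ω) = fun N => cascadeMass X ν N Set.univ ω := by
    funext N
    have : ω ∈ {ω | ∀ n ≤ N, cascadeMass X ν n Set.univ ω ≤ K} := fun n _ => hK n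
    simp only [g, Set.indicator_of_mem this, Pi.one_apply, mul_one]
  have h0 := hω K
  rw [hgK, hM.liminf_eq] at h0
  exact Subtype.ext (Measure.measure_univ_eq_zero.1 h0)

/-! ### Regularity -/

/-- Term k is at most e^{-(a-c)k} once n is large; the shift of a geometric series pulls out
e^{-(a-c)n}. The bound is uniform in N. -/
theorem eventually_spineSum_le {x : SymbolicSpace b} {y : ℕ → ℝ≥0} {a c : ℝ}
    (hν : ∀ᶠ n in atTop, ν (cylinder x n) ≤ expDecay a n)
    (hy : ∀ᶠ n in atTop, (partialProd n y : ℝ≥0∞) ≤ expDecay (-c) n) :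
    ∀ᶠ n in atTop, ∀ N, spineSum ν n N x y ≤
      expDecay (a - c) n * ∑' k, expDecay (a - c) k := by
  obtain ⟨n₀, h₀⟩ := eventually_atTop.1 (hν.and hy)
  filter_upwards [eventually_ge_atTop n₀] with n hn N
  calc spineSum ν n N x y ≤ ∑ k ∈ Finset.Icc n N, expDecay (a - c) k := by
        refine Finset.sum_le_sum fun k hk => ?_
        have h := h₀ k (hn.trans (Finset.mem_Icc.1 hk).1)
        rw [sub_eq_neg_add, expDecay_add]
        exact mul_le_mul' h.2 h.1
    _ ≤ ∑ k ∈ Finset.Ico (0 + n) (N + 1 + n), expDecay (a - c) k :=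
        Finset.sum_le_sum_of_subset fun k hk => by
          rw [Finset.mem_Icc] at hk
          rw [Finset.mem_Ico]
          omega
    _ = ∑ k ∈ Finset.range (N + 1), expDecay (a - c) n * expDecay (a - c) k := by
        rw [← Finset.sum_Ico_add', Finset.range_eq_Ico]
        refine Finset.sum_congr rfl fun k _ => ?_
        rw [expDecay_eq_pow, expDecay_eq_pow, expDecay_eq_pow, ← pow_add, add_comm]
    _ = expDecay (a - c) n * ∑ k ∈ Finset.range (N + 1), expDecay (a - c) k :=
        (Finset.mul_sum _ _ _).symm
    _ ≤ _ := by
        gcongr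
        exact ENNReal.sum_le_tsum _

theorem spineSum_ne_top [IsFiniteMeasure ν] (n N : ℕ) (x : SymbolicSpace b) (y : ℕ → ℝ≥0) :
    spineSum ν n N x y ≠ ∞ :=
  ENNReal.sum_ne_top.2 fun _ _ => ENNReal.mul_ne_top ENNReal.coe_ne_top (measure_ne_top _ _)

theorem IsCascade.ae_exists_spineSum_le (hX : IsCascade P ρ X) [IsProbabilityMeasure ν]
    (h : ∀ᵐ x ∂ν, cascadeEntropy ρ < lowerLocalDim ν x) :
    ∀ᵐ q ∂ν.prod (pathLaw ρ), ∃ K : ℕ, ∀ N, spineSum ν 0 N q.1 q.2 ≤ K := by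
  have := hX.isProbabilityMeasure_pathLaw
  filter_upwards [Measure.quasiMeasurePreserving_fst.ae h,
    Measure.quasiMeasurePreserving_snd.ae (hX.ae_forall_eventually_le (ν := ν))] with q hx hy
  obtain ⟨c, hc1, hc2⟩ := EReal.lt_iff_exists_rat_btwn.1 hx
  obtain ⟨a, ha1, ha2⟩ := EReal.lt_iff_exists_rat_btwn.1 hc2
  have hca : 0 < (a : ℝ) - c := sub_pos.2 (by exact_mod_cast ha1)
  obtain ⟨n, hn⟩ := (eventually_spineSum_le (eventually_of_lt_lowerLocalDim ha2)
    (hy c hc1)).exists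
  obtain ⟨K, hK⟩ := ENNReal.exists_nat_gt (r := spineSum ν 0 n q.1 q.2 +
    expDecay (a - c) n * ∑' k, expDecay (a - c) k) (ENNReal.add_ne_top.2
      ⟨spineSum_ne_top _ _ _ _, ENNReal.mul_ne_top (expDecay_ne_top _ _)
        (tsum_expDecay_ne_top hca)⟩)
  refine ⟨K, fun N => le_trans ?_ hK.le⟩
  refine le_trans ?_ (add_le_add le_rfl (hn N))
  rw [spineSum, spineSum, spineSum]
  -- The ranges 0..n and n..N together contain 0..N; counting their overlap twice is harmless for an
  -- upper bound.
  rw [← Finset.sum_union_inter]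
  refine (Finset.sum_le_sum_of_subset fun k hk => ?_).trans le_self_add
  simp only [Finset.mem_union, Finset.mem_Icc] at hk ⊢
  omega

end Cascade

end MandelbrotCascade

/-! ### Regularity: tightness of the total mass -/

namespace MandelbrotCascade

variable {b : ℕ} {Ω : Type*} {X : List (Fin b) → Ω → ℝ≥0} {ν : Measure (SymbolicSpace b)}

section Cascade

variable [MeasurableSpace Ω] {P : Measure Ω} {ρ : Measure ℝ≥0} [IsProbabilityMeasure P]

theorem measurableSet_exists_lt_spineSum (n : ℕ) (s : ℝ≥0∞) :
    MeasurableSet {q : SymbolicSpace b × (ℕ → ℝ≥0) | ∃ N, s < spineSum ν n N q.1 q.2} := by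
  rw [Set.ofPred_exists]
  exact MeasurableSet.iUnion fun N =>
    measurableSet_lt measurable_const (measurable_uncurry_spineSum n N)

theorem IsCascade.tendsto_measure_exists_lt_spineSum (hX : IsCascade P ρ X)
    [IsProbabilityMeasure ν] (h : ∀ᵐ x ∂ν, cascadeEntropy ρ < lowerLocalDim ν x) :
    Tendsto (fun K : ℕ => (ν.prod (pathLaw ρ)) {q | ∃ N, (K : ℝ≥0∞) < spineSum ν 0 N q.1 q.2})
      atTop (𝓝 0) := by
  have := hX.isProbabilityMeasure_pathLaw
  have h0 : (ν.prod (pathLaw ρ))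
      (⋂ K : ℕ, {q | ∃ N, (K : ℝ≥0∞) < spineSum ν 0 N q.1 q.2}) = 0 := by
    rw [measure_eq_zero_iff_ae_notMem]
    filter_upwards [hX.ae_exists_spineSum_le h] with q hq hmem
    obtain ⟨K, hK⟩ := hq
    obtain ⟨N, hN⟩ := Set.mem_iInter.1 hmem K
    exact absurd hN (not_lt.2 (hK N))
  rw [← h0]
  refine tendsto_measure_iInter_atTop
    (fun K => (measurableSet_exists_lt_spineSum 0 K).nullMeasurableSet) ?_
    ⟨0, measure_ne_top _ _⟩
  rintro K L hKL q ⟨N, hN⟩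
  exact ⟨N, lt_of_le_of_lt (by exact_mod_cast hKL) hN⟩

theorem IsCascade.levelMeasure_lt_spineSum_le (hX : IsCascade P ρ X) [IsProbabilityMeasure ν]
    (n N : ℕ) (s : ℝ≥0∞) :
    levelMeasure P X ν N {p | s < spineSum ν n N p.2 (spine X p.2 p.1)} ≤
      (ν.prod (pathLaw ρ)) {q | ∃ N, s < spineSum ν n N q.1 q.2} := by
  have hA : MeasurableSet {q : SymbolicSpace b × (ℕ → ℝ≥0) | s < spineSum ν n N q.1 q.2} :=
    measurableSet_lt measurable_const (measurable_uncurry_spineSum n N)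
  refine (hX.levelMeasure_spine hA fun x y z hyz => ?_).le.trans
    (measure_mono fun q hq => ⟨N, hq⟩)
  simp only [Set.mem_ofPred_eq]
  rw [spineSum_congr x hyz]

/-- The expectation of M_N on {M_N > t} is the level measure of {M_N > t}. Either the spine sum
exceeds s, or the conditional Markov inequality for the cylinder of length 0, the whole space, gives
at most s/t. -/
theorem IsCascade.one_le_lintegral_min_mass_add (hX : IsCascade P ρ X) [IsProbabilityMeasure ν]
    (N : ℕ) (s : ℝ≥0∞) {t : ℝ≥0∞} (ht : t ≠ 0) (ht' : t ≠ ∞) :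
    1 ≤ ∫⁻ ω, min (cascadeMass X ν N Set.univ ω) t ∂P +
      ((ν.prod (pathLaw ρ)) {q | ∃ N, s < spineSum ν 0 N q.1 q.2} + s / t) := by
  have hM := hX.measurable_mass (ν := ν) N Set.univ
  have hB : MeasurableSet {p : Ω × SymbolicSpace b | t < cascadeMass X ν N Set.univ p.1} :=
    measurableSet_lt measurable_const (hM.comp measurable_fst)
  calc (1 : ℝ≥0∞) = ∫⁻ ω, cascadeMass X ν N Set.univ ω ∂P := by
        rw [hX.lintegral_mass N, measure_univ]
    _ ≤ ∫⁻ ω, (min (cascadeMass X ν N Set.univ ω) t +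
          ∫⁻ x, cascadeDensity X N ω x *
            {p : Ω × SymbolicSpace b | t < cascadeMass X ν N Set.univ p.1}.indicator 1 (ω, x) ∂ν)
          ∂P := by
        refine lintegral_mono fun ω => ?_
        rcases le_or_gt (cascadeMass X ν N Set.univ ω) t with h | h
        · rw [min_eq_left h]
          exact le_self_add
        · refine le_trans (le_of_eq ?_) le_add_self
          rw [cascadeMass, setLIntegral_univ]
          refine lintegral_congr fun x => ?_
          rw [Set.indicator_of_mem (by exact h), Pi.one_apply, mul_one]
    _ = ∫⁻ ω, min (cascadeMass X ν N Set.univ ω) t ∂P +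
          levelMeasure P X ν N {p | t < cascadeMass X ν N Set.univ p.1} := by
        rw [lintegral_add_left (hM.min measurable_const), ← lintegral_indicator_one hB,
          hX.lintegral_levelMeasure N (measurable_one.indicator hB)]
    _ ≤ _ := add_le_add le_rfl ?_
  have hsub : {p : Ω × SymbolicSpace b | t < cascadeMass X ν N Set.univ p.1} ⊆
      {p | s < spineSum ν 0 N p.2 (spine X p.2 p.1)} ∪
        {p | t < cascadeMass X ν N (cylinder p.2 0) p.1 ∧
          spineSum ν 0 N p.2 (spine X p.2 p.1) ≤ s} := by
    intro p hp
    rcases le_or_gt (spineSum ν 0 N p.2 (spine X p.2 p.1)) s with h | h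
    · right
      refine ⟨?_, h⟩
      rw [cylinder_zero]
      exact hp
    · exact Or.inl h
  refine (measure_mono hsub).trans ((measure_union_le _ _).trans
    (add_le_add (hX.levelMeasure_lt_spineSum_le 0 N s) ?_))
  rw [ENNReal.le_div_iff_mul_le (Or.inl ht) (Or.inl ht'), mul_comm]
  exact hX.mul_levelMeasure_le (Nat.zero_le N) s t

theorem IsCascade.lintegral_limitMeasure_univ_le (hX : IsCascade P ρ X) [IsProbabilityMeasure ν] :
    ∫⁻ ω, (limitMeasure X ν ω : Measure (SymbolicSpace b)) Set.univ ∂P ≤ 1 := by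
  have h := hX.lintegral_mul_limitMeasure_le (ν := ν) (n := 0) (f := fun _ => 1)
    measurable_const isClopen_univ
  simpa [hX.lintegral_mass 0] using h

/-- Fatou's lemma gives the upper bound. For the lower bound, let N → ∞ by dominated convergence at
the truncation level T + 1, then T → ∞ to remove K/(T + 1), then K → ∞ by almost sure boundedness of
the spine sums. -/
theorem IsCascade.isQRegular (hX : IsCascade P ρ X) [IsProbabilityMeasure ν]
    (h : ∀ᵐ x ∂ν, cascadeEntropy ρ < lowerLocalDim ν x) : IsQRegular P X ν := by
  rw [IsQRegular, measure_univ]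
  refine le_antisymm hX.lintegral_limitMeasure_univ_le ?_
  set M := ∫⁻ ω, (limitMeasure X ν ω : Measure (SymbolicSpace b)) Set.univ ∂P
  have key : ∀ K T : ℕ, 1 ≤ M + ((ν.prod (pathLaw ρ))
      {q | ∃ N, (K : ℝ≥0∞) < spineSum ν 0 N q.1 q.2} + K / ((T : ℝ≥0∞) + 1)) := by
    intro K T
    have hT : (T : ℝ≥0∞) + 1 ≠ ∞ := by simp
    have hlim : Tendsto (fun N => ∫⁻ ω, min (cascadeMass X ν N Set.univ ω) (T + 1) ∂P) atTop
        (𝓝 (∫⁻ ω, min ((limitMeasure X ν ω : Measure (SymbolicSpace b)) Set.univ) (T + 1) ∂P)) := by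
      refine tendsto_lintegral_of_dominated_convergence (fun _ => (T : ℝ≥0∞) + 1)
        (fun N => (hX.measurable_mass N _).min measurable_const)
        (fun N => ae_of_all _ fun ω => min_le_right _ _) (by simp) ?_
      filter_upwards [hX.ae_tendsto_limitMeasure (ν := ν)] with ω hω
      exact (tendsto_cascadeMass hω isClopen_univ).min tendsto_const_nhds
    refine (ge_of_tendsto' (hlim.add_const _) fun N =>
      hX.one_le_lintegral_min_mass_add N K (by simp) hT).trans ?_
    exact add_le_add (lintegral_mono fun ω => min_le_left _ _) le_rfl
  have key2 : ∀ K : ℕ, 1 ≤ M + (ν.prod (pathLaw ρ))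
      {q | ∃ N, (K : ℝ≥0∞) < spineSum ν 0 N q.1 q.2} := by
    intro K
    have h1 : Tendsto (fun T : ℕ => (K : ℝ≥0∞) / ((T : ℝ≥0∞) + 1)) atTop (𝓝 0) := by
      have : Tendsto (fun T : ℕ => (T : ℝ≥0∞) + 1) atTop (𝓝 ∞) := by
        simpa [Function.comp_def] using ENNReal.tendsto_nat_nhds_top.comp (tendsto_add_atTop_nat 1)
      have h2 := ENNReal.Tendsto.const_div this (Or.inr (ENNReal.natCast_ne_top K))
      simpa using h2
    have h2 := (tendsto_const_nhds (x := M)).add ((tendsto_const_nhds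
      (x := (ν.prod (pathLaw ρ)) {q | ∃ N, (K : ℝ≥0∞) < spineSum ν 0 N q.1 q.2})).add h1)
    rw [add_zero] at h2
    exact ge_of_tendsto' h2 (key K)
  have h3 := (tendsto_const_nhds (x := M)).add (hX.tendsto_measure_exists_lt_spineSum h)
  rw [add_zero] at h3
  exact ge_of_tendsto' h3 key2

end Cascade

end MandelbrotCascade

namespace MandelbrotCascade

variable {b : ℕ} {Ω : Type*} {X : List (Fin b) → Ω → ℝ≥0} {ν : Measure (SymbolicSpace b)}

/-! ### The Peyrière measure of the limit -/

theorem isClopen_preimage_firstLetters (n : ℕ) (v : Fin n → Fin b) :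
    IsClopen (firstLetters n ⁻¹' {v} : Set (SymbolicSpace b)) := by
  by_cases hv : ∃ x, firstLetters n x = v
  · obtain ⟨x, rfl⟩ := hv
    rw [← cylinder_eq_preimage]
    exact isClopen_cylinder x n
  · have : firstLetters n ⁻¹' {v} = (∅ : Set (SymbolicSpace b)) :=
      Set.eq_empty_of_forall_notMem fun x hx => hv ⟨x, hx⟩
    rw [this]
    exact isClopen_empty

/-- The total masses need not be uniformly bounded, so the parameter space is cut according to the
integer part of the mass. -/
theorem isSFiniteKernel_of_isFiniteMeasure {α β : Type*} [MeasurableSpace α] [MeasurableSpace β]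
    (κ : Kernel α β) (h : ∀ a, IsFiniteMeasure (κ a)) : IsSFiniteKernel κ := by
  classical
  have hs : ∀ n : ℕ, MeasurableSet {a | ⌊(κ a Set.univ).toNNReal⌋₊ = n} := fun n =>
    (Nat.measurable_floor.comp (κ.measurable_coe MeasurableSet.univ).ennreal_toNNReal)
      (measurableSet_singleton n)
  have hfin : ∀ n, IsFiniteKernel (Kernel.piecewise (hs n) κ 0) := by
    intro n
    refine ⟨⟨(n : ℝ≥0∞) + 1, by simp, fun a => ?_⟩⟩
    rw [Kernel.piecewise_apply]
    split_ifs with ha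
    · have h1 := (Nat.lt_floor_add_one (κ a Set.univ).toNNReal).le
      rw [show ⌊(κ a Set.univ).toNNReal⌋₊ = n from ha] at h1
      rw [← ENNReal.coe_toNNReal (measure_ne_top (κ a) Set.univ)]
      exact_mod_cast h1
    · simp
  have hsum : κ = Kernel.sum fun n => Kernel.piecewise (hs n) κ 0 := by
    refine Kernel.ext fun a => Measure.ext fun t ht => ?_
    rw [Kernel.sum_apply' _ _ ht, tsum_eq_single ⌊(κ a Set.univ).toNNReal⌋₊]
    · rw [Kernel.piecewise_apply, if_pos (by exact rfl)]
    · intro n hn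
      rw [Kernel.piecewise_apply, if_neg (by exact fun h' => hn h'.symm)]
      simp
  rw [hsum]
  infer_instance

section Cascade

variable [MeasurableSpace Ω] {P : Measure Ω} {ρ : Measure ℝ≥0} [IsProbabilityMeasure P]

instance (hX : IsCascade P ρ X) [IsFiniteMeasure ν] : IsSFiniteKernel (limitKernel hX ν) :=
  isSFiniteKernel_of_isFiniteMeasure _ fun ω =>
    inferInstanceAs (IsFiniteMeasure (limitMeasure X ν ω : Measure (SymbolicSpace b)))

/-- The measure `(Q · ν)(ω, dx) P(dω)`. -/
noncomputable def peyriereMeasure (hX : IsCascade P ρ X) (ν : Measure (SymbolicSpace b))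
    [IsFiniteMeasure ν] : Measure (Ω × SymbolicSpace b) :=
  P ⊗ₘ limitKernel hX ν

theorem lintegral_peyriereMeasure (hX : IsCascade P ρ X) [IsFiniteMeasure ν]
    {f : Ω × SymbolicSpace b → ℝ≥0∞} (hf : Measurable f) :
    ∫⁻ p, f p ∂peyriereMeasure hX ν =
      ∫⁻ ω, ∫⁻ x, f (ω, x) ∂(limitMeasure X ν ω : Measure (SymbolicSpace b)) ∂P :=
  Measure.lintegral_compProd hf

theorem ae_ae_of_ae_peyriereMeasure (hX : IsCascade P ρ X) [IsFiniteMeasure ν]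
    {p : Ω × SymbolicSpace b → Prop} (h : ∀ᵐ q ∂peyriereMeasure hX ν, p q) :
    ∀ᵐ ω ∂P, ∀ᵐ x ∂(limitMeasure X ν ω : Measure (SymbolicSpace b)), p (ω, x) :=
  Measure.ae_ae_of_ae_compProd (κ := limitKernel hX ν) (p := p) h

theorem isProbabilityMeasure_peyriereMeasure (hX : IsCascade P ρ X) [IsProbabilityMeasure ν]
    (hreg : IsQRegular P X ν) : IsProbabilityMeasure (peyriereMeasure hX ν) := by
  constructor
  have h := lintegral_peyriereMeasure hX (ν := ν) (f := fun _ => 1) measurable_const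
  rw [IsQRegular, measure_univ] at hreg
  simpa [hreg] using h

/-- A function of finite level is a finite sum over words of length N, with coefficients in the
level-N σ-algebra; Fatou's lemma against those coefficients applies to each word. -/
theorem lintegral_peyriereMeasure_le (hX : IsCascade P ρ X) [IsProbabilityMeasure ν] {N : ℕ}
    {f : Ω × SymbolicSpace b → ℝ≥0∞} (hf : Measurable f)
    (hmeas : ∀ x, Measurable[wordAlgebra X {u | u.length ≤ N}] fun ω => f (ω, x))
    (hdep : ∀ ω x y, firstLetters N x = firstLetters N y → f (ω, x) = f (ω, y)) :
    ∫⁻ p, f p ∂peyriereMeasure hX ν ≤ ∫⁻ p, f p ∂levelMeasure P X ν N := by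
  classical
  let F : (Fin N → Fin b) → Ω → ℝ≥0∞ := fun v ω =>
    if h : ∃ x : SymbolicSpace b, firstLetters N x = v then f (ω, h.choose) else 0
  have hF : ∀ ω x, f (ω, x) = F (firstLetters N x) ω := by
    intro ω x
    have h : ∃ y : SymbolicSpace b, firstLetters N y = firstLetters N x := ⟨x, rfl⟩
    simp only [F, dif_pos h]
    exact hdep ω _ _ h.choose_spec.symm
  have hFm : ∀ v, Measurable[wordAlgebra X {u | u.length ≤ N}] (F v) := by
    intro v
    by_cases h : ∃ x : SymbolicSpace b, firstLetters N x = v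
    · simp only [F, dif_pos h]
      exact hmeas _
    · simp only [F, dif_neg h]
      exact measurable_const
  have hFm' : ∀ v, Measurable (F v) := fun v => (hFm v).mono (hX.wordAlgebra_le _) le_rfl
  have hlim : ∀ v : Fin N → Fin b, Measurable fun ω =>
      (limitMeasure X ν ω : Measure (SymbolicSpace b)) (firstLetters N ⁻¹' {v}) := fun v =>
    (Measure.measurable_coe (measurable_firstLetters N (measurableSet_singleton v))).comp
      hX.measurable_limitMeasure
  calc _ = ∫⁻ ω, ∑ v, F v ω *
        (limitMeasure X ν ω : Measure (SymbolicSpace b)) (firstLetters N ⁻¹' {v}) ∂P := by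
        rw [lintegral_peyriereMeasure hX hf]
        refine lintegral_congr fun ω => ?_
        simp_rw [hF ω]
        exact lintegral_firstLetters _ N fun v => F v ω
    _ = ∑ v, ∫⁻ ω, F v ω *
        (limitMeasure X ν ω : Measure (SymbolicSpace b)) (firstLetters N ⁻¹' {v}) ∂P :=
        lintegral_finsetSum _ fun v _ => (hFm' v).mul (hlim v)
    _ ≤ ∑ v, ∫⁻ ω, F v ω * cascadeMass X ν N (firstLetters N ⁻¹' {v}) ω ∂P :=
        Finset.sum_le_sum fun v _ =>
          hX.lintegral_mul_limitMeasure_le (hFm v) (isClopen_preimage_firstLetters N v)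
    _ = ∫⁻ ω, ∑ v, F v ω * cascadeMass X ν N (firstLetters N ⁻¹' {v}) ω ∂P :=
        (lintegral_finsetSum _ fun v _ => (hFm' v).mul (hX.measurable_mass N _)).symm
    _ = ∫⁻ ω, ∫⁻ x, f (ω, x) ∂(cascadeMeasure X ν N ω : Measure (SymbolicSpace b)) ∂P := by
        refine lintegral_congr fun ω => ?_
        simp_rw [hF ω]
        rw [lintegral_firstLetters _ N fun v => F v ω]
        refine Finset.sum_congr rfl fun v _ => ?_
        rw [cascadeMeasure_apply N ω (measurable_firstLetters N (measurableSet_singleton v))]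
    _ = _ := by
        rw [hX.lintegral_levelMeasure N hf]
        refine lintegral_congr fun ω => ?_
        exact lintegral_withDensity_eq_lintegral_mul _
          ((hX.measurable_density_coe N).comp measurable_prodMk_left)
          (hf.comp measurable_prodMk_left)

theorem peyriereMeasure_le (hX : IsCascade P ρ X) [IsProbabilityMeasure ν] {N : ℕ}
    {A : Set (Ω × SymbolicSpace b)} (hA : MeasurableSet A)
    (hmeas : ∀ x, MeasurableSet[wordAlgebra X {u | u.length ≤ N}] {ω | (ω, x) ∈ A})
    (hdep : ∀ ω x y, firstLetters N x = firstLetters N y → ((ω, x) ∈ A ↔ (ω, y) ∈ A)) :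
    peyriereMeasure hX ν A ≤ levelMeasure P X ν N A := by
  rw [← lintegral_indicator_one hA, ← lintegral_indicator_one hA]
  refine lintegral_peyriereMeasure_le hX (measurable_one.indicator hA) (fun x => ?_)
    fun ω x y h => ?_
  · exact Measurable.indicator (m := wordAlgebra X {u | u.length ≤ N}) measurable_const (hmeas x)
  · by_cases hx : (ω, x) ∈ A
    · simp [hx, (hdep ω x y h).1 hx]
    · simp [hx, mt (hdep ω x y h).2 hx]

/-- Under regularity both measures have total mass 1, so the inequality for the complement of `A`
gives the reverse inequality for `A`. -/
theorem peyriereMeasure_eq (hX : IsCascade P ρ X) [IsProbabilityMeasure ν]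
    (hreg : IsQRegular P X ν) {N : ℕ} {A : Set (Ω × SymbolicSpace b)} (hA : MeasurableSet A)
    (hmeas : ∀ x, MeasurableSet[wordAlgebra X {u | u.length ≤ N}] {ω | (ω, x) ∈ A})
    (hdep : ∀ ω x y, firstLetters N x = firstLetters N y → ((ω, x) ∈ A ↔ (ω, y) ∈ A)) :
    peyriereMeasure hX ν A = levelMeasure P X ν N A := by
  have := isProbabilityMeasure_peyriereMeasure hX hreg
  have := hX.isProbabilityMeasure_levelMeasure (ν := ν) N
  refine le_antisymm (peyriereMeasure_le hX hA hmeas hdep) ?_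
  have h := peyriereMeasure_le (ν := ν) hX hA.compl (fun x => (hmeas x).compl)
    fun ω x y hxy => not_congr (hdep ω x y hxy)
  rw [prob_compl_eq_one_sub (μ := peyriereMeasure hX ν) hA,
    prob_compl_eq_one_sub (μ := levelMeasure P X ν N) hA] at h
  exact (ENNReal.sub_le_sub_iff_left (prob_le_one (μ := levelMeasure P X ν N)) ENNReal.one_ne_top).1 h

theorem peyriereMeasure_spine (hX : IsCascade P ρ X) [IsProbabilityMeasure ν]
    (hreg : IsQRegular P X ν) {N : ℕ} {A : Set (SymbolicSpace b × (ℕ → ℝ≥0))}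
    (hA : MeasurableSet A)
    (hdep : ∀ x x', ∀ y y' : ℕ → ℝ≥0, firstLetters N x = firstLetters N x' →
      (∀ k < N, y k = y' k) → ((x, y) ∈ A ↔ (x', y') ∈ A)) :
    peyriereMeasure hX ν {p | (p.2, spine X p.2 p.1) ∈ A} = (ν.prod (pathLaw ρ)) A := by
  have hmeas : Measurable fun p : Ω × SymbolicSpace b => (p.2, spine X p.2 p.1) :=
    measurable_snd.prodMk hX.measurable_uncurry_spine
  rw [← hX.levelMeasure_spine (N := N) hA fun x y z h => hdep x x y z rfl h]
  refine peyriereMeasure_eq hX hreg (hmeas hA) (fun x => ?_) fun ω x y hxy => ?_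
  · let m := wordAlgebra X {u | u.length ≤ N}
    -- The whole spine is not measurable at level N, but `A` only sees its first N terms, so the
    -- spine may be cut off there.
    let g : Ω → ℕ → ℝ≥0 := fun ω k => if k < N then spine X x ω k else 0
    have hg : Measurable[m] g := by
      refine (@measurable_pi_iff _ _ _ m _ _).2 fun k => ?_
      by_cases hk : k < N
      · simp only [g, if_pos hk]
        refine measurable_wordAlgebra ?_ (prefixWord_succ_ne_nil x k)
        change (prefixWord x (k + 1)).length ≤ N
        rw [length_prefixWord]
        exact hk
      · simp only [g, if_neg hk]
        exact measurable_const
    have h1 : {ω | (ω, x) ∈ {p : Ω × SymbolicSpace b | (p.2, spine X p.2 p.1) ∈ A}} =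
        g ⁻¹' (Prod.mk x ⁻¹' A) := by
      ext ω
      exact hdep x x _ _ rfl fun k hk => by simp [g, hk]
    rw [h1]
    exact hg (measurable_prodMk_left hA)
  · refine hdep x y _ _ hxy fun k hk => ?_
    have h1 : x ∈ cylinder y (k + 1) := cylinder_anti y hk (firstLetters_eq_iff.1 hxy)
    simp only [spine]
    rw [show prefixWord x (k + 1) = prefixWord y (k + 1) from h1]

/-- Together with the law of the weights below, this transfers almost sure statements about the ray
and about its weights to Q·ν. -/
theorem map_snd_peyriereMeasure (hX : IsCascade P ρ X) [IsProbabilityMeasure ν]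
    (hreg : IsQRegular P X ν) : (peyriereMeasure hX ν).map Prod.snd = ν := by
  have := isProbabilityMeasure_peyriereMeasure hX hreg
  have := hX.isProbabilityMeasure_pathLaw
  have := Measure.isProbabilityMeasure_map (μ := peyriereMeasure hX ν)
    measurable_snd.aemeasurable
  refine measure_ext_of_cylinder fun x n => ?_
  rw [Measure.map_apply measurable_snd (measurableSet_cylinder x n)]
  have h := peyriereMeasure_spine hX (ν := ν) hreg (N := n) (A := cylinder x n ×ˢ Set.univ)
    ((measurableSet_cylinder x n).prod MeasurableSet.univ) fun z z' _ _ hz _ => by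
      simp [← firstLetters_eq_iff, hz]
  rw [Measure.prod_prod, measure_univ, mul_one] at h
  rw [← h]
  congr 1
  ext p
  simp

theorem map_spine_peyriereMeasure (hX : IsCascade P ρ X) [IsProbabilityMeasure ν]
    (hreg : IsQRegular P X ν) :
    (peyriereMeasure hX ν).map (fun p => spine X p.2 p.1) = pathLaw ρ := by
  have := hX.isProbabilityMeasure_sizeBiased
  have := hX.isProbabilityMeasure_pathLaw
  refine Measure.eq_infinitePi _ fun s t ht => ?_
  have hmeas : MeasurableSet ((s : Set ℕ).pi t) :=
    MeasurableSet.pi s.countable_toSet fun i _ => ht i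
  rw [Measure.map_apply hX.measurable_uncurry_spine hmeas]
  have h := peyriereMeasure_spine hX (ν := ν) hreg (N := s.sup id + 1)
    (A := Set.univ ×ˢ (s : Set ℕ).pi t) (MeasurableSet.univ.prod hmeas) fun _ _ y y' _ hy => by
      simp only [Set.mem_prod, Set.mem_univ, true_and, Set.mem_pi]
      refine forall₂_congr fun i hi => ?_
      rw [hy i (Nat.lt_succ_of_le (Finset.le_sup (f := id) hi))]
  rw [Measure.prod_prod, measure_univ, one_mul, pathLaw, Measure.infinitePi_pi _ fun i _ => ht i] at h
  rw [← h]
  congr 1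
  ext p
  simp

theorem ae_peyriereMeasure_snd (hX : IsCascade P ρ X) [IsProbabilityMeasure ν]
    (hreg : IsQRegular P X ν) {p : SymbolicSpace b → Prop} (h : ∀ᵐ x ∂ν, p x) :
    ∀ᵐ q ∂peyriereMeasure hX ν, p q.2 := by
  rw [← map_snd_peyriereMeasure hX hreg] at h
  exact ae_of_ae_map measurable_snd.aemeasurable h

theorem ae_peyriereMeasure_spine (hX : IsCascade P ρ X) [IsProbabilityMeasure ν]
    (hreg : IsQRegular P X ν) {p : (ℕ → ℝ≥0) → Prop} (h : ∀ᵐ y ∂pathLaw ρ, p y) :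
    ∀ᵐ q ∂peyriereMeasure hX ν, p (spine X q.2 q.1) := by
  rw [← map_spine_peyriereMeasure hX hreg] at h
  exact ae_of_ae_map hX.measurable_uncurry_spine.aemeasurable h

end Cascade

end MandelbrotCascade

namespace MandelbrotCascade

variable {b : ℕ} {Ω : Type*} {X : List (Fin b) → Ω → ℝ≥0} {ν : Measure (SymbolicSpace b)}

/-! ### Local estimates for the limit measure -/

theorem cascadeMass_univ_eq_sum [IsFiniteMeasure ν] (N n : ℕ) (ω : Ω) :
    cascadeMass X ν N Set.univ ω =
      ∑ v : Fin n → Fin b, cascadeMass X ν N (firstLetters n ⁻¹' {v}) ω := by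
  rw [← cascadeMeasure_apply N ω MeasurableSet.univ]
  have h := lintegral_firstLetters (cascadeMeasure X ν N ω : Measure (SymbolicSpace b)) n
    fun _ => 1
  simp only [lintegral_const, one_mul] at h
  rw [h]
  exact Finset.sum_congr rfl fun v _ =>
    cascadeMeasure_apply N ω (measurable_firstLetters n (measurableSet_singleton v))

section Cascade

variable [MeasurableSpace Ω] {P : Measure Ω} {ρ : Measure ℝ≥0}

theorem IsCascade.measurable_uncurry_limitMeasure_cylinder (hX : IsCascade P ρ X)
    [IsFiniteMeasure ν] (n : ℕ) :
    Measurable fun p : Ω × SymbolicSpace b =>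
      (limitMeasure X ν p.1 : Measure (SymbolicSpace b)) (cylinder p.2 n) := by
  simp_rw [cylinder_eq_preimage]
  exact measurable_comp_firstLetters (G := fun v ω =>
    (limitMeasure X ν ω : Measure (SymbolicSpace b)) (firstLetters n ⁻¹' {v})) fun v =>
      (Measure.measurable_coe (measurable_firstLetters n (measurableSet_singleton v))).comp
        hX.measurable_limitMeasure

variable [IsProbabilityMeasure P]

/-- The limit measure is seldom much smaller than the approximating measure. -/
theorem peyriereMeasure_limitMeasure_lt_le (hX : IsCascade P ρ X) [IsProbabilityMeasure ν]
    (n : ℕ) (c : ℝ≥0∞) :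
    peyriereMeasure hX ν {p | (limitMeasure X ν p.1 : Measure (SymbolicSpace b)) (cylinder p.2 n) <
      c * cascadeMass X ν n (cylinder p.2 n) p.1} ≤ c := by
  classical
  have hA : MeasurableSet {p : Ω × SymbolicSpace b |
      (limitMeasure X ν p.1 : Measure (SymbolicSpace b)) (cylinder p.2 n) <
      c * cascadeMass X ν n (cylinder p.2 n) p.1} :=
    measurableSet_lt (hX.measurable_uncurry_limitMeasure_cylinder n)
      ((hX.measurable_uncurry_mass_cylinder n n).const_mul c)
  rw [← lintegral_indicator_one hA, lintegral_peyriereMeasure hX (measurable_one.indicator hA)]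
  calc _ ≤ ∫⁻ ω, c * cascadeMass X ν n Set.univ ω ∂P := by
        refine lintegral_mono fun ω => ?_
        let μ : Measure (SymbolicSpace b) := limitMeasure X ν ω
        let g : (Fin n → Fin b) → ℝ≥0∞ := fun v =>
          if μ (firstLetters n ⁻¹' {v}) < c * cascadeMass X ν n (firstLetters n ⁻¹' {v}) ω
          then 1 else 0
        have hg : ∀ x, {p : Ω × SymbolicSpace b |
            (limitMeasure X ν p.1 : Measure (SymbolicSpace b)) (cylinder p.2 n) <
            c * cascadeMass X ν n (cylinder p.2 n) p.1}.indicator 1 (ω, x) =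
            g (firstLetters n x) := by
          intro x
          simp only [g, μ, Set.indicator_apply, Set.mem_ofPred_eq, Pi.one_apply,
            cylinder_eq_preimage]
        simp_rw [hg]
        -- Word by word: a cylinder counts only if its limit mass is below c times its level-n mass,
        -- so the counted limit mass is at most c M_n.
        rw [lintegral_firstLetters _ n g, cascadeMass_univ_eq_sum n n, Finset.mul_sum]
        refine Finset.sum_le_sum fun v _ => ?_
        simp only [g]
        split_ifs with h
        · rw [one_mul]
          exact h.le
        · simp
    _ = c := by
        rw [lintegral_const_mul _ (hX.measurable_mass n _), hX.lintegral_mass, measure_univ,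
          mul_one]

/-- Borel–Cantelli with the exceptional factors c = e^{-εn}, which are summable. -/
theorem ae_eventually_le_limitMeasure (hX : IsCascade P ρ X) [IsProbabilityMeasure ν] {ε : ℝ}
    (hε : 0 < ε) :
    ∀ᵐ q ∂peyriereMeasure hX ν, ∀ᶠ n in atTop,
      expDecay ε n * (cascadeDensity X n q.1 q.2 * ν (cylinder q.2 n)) ≤
        (limitMeasure X ν q.1 : Measure (SymbolicSpace b)) (cylinder q.2 n) := by
  have hbound : ∀ n, peyriereMeasure hX ν
      {p | (limitMeasure X ν p.1 : Measure (SymbolicSpace b)) (cylinder p.2 n) <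
        expDecay ε n * cascadeMass X ν n (cylinder p.2 n) p.1} ≤ expDecay ε n := fun n =>
    peyriereMeasure_limitMeasure_lt_le hX n _
  filter_upwards [ae_eventually_notMem (ne_top_of_le_ne_top (tsum_expDecay_ne_top hε)
    (ENNReal.tsum_le_tsum hbound))] with q hq
  filter_upwards [hq] with n hn
  rw [← cascadeMass_cylinder]
  exact not_lt.1 hn

/-- Cylinders are clopen, so if the limit mass exceeds t then so do the level-N masses for all large
N. The event therefore lies in an increasing union of intersections of level-N events, each
controlled by the conditional Markov inequality. -/
theorem mul_peyriereMeasure_le (hX : IsCascade P ρ X) [IsProbabilityMeasure ν] (n : ℕ)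
    (s t : ℝ≥0∞) :
    t * peyriereMeasure hX ν
      {p | t < (limitMeasure X ν p.1 : Measure (SymbolicSpace b)) (cylinder p.2 n) ∧
        ∀ N, spineSum ν n N p.2 (spine X p.2 p.1) ≤ s} ≤ s := by
  let A : ℕ → Set (Ω × SymbolicSpace b) := fun N =>
    {p | t < cascadeMass X ν N (cylinder p.2 n) p.1 ∧
      spineSum ν n N p.2 (spine X p.2 p.1) ≤ s}
  let B : ℕ → Set (Ω × SymbolicSpace b) := fun M => ⋂ N ≥ M, A N
  have hA : ∀ N ≥ n, t * peyriereMeasure hX ν (A N) ≤ s := by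
    intro N hN
    refine le_trans ?_ (hX.mul_levelMeasure_le (ν := ν) hN s t)
    refine mul_le_mul' le_rfl (peyriereMeasure_le hX (hX.measurableSet_mass_spineSum n N s t)
      (fun x => ?_) fun ω x y hxy => ?_)
    · let m := wordAlgebra X {u | u.length ≤ N}
      have h1 : Measurable[m] fun ω => spineSum ν n N x (spine X x ω) := by
        unfold spineSum
        refine Finset.measurable_fun_sum _ fun k hk => Measurable.mul_const ?_ _
        refine measurable_coe_nnreal_ennreal.comp
          ((measurable_cascadeDensity k x).mono (wordAlgebra_mono fun u hu => ?_) le_rfl)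
        exact le_trans hu (Finset.mem_Icc.1 hk).2
      exact MeasurableSet.inter (m := m)
        (measurable_cascadeMass N (cylinder x n) measurableSet_Ioi)
        (h1 measurableSet_Iic)
    · have hc : ∀ k ≤ N, x ∈ cylinder y k := fun k hk =>
        cylinder_anti y hk (firstLetters_eq_iff.1 hxy)
      have h1 : spineSum ν n N x (spine X x ω) = spineSum ν n N y (spine X y ω) := by
        refine Finset.sum_congr rfl fun k hk => ?_
        have hk' := hc k (Finset.mem_Icc.1 hk).2
        rw [partialProd_spine, partialProd_spine, cascadeDensity_congr hk',
          cylinder_eq_of_mem hk']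
      change _ ∧ _ ↔ _ ∧ _
      rw [h1, cylinder_eq_of_mem (hc n hN)]
  have hsub : {p : Ω × SymbolicSpace b |
      t < (limitMeasure X ν p.1 : Measure (SymbolicSpace b)) (cylinder p.2 n) ∧
        ∀ N, spineSum ν n N p.2 (spine X p.2 p.1) ≤ s} ⊆ ⋃ M, B M := by
    rintro p ⟨h1, h2⟩
    -- Where the weak limit fails to exist the limit measure is 0 by convention, and it cannot
    -- exceed t.
    rcases tendsto_limitMeasure_or_eq_zero (X := X) (ν := ν) p.1 with h | ⟨-, h⟩
    · obtain ⟨M, hM⟩ := eventually_atTop.1 ((tendsto_cascadeMass h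
        (isClopen_cylinder p.2 n)).eventually (lt_mem_nhds h1))
      exact Set.mem_iUnion.2 ⟨M, Set.mem_iInter₂.2 fun N hN => ⟨hM N hN, h2 N⟩⟩
    · simp [h] at h1
  have hB : Monotone B := fun M M' hMM' =>
    Set.biInter_mono (fun N hN => le_trans hMM' hN) fun _ _ => subset_rfl
  calc _ ≤ t * peyriereMeasure hX ν (⋃ M, B M) := by gcongr
    _ = ⨆ M, t * peyriereMeasure hX ν (B M) := by
        rw [hB.measure_iUnion, ENNReal.mul_iSup]
    _ ≤ s := iSup_le fun M => (mul_le_mul' le_rfl (measure_mono (Set.iInter₂_subset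
        (max M n) (le_max_left M n)))).trans (hA _ (le_max_right M n))

theorem ae_eventually_limitMeasure_le (hX : IsCascade P ρ X) [IsProbabilityMeasure ν] {δ ε : ℝ}
    (hδ : 0 < δ) (hε : 0 < ε) :
    ∀ᵐ q ∂peyriereMeasure hX ν, (∀ᶠ n in atTop, ∀ N, spineSum ν n N q.2 (spine X q.2 q.1) ≤
        expDecay δ n * ∑' k, expDecay δ k) →
      ∀ᶠ n in atTop, (limitMeasure X ν q.1 : Measure (SymbolicSpace b)) (cylinder q.2 n) ≤
        expDecay (δ - ε) n := by
  set C := ∑' k, expDecay δ k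
  have hC : C ≠ ∞ := tsum_expDecay_ne_top hδ
  -- The thresholds s = C e^{-δn} and t = e^{-(δ-ε)n} have the summable ratio C e^{-εn}.
  have hbound : ∀ n, peyriereMeasure hX ν {p | expDecay (δ - ε) n <
      (limitMeasure X ν p.1 : Measure (SymbolicSpace b)) (cylinder p.2 n) ∧
        ∀ N, spineSum ν n N p.2 (spine X p.2 p.1) ≤ expDecay δ n * C} ≤ C * expDecay ε n := by
    intro n
    have h := mul_peyriereMeasure_le hX (ν := ν) n (expDecay δ n * C) (expDecay (δ - ε) n)
    refine (ENNReal.mul_le_mul_iff_right (expDecay_pos (δ - ε) n).ne' (expDecay_ne_top _ _)).1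
      (h.trans_eq ?_)
    rw [mul_comm C, ← mul_assoc, ← expDecay_add, sub_add_cancel]
  have hsum : ∑' n, C * expDecay ε n ≠ ∞ := by
    rw [ENNReal.tsum_mul_left]
    exact ENNReal.mul_ne_top hC (tsum_expDecay_ne_top hε)
  filter_upwards [ae_eventually_notMem
    (ne_top_of_le_ne_top hsum (ENNReal.tsum_le_tsum hbound))] with q hq hs
  filter_upwards [hq, hs] with n hn hsn
  by_contra hlt
  exact hn ⟨not_le.1 hlt, hsn⟩

end Cascade

end MandelbrotCascade

namespace MandelbrotCascade

variable {b : ℕ} {Ω : Type*} {X : List (Fin b) → Ω → ℝ≥0} {ν : Measure (SymbolicSpace b)}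

/-! ### Dimensions of the limit measure -/

theorem coe_ennreal_lt_coe_iff {m : ℝ≥0∞} {r : ℝ} :
    (m : EReal) < (r : EReal) ↔ m < ENNReal.ofReal r := by
  rw [← EReal.coe_ennreal_lt_coe_ennreal_iff, EReal.coe_ennreal_ofReal]
  rcases le_total 0 r with h | h
  · rw [max_eq_left h]
  · rw [max_eq_right h]
    refine iff_of_false (not_lt.2 ?_) (not_lt.2 (EReal.coe_ennreal_nonneg m))
    exact le_trans (by exact_mod_cast h) (EReal.coe_ennreal_nonneg m)

theorem cascadeEntropy_ne_bot {ρ : Measure ℝ≥0} [IsProbabilityMeasure ρ] :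
    cascadeEntropy ρ ≠ ⊥ := by
  rw [cascadeEntropy, sub_eq_add_neg, Ne, EReal.add_eq_bot_iff, not_or]
  refine ⟨EReal.coe_ennreal_ne_bot _, ?_⟩
  rw [EReal.neg_eq_bot_iff, EReal.coe_ennreal_eq_top_iff]
  exact lintegral_neg_entropy_ne_top

section Cascade

variable [MeasurableSpace Ω] {P : Measure Ω} {ρ : Measure ℝ≥0} [IsProbabilityMeasure P]

/-- The strict inequality at a single point excludes h_X = ∞, and the negative part of X log X is
always integrable. -/
theorem IsCascade.exists_cascadeEntropy_eq_coe (hX : IsCascade P ρ X) [IsProbabilityMeasure ν]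
    (h : ∀ᵐ x ∂ν, cascadeEntropy ρ < lowerLocalDim ν x) :
    ∃ η : ℝ, cascadeEntropy ρ = η := by
  have := hX.isProbabilityMeasure_law (ν := ν)
  obtain ⟨x, hx⟩ := h.exists
  exact ⟨_, (EReal.coe_toReal (hx.trans_le le_top).ne cascadeEntropy_ne_bot).symm⟩

theorem ae_lowerLocalDim_sub_le (hX : IsCascade P ρ X) [IsProbabilityMeasure ν]
    (h : ∀ᵐ x ∂ν, cascadeEntropy ρ < lowerLocalDim ν x) :
    ∀ᵐ q ∂peyriereMeasure hX ν, lowerLocalDim ν q.2 - cascadeEntropy ρ ≤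
      lowerLocalDim (limitMeasure X ν q.1 : Measure (SymbolicSpace b)) q.2 := by
  have hreg := hX.isQRegular h
  obtain ⟨η, hη⟩ := hX.exists_cascadeEntropy_eq_coe h
  have key : ∀ᵐ q ∂peyriereMeasure hX ν, ∀ a c ε : ℚ, 0 < (a : ℝ) - c → 0 < (ε : ℝ) →
      (∀ᶠ n in atTop, ∀ N, spineSum ν n N q.2 (spine X q.2 q.1) ≤
        expDecay (a - c) n * ∑' k, expDecay (a - c) k) →
      ∀ᶠ n in atTop, (limitMeasure X ν q.1 : Measure (SymbolicSpace b)) (cylinder q.2 n) ≤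
        expDecay (a - c - ε) n := by
    refine ae_all_iff.2 fun a => ae_all_iff.2 fun c => ae_all_iff.2 fun ε => ?_
    by_cases hac : 0 < (a : ℝ) - c
    · by_cases hε : 0 < (ε : ℝ)
      · filter_upwards [ae_eventually_limitMeasure_le hX (ν := ν) hac hε] with q hq _ _ using hq
      · exact ae_of_all _ fun q _ h0 => absurd h0 hε
    · exact ae_of_all _ fun q h0 => absurd h0 hac
  filter_upwards [key, ae_peyriereMeasure_snd hX hreg h,
    ae_peyriereMeasure_spine hX hreg (hX.ae_forall_eventually_le (ν := ν))] with q hq hx hy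
  rw [hη] at hx hy ⊢
  refine EReal.ge_of_forall_gt_iff_ge.1 fun r hr => ?_
  -- The geometric tail needs a > c, so r is replaced by max r 0; for r ≤ 0 the inequality is the
  -- hypothesis on the local dimension. The rationals then satisfy η < c < a - max r 0 and 0 < ε < a
  -- - c - max r 0, so that a - c - ε > r.
  have hr' : ((max r 0 + η : ℝ) : EReal) < lowerLocalDim ν q.2 := by
    rcases le_total r 0 with h0 | h0
    · rwa [max_eq_right h0, zero_add]
    · rw [max_eq_left h0, EReal.coe_add]
      exact (EReal.lt_sub_iff_add_lt (Or.inl (EReal.coe_ne_bot _))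
        (Or.inl (EReal.coe_ne_top _))).1 hr
  obtain ⟨a, ha1, ha2⟩ := EReal.lt_iff_exists_rat_btwn.1 hr'
  have ha1 : max r 0 + η < a := by exact_mod_cast ha1
  obtain ⟨c, hc1, hc2⟩ := exists_rat_btwn (show η < a - max r 0 by linarith)
  obtain ⟨ε, hε1, hε2⟩ := exists_rat_btwn (show 0 < a - c - max r 0 by linarith)
  have hac : 0 < (a : ℝ) - c := by linarith [le_max_right r 0]
  have h1 := hq a c ε hac hε1 (eventually_spineSum_le (eventually_of_lt_lowerLocalDim ha2)
    (hy c (by exact_mod_cast hc1)))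
  refine le_trans ?_ (le_lowerLocalDim_of_eventually h1)
  have : r ≤ a - c - ε := by linarith [le_max_left r 0]
  exact_mod_cast this

/-- For D above the packing dimension of ν, c < h_X and ε > 0, eventually (Q·ν)([x|_n]) ≥ e^{-εn}
e^{cn} e^{-Dn}. Optimising over rational D, c, ε gives the bound. -/
theorem ae_upperPackingDim_le (hX : IsCascade P ρ X) [IsProbabilityMeasure ν]
    (h : ∀ᵐ x ∂ν, cascadeEntropy ρ < lowerLocalDim ν x) :
    ∀ᵐ ω ∂P, limitMeasure X ν ω ≠ 0 →
      (upperPackingDim (limitMeasure X ν ω : Measure (SymbolicSpace b)) : EReal) ≤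
        (upperPackingDim ν : EReal) - cascadeEntropy ρ := by
  have hreg := hX.isQRegular h
  obtain ⟨η, hη⟩ := hX.exists_cascadeEntropy_eq_coe h
  have key : ∀ D c ε : ℚ, ∀ᵐ ω ∂P, upperPackingDim ν < ENNReal.ofReal D → (c : ℝ) < η →
      0 < (ε : ℝ) → ∀ᵐ x ∂(limitMeasure X ν ω : Measure (SymbolicSpace b)), ∀ᶠ n in atTop,
        expDecay (D - c + ε) n ≤
          (limitMeasure X ν ω : Measure (SymbolicSpace b)) (cylinder x n) := by
    intro D c ε
    by_cases hD : upperPackingDim ν < ENNReal.ofReal D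
    · by_cases hε : 0 < (ε : ℝ)
      · have h1 : ∀ᵐ q ∂peyriereMeasure hX ν, (c : ℝ) < η → ∀ᶠ n in atTop,
            expDecay (D - c + ε) n ≤
              (limitMeasure X ν q.1 : Measure (SymbolicSpace b)) (cylinder q.2 n) := by
          filter_upwards [ae_eventually_le_limitMeasure hX (ν := ν) hε,
            ae_peyriereMeasure_snd hX hreg (ae_eventually_ge_of_upperPackingDim_lt hD),
            ae_peyriereMeasure_spine hX hreg (hX.ae_forall_eventually_ge (ν := ν))]
            with q hq hx hy hc
          rw [hη] at hy
          filter_upwards [hq, hx, hy c (by exact_mod_cast hc)] with n h2 h3 h4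
          refine le_trans (le_trans (le_of_eq ?_) (mul_le_mul' le_rfl (mul_le_mul' h4 h3))) h2
          rw [← expDecay_add, ← expDecay_add]
          congr 1
          ring
        filter_upwards [ae_ae_of_ae_peyriereMeasure hX h1] with ω hω _ hc _
        filter_upwards [hω] with x hx using hx hc
      · exact ae_of_all _ fun ω _ _ h0 => absurd h0 hε
    · exact ae_of_all _ fun ω h0 => absurd h0 hD
  filter_upwards [ae_all_iff.2 fun D => ae_all_iff.2 fun c => ae_all_iff.2 fun ε => key D c ε]
    with ω hω hne
  have hne' : (limitMeasure X ν ω : Measure (SymbolicSpace b)) ≠ 0 := fun h0 =>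
    hne (Subtype.ext h0)
  have := ae_neBot.2 hne'
  rw [hη]
  refine EReal.le_of_forall_lt_iff_le.1 fun r hr => ?_
  have hr' : (upperPackingDim ν : EReal) < ((r + η : ℝ) : EReal) := by
    rw [EReal.coe_add]
    exact (EReal.sub_lt_iff (Or.inl (EReal.coe_ne_bot _)) (Or.inl (EReal.coe_ne_top _))).1 hr
  obtain ⟨D, hD1, hD2⟩ := EReal.lt_iff_exists_rat_btwn.1 hr'
  have hD2 : (D : ℝ) < r + η := by exact_mod_cast hD2
  obtain ⟨c, hc1, hc2⟩ := exists_rat_btwn (show D - r < η by linarith)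
  obtain ⟨ε, hε1, hε2⟩ := exists_rat_btwn (show 0 < r - D + c by linarith)
  have hD : upperPackingDim ν < ENNReal.ofReal D := coe_ennreal_lt_coe_iff.1 hD1
  have h1 := hω D c ε hD hc2 hε1
  -- A negative exponent would force cylinder masses to exceed the finite total mass. A point where
  -- this happens exists because the limit measure is nonzero.
  rcases lt_or_ge ((D : ℝ) - c + ε) 0 with hneg | hpos
  · exfalso
    obtain ⟨x, hx⟩ := h1.exists
    obtain ⟨n, hn1, hn2⟩ := (hx.and ((tendsto_expDecay_top hneg).eventually (lt_mem_nhds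
      (measure_lt_top (limitMeasure X ν ω : Measure (SymbolicSpace b)) Set.univ)))).exists
    exact absurd (hn1.trans (measure_mono (Set.subset_univ _))) (not_le.2 hn2)
  · have h2 := upperPackingDim_le_of_ae_eventually hpos h1
    rw [← EReal.coe_ennreal_le_coe_ennreal_iff, EReal.coe_ennreal_ofReal, max_eq_left hpos] at h2
    refine h2.trans ?_
    have : (D : ℝ) - c + ε ≤ r := by linarith
    exact_mod_cast this

end Cascade

/-! ### Comparison of dimensions and conclusion -/

/-- If q lay strictly between the two dimensions in the wrong order, some point would have μ([x|_n])
≥ e^{-qn} eventually, hence lower local dimension at most q, and also lower local dimension above q.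
Nonvanishing of μ supplies the point. -/
theorem lowerHausdorffDim_le_upperPackingDim {μ : Measure (SymbolicSpace b)} [IsFiniteMeasure μ]
    (hμ : μ ≠ 0) : lowerHausdorffDim μ ≤ upperPackingDim μ := by
  have := ae_neBot.2 hμ
  by_contra! hlt
  rw [← EReal.coe_ennreal_lt_coe_ennreal_iff] at hlt
  obtain ⟨q, hq1, hq2⟩ := EReal.lt_iff_exists_real_btwn.1 hlt
  obtain ⟨x, h1, h2⟩ := ((ae_eventually_ge_of_upperPackingDim_lt
    (coe_ennreal_lt_coe_iff.1 hq1)).and (ae_lowerHausdorffDim_le_lowerLocalDim μ)).exists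
  exact absurd (h2.trans (lowerLocalDim_le_of_frequently h1.frequently)) (not_le.2 hq2)

theorem ae_lowerLocalDim_lt_of_upperHausdorffDim_lt {μ : Measure (SymbolicSpace b)}
    [IsFiniteMeasure μ] {h : EReal} (hμ : (upperHausdorffDim μ : EReal) < h) :
    ∀ᵐ x ∂μ, lowerLocalDim μ x < h := by
  obtain ⟨q, hq1, hq2⟩ := EReal.lt_iff_exists_real_btwn.1 hμ
  have hq1 := coe_ennreal_lt_coe_iff.1 hq1
  simp only [upperHausdorffDim, iInf_lt_iff] at hq1
  obtain ⟨E, -, hE, hlt⟩ := hq1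
  filter_upwards [ae_lowerLocalDim_le_of_dimH hE] with x hx
  exact hx.trans_lt ((coe_ennreal_lt_coe_iff.2 hlt).trans hq2)

theorem ae_lt_lowerLocalDim_of_lt_lowerHausdorffDim {μ : Measure (SymbolicSpace b)}
    [IsFiniteMeasure μ] {h : EReal} (hμ : h < (lowerHausdorffDim μ : EReal)) :
    ∀ᵐ x ∂μ, h < lowerLocalDim μ x := by
  filter_upwards [ae_lowerHausdorffDim_le_lowerLocalDim μ] with x hx using hμ.trans_le hx

/-- The local dimension of ν is at least its lower Hausdorff dimension at almost every ray, also
under the Peyrière measure. The local bound for Q·ν then holds almost everywhere with a constant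
left side, and the mass distribution principle applies. -/
theorem ae_sub_le_lowerHausdorffDim [MeasurableSpace Ω] {P : Measure Ω} {ρ : Measure ℝ≥0}
    [IsProbabilityMeasure P] (hX : IsCascade P ρ X) [IsProbabilityMeasure ν]
    (h : ∀ᵐ x ∂ν, cascadeEntropy ρ < lowerLocalDim ν x) :
    ∀ᵐ ω ∂P, (lowerHausdorffDim ν : EReal) - cascadeEntropy ρ ≤
      (lowerHausdorffDim (limitMeasure X ν ω : Measure (SymbolicSpace b)) : EReal) := by
  have h1 : ∀ᵐ q ∂peyriereMeasure hX ν, (lowerHausdorffDim ν : EReal) - cascadeEntropy ρ ≤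
      lowerLocalDim (limitMeasure X ν q.1 : Measure (SymbolicSpace b)) q.2 := by
    filter_upwards [ae_lowerLocalDim_sub_le hX h, ae_peyriereMeasure_snd hX (hX.isQRegular h)
      (ae_lowerHausdorffDim_le_lowerLocalDim ν)] with q hq hx
    exact (EReal.sub_le_sub hx le_rfl).trans hq
  filter_upwards [ae_ae_of_ae_peyriereMeasure hX h1] with ω hω
  exact le_lowerHausdorffDim_of_ae hω

end MandelbrotCascade

theorem theorem2p2 {Ω : Type*} [MeasurableSpace Ω] (P : Measure Ω) [IsProbabilityMeasure P]
    (b : ℕ) (hb : 2 ≤ b) (ρ : Measure ℝ≥0) (X : List (Fin b) → Ω → ℝ≥0)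
    (hX : IsCascade P ρ X)
    (ν : Measure (SymbolicSpace b)) [IsProbabilityMeasure ν] :
    -- the random measure `Q · ν` is well defined: almost surely the weak limit exists
    (∀ᵐ ω ∂P, Tendsto (fun n => cascadeMeasure X ν n ω) atTop
      (𝓝 (limitMeasure X ν ω))) ∧
    -- (a)
    ((∀ᵐ x ∂ν, cascadeEntropy ρ < lowerLocalDim ν x) →
      IsQRegular P X ν) ∧
    (cascadeEntropy ρ < (lowerHausdorffDim ν : EReal) →
      (∀ᵐ x ∂ν, cascadeEntropy ρ < lowerLocalDim ν x) ∧
      IsQRegular P X ν) ∧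
    -- (b)
    ((∀ᵐ x ∂ν, lowerLocalDim ν x < cascadeEntropy ρ) →
      IsQSingular P X ν) ∧
    ((upperHausdorffDim ν : EReal) < cascadeEntropy ρ →
      (∀ᵐ x ∂ν, lowerLocalDim ν x < cascadeEntropy ρ) ∧
      IsQSingular P X ν) ∧
    -- (c)
    ((∀ᵐ x ∂ν, cascadeEntropy ρ < lowerLocalDim ν x) →
      ∀ᵐ ω ∂P, limitMeasure X ν ω ≠ 0 →
        (lowerHausdorffDim ν : EReal) - cascadeEntropy ρ ≤
          (lowerHausdorffDim
            (limitMeasure X ν ω : Measure (SymbolicSpace b)) : EReal) ∧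
        lowerHausdorffDim
            (limitMeasure X ν ω : Measure (SymbolicSpace b)) ≤
          upperPackingDim
            (limitMeasure X ν ω : Measure (SymbolicSpace b)) ∧
        (upperPackingDim
            (limitMeasure X ν ω : Measure (SymbolicSpace b)) : EReal) ≤
          (upperPackingDim ν : EReal) -
            cascadeEntropy ρ) := by
  exact ⟨hX.ae_tendsto_limitMeasure, hX.isQRegular,
    fun h => ⟨ae_lt_lowerLocalDim_of_lt_lowerHausdorffDim h,
      hX.isQRegular (ae_lt_lowerLocalDim_of_lt_lowerHausdorffDim h)⟩,
    hX.isQSingular,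
    fun h => ⟨ae_lowerLocalDim_lt_of_upperHausdorffDim_lt h,
      hX.isQSingular (ae_lowerLocalDim_lt_of_upperHausdorffDim_lt h)⟩,
    fun h => by
      filter_upwards [ae_sub_le_lowerHausdorffDim hX h, ae_upperPackingDim_le hX h]
        with ω h1 h2 hne
      exact ⟨h1, lowerHausdorffDim_le_upperPackingDim fun h0 => hne (Subtype.ext h0), h2 hne⟩⟩
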